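/- Let $\sigma_x,\lambda,\gamma,\sigma_c>0$ and $\tau\ge 0$ be fixed. Let $\mathbb T^2=(\mathbb R/\mathbb Z)^2$, let $\theta\in\mathbb R/2\pi\mathbb Z$, $v_\theta=(\cos\theta,\sin\theta)$, $v_\theta^\perp=(-\sin\theta,\cos\theta)$. Let $L^2_0$ be the real Hilbert space of square integrable real functions on $\mathbb T^2\times\mathbb R/2\pi\mathbb Z$ with zero average, and $H^2_0\subset L^2_0$ the subspace of functions whose weak derivatives up to order two are in $L^2$. For $\sigma_\theta,\chi>0$ consider the linearization $$\mathrm L_\chi f=\sigma_x\Delta_xf+\sigma_\theta\partial_{\theta\theta}f-\lambda v_\theta\cdot\nabla_xf-\frac{\chi}{2\pi}\,\partial_\theta \mathrm B_\tau[f],\qquad \mathrm B_\tau[f]=v_\theta^\perp\cdot\nabla_xc+\tau\,v_\theta^\perp\cdot(\nabla_x^2c)\,v_\theta,$$ where $c$ solves $\gamma c-\sigma_c\Delta_xc=\int f\,\mathrm d\theta$ on $\mathbb T^2$, as an operator in $L^2_0$ with domain $H^2_0$, and let $\mathrm L_\chi^\star$ be its adjoint. For $\ell\in\mathbb Z^2\setminus\{0\}$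 put $$\hat{\mathsf M}_\ell=4\pi^2\sigma_x|\ell|^2+2\pi i\lambda\,v_\theta\cdot\ell,\qquad \hat{\mathsf B}_\ell=\frac{2\pi i\,v_\theta^\perp\cdot\ell-4\pi^2\tau\,v_\theta^\perp\cdot(\ell\otimes\ell)v_\theta}{\gamma+4\pi^2\sigma_c|\ell|^2},\qquad \mathsf R^\ell=(-\hat{\mathsf M}_\ell+\sigma_\theta\partial_{\theta\theta})^{-1}$$ (the resolvent acting from $L^2(\mathbb R/2\pi\mathbb Z,\mathbb C)$ to $H^2(\mathbb R/2\pi\mathbb Z,\mathbb C)$), and $\hat{\mathsf U}^\ell=\mathsf R^\ell\partial_\theta\hat{\mathsf B}_\ell$, $\hat{\mathsf V}^\ell=-\mathsf R^{-\ell}1$. Define the real functions $$\phi^{\ell}=\hat{\mathsf U}^\ell(\theta)e^{2\pi i\ell\cdot x}+\hat{\mathsf U}^{-\ell}(\theta)e^{-2\pi i\ell\cdot x},\qquad \phi^{\mathrm{bis}\,\ell}=i\hat{\mathsf U}^\ell(\theta)e^{2\pi i\ell\cdot x}-i\hat{\mathsf U}^{-\ell}(\theta)e^{-2\pi i\ell\cdot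 x},$$ and $\psi^\ell$, $\psi^{\mathrm{bis}\,\ell}$ in the same way with $\hat{\mathsf V}$ in place of $\hat{\mathsf U}$ (the bis functions are translates in $x$ of $\phi^\ell$, $\psi^\ell$). **Theorem.** For every integer $k\ge1$ there is $\sigma_\theta^k>0$ such that for every $0<\sigma_\theta<\sigma^k_\theta$ there is $\chi^k>0$ such that $\mathrm L_k=\mathrm L_{\chi^k}$ satisfies $$\dim\ker \mathrm L_k=\dim\ker \mathrm L_k^\star=\dim\operatorname{coker}\mathrm L_k=\operatorname{card}\{\mathbf k\in\mathbb Z^2\setminus\{0\}:|\mathbf k|^2=k^2\},\qquad \operatorname{Range}(\mathrm L_k)^\perp=\ker \mathrm L_k^\star,$$ where $\operatorname{coker}\mathrm L_k=L^2_0/\operatorname{Range}(\mathrm L_k)$ in the dimension identity. If moreover $k$ is non-Pythagorean, that is, $k^2\ne l^2+m^2$ for all integers $l,m\ge1$, then with $\mathbf k_1=(k,0)$ and $\mathbf k_2=(0,k)$, and for the same $\chi^k$, $$\ker \mathrm L_k=\operatorname{span}_{\mathbb R}\{\phi^{\mathbf k_1},\phi^{\mathbf k_2},\phi^{\mathrm{bis}\,\mathbf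 k_1},\phi^{\mathrm{bis}\,\mathbf k_2}\},\qquad \ker \mathrm L_k^\star=\operatorname{Range}(\mathrm L_k)^\perp=\operatorname{span}_{\mathbb R}\{\psi^{\mathbf k_1},\psi^{\mathbf k_2},\psi^{\mathrm{bis}\,\mathbf k_1},\psi^{\mathrm{bis}\,\mathbf k_2}\}.$$ -/

import Mathlib

open scoped LinearPMap

noncomputable section
namespace AntModel
open MeasureTheory Submodule Matrix
open scoped ComplexConjugate

instance factTwoPiPos : Fact (0 < 2 * Real.pi) := ⟨Real.two_pi_pos⟩

/-! ## The tori and the Lebesgue spaces -/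

/-- The unit square torus of positions `x`. -/
abbrev Pos := UnitAddTorus (Fin 2)

/-- The circle of angles `θ`, of length `2π`. -/
abbrev Ang := AddCircle (2 * Real.pi)

/-- The domain of the equation. `volume` on it is Lebesgue measure, of total mass `2π`. -/
abbrev Phase := Pos × Ang

instance isProbPos : IsProbabilityMeasure (volume : Measure Pos) := by
  have : IsProbabilityMeasure (volume : Measure UnitAddCircle) := ⟨UnitAddCircle.measure_univ⟩
  unfold Pos UnitAddTorus
  infer_instance

abbrev L2Pos := Lp ℝ 2 (volume : Measure Pos)
abbrev L2Phase := Lp ℝ 2 (volume : Measure Phase)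
abbrev L2Ang := Lp ℂ 2 (volume : Measure Ang)

lemma integrable_L2Phase (f : L2Phase) : Integrable (f : Phase → ℝ) :=
  (Lp.memLp f).integrable (by norm_num)

lemma integrable_L2Pos (f : L2Pos) : Integrable (f : Pos → ℝ) :=
  (Lp.memLp f).integrable (by norm_num)

/-- The space `L²₀` of square integrable functions with zero average. -/
def L20 : Submodule ℝ L2Phase where
  carrier := {f | ∫ p, f p = 0}
  zero_mem' := by
    change ∫ p, (0 : L2Phase) p = 0
    rw [integral_congr_ae (Lp.coeFn_zero _ _ _)]
    simp
  add_mem' := by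
    intro f g hf hg
    change ∫ p, (f + g : L2Phase) p = 0
    rw [integral_congr_ae (Lp.coeFn_add f g)]
    change ∫ p, (f p + g p) = 0
    rw [integral_add (integrable_L2Phase f) (integrable_L2Phase g)]
    rw [show ∫ p, f p = 0 from hf, show ∫ p, g p = 0 from hg, add_zero]
  smul_mem' := by
    intro c f hf
    change ∫ p, (c • f : L2Phase) p = 0
    rw [integral_congr_ae (Lp.coeFn_smul c f)]
    change ∫ p, c * f p = 0
    rw [integral_const_mul, show ∫ p, f p = 0 from hf, mul_zero]

lemma mem_L20 (f : L2Phase) : f ∈ L20 ↔ ∫ p, f p = 0 := Iff.rfl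

instance completeL20 : CompleteSpace L20 := by
  have h1 : MemLp (fun _ : Phase => (1 : ℝ)) 2 volume := memLp_const 1
  have : (L20 : Set L2Phase) = {f | inner ℝ (h1.toLp) f = 0} := by
    ext f
    have : inner ℝ (h1.toLp) f = ∫ p, f p := by
      rw [L2.inner_def]
      refine integral_congr_ae ?_
      filter_upwards [h1.coeFn_toLp] with p hp
      rw [hp]; simp
    rw [SetLike.mem_coe, mem_L20, Set.mem_ofPred_eq, this]
  have hc : IsClosed (L20 : Set L2Phase) := by
    rw [this]
    exact isClosed_eq (by fun_prop) continuous_const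
  exact hc.completeSpace_coe

/-! ## Fourier coefficients and weak derivatives

On a torus, `g ∈ L²` is the weak derivative of `f ∈ L²` in a coordinate if and only if the
integration by parts formula holds against every character, that is, if and only if the Fourier
coefficients of `g` are those of `f` times the symbol of the derivative. -/

/-- `∫ f(x) e^{-2πi m·x} dx`. -/
def posCoeff (f : Pos → ℝ) (m : Fin 2 → ℤ) : ℂ :=
  ∫ x, UnitAddTorus.mFourier (-m) x * (f x : ℂ)

/-- `∫ f(x,θ) e^{-2πi m·x} e^{-inθ} dx dθ`. -/
def phaseCoeff (f : Phase → ℝ) (m : Fin 2 → ℤ) (n : ℤ) : ℂ :=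
  ∫ p : Phase, UnitAddTorus.mFourier (-m) p.1 * fourier (-n) p.2 * (f p : ℂ)

/-- `∫ u(θ) e^{-inθ} dθ`. -/
def angCoeff (u : Ang → ℂ) (n : ℤ) : ℂ :=
  ∫ θ, fourier (-n) θ * u θ

/-- `g = ∂f/∂x_j` weakly, for functions of `x`. -/
def IsPosDeriv (j : Fin 2) (f g : L2Pos) : Prop :=
  ∀ m, posCoeff g m = 2 * Real.pi * Complex.I * m j * posCoeff f m

/-- The symbols of `∂/∂x₁`, `∂/∂x₂` and `∂/∂θ`; the coordinates `(x₁, x₂, θ)` are numbered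
`0, 1, 2`. -/
def phaseSymbol (m : Fin 2 → ℤ) (n : ℤ) : Fin 3 → ℂ :=
  ![2 * Real.pi * Complex.I * m 0, 2 * Real.pi * Complex.I * m 1, Complex.I * n]

/-- `g` is the weak derivative of `f` in the `j`-th of the coordinates `(x₁, x₂, θ)`. -/
def IsPhaseDeriv (j : Fin 3) (f g : L2Phase) : Prop :=
  ∀ m n, phaseCoeff g m n = phaseSymbol m n j * phaseCoeff f m n

/-- `w = ∂u/∂θ` weakly, for complex functions of `θ`. -/
def IsAngDeriv (u w : L2Ang) : Prop :=
  ∀ n, angCoeff w n = Complex.I * n * angCoeff u n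

/-- `G` consists of the first and `H` of the second weak derivatives of `f`. -/
def HasPhaseDerivs (f : L2Phase) (G : Fin 3 → L2Phase) (H : Fin 3 → Fin 3 → L2Phase) : Prop :=
  (∀ j, IsPhaseDeriv j f (G j)) ∧ ∀ i j, IsPhaseDeriv j (G i) (H i j)

/-- `D` consists of the first and `K` of the second weak derivatives of `c`. -/
def HasPosDerivs (c : L2Pos) (D : Fin 2 → L2Pos) (K : Fin 2 → Fin 2 → L2Pos) : Prop :=
  (∀ j, IsPosDeriv j c (D j)) ∧ ∀ i j, IsPosDeriv j (D i) (K i j)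

lemma phaseCoeff_add (f g : L2Phase) (m : Fin 2 → ℤ) (n : ℤ) :
    phaseCoeff (f + g : L2Phase) m n = phaseCoeff f m n + phaseCoeff g m n := by
  have hi : ∀ f : L2Phase, Integrable (fun p : Phase =>
      UnitAddTorus.mFourier (-m) p.1 * fourier (-n) p.2 * (f p : ℂ)) := by
    intro f
    refine (integrable_L2Phase f).ofReal.bdd_mul (c := 1) ?_ ?_
    · exact (by fun_prop : Continuous fun p : Phase =>
        UnitAddTorus.mFourier (-m) p.1 * fourier (-n) p.2).aestronglyMeasurable
    · refine Filter.Eventually.of_forall fun p => ?_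
      rw [norm_mul]
      exact mul_le_one₀ (((UnitAddTorus.mFourier (-m)).norm_coe_le_norm _).trans
        UnitAddTorus.mFourier_norm.le) (norm_nonneg _)
        (((fourier (-n)).norm_coe_le_norm _).trans (fourier_norm (-n)).le)
  unfold phaseCoeff
  rw [← integral_add (hi f) (hi g)]
  refine integral_congr_ae ?_
  filter_upwards [Lp.coeFn_add f g] with p hp
  rw [hp]; simp [mul_add]

lemma phaseCoeff_smul (a : ℝ) (f : L2Phase) (m : Fin 2 → ℤ) (n : ℤ) :
    phaseCoeff (a • f : L2Phase) m n = a * phaseCoeff f m n := by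
  unfold phaseCoeff
  rw [← integral_const_mul]
  refine integral_congr_ae ?_
  filter_upwards [Lp.coeFn_smul a f] with p hp
  rw [hp]; simp only [Pi.smul_apply, smul_eq_mul, Complex.ofReal_mul]; ring

lemma posCoeff_add (f g : L2Pos) (m : Fin 2 → ℤ) :
    posCoeff (f + g : L2Pos) m = posCoeff f m + posCoeff g m := by
  have hi : ∀ f : L2Pos, Integrable (fun x : Pos => UnitAddTorus.mFourier (-m) x * (f x : ℂ)) := by
    intro f
    refine (integrable_L2Pos f).ofReal.bdd_mul (c := 1) ?_ ?_
    · exact (UnitAddTorus.mFourier (-m)).continuous.aestronglyMeasurable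
    · exact Filter.Eventually.of_forall fun p =>
        ((UnitAddTorus.mFourier (-m)).norm_coe_le_norm _).trans UnitAddTorus.mFourier_norm.le
  unfold posCoeff
  rw [← integral_add (hi f) (hi g)]
  refine integral_congr_ae ?_
  filter_upwards [Lp.coeFn_add f g] with p hp
  rw [hp]; simp [mul_add]

lemma posCoeff_smul (a : ℝ) (f : L2Pos) (m : Fin 2 → ℤ) :
    posCoeff (a • f : L2Pos) m = a * posCoeff f m := by
  unfold posCoeff
  rw [← integral_const_mul]
  refine integral_congr_ae ?_
  filter_upwards [Lp.coeFn_smul a f] with p hp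
  rw [hp]; simp only [Pi.smul_apply, smul_eq_mul, Complex.ofReal_mul]; ring

lemma IsPhaseDeriv.add {j : Fin 3} {f f' g g' : L2Phase} (h : IsPhaseDeriv j f g)
    (h' : IsPhaseDeriv j f' g') : IsPhaseDeriv j (f + f') (g + g') := fun m n => by
  rw [phaseCoeff_add, phaseCoeff_add, h, h', mul_add]

lemma IsPhaseDeriv.smul {j : Fin 3} {f g : L2Phase} (a : ℝ) (h : IsPhaseDeriv j f g) :
    IsPhaseDeriv j (a • f) (a • g) := fun m n => by
  rw [phaseCoeff_smul, phaseCoeff_smul, h]; ring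

lemma IsPosDeriv.add {j : Fin 2} {f f' g g' : L2Pos} (h : IsPosDeriv j f g)
    (h' : IsPosDeriv j f' g') : IsPosDeriv j (f + f') (g + g') := fun m => by
  rw [posCoeff_add, posCoeff_add, h, h', mul_add]

lemma IsPosDeriv.smul {j : Fin 2} {f g : L2Pos} (a : ℝ) (h : IsPosDeriv j f g) :
    IsPosDeriv j (a • f) (a • g) := fun m => by
  rw [posCoeff_smul, posCoeff_smul, h]; ring

lemma HasPhaseDerivs.add {f f' : L2Phase} {G G' : Fin 3 → L2Phase}
    {H H' : Fin 3 → Fin 3 → L2Phase} (h : HasPhaseDerivs f G H) (h' : HasPhaseDerivs f' G' H') :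
    HasPhaseDerivs (f + f') (G + G') (H + H') :=
  ⟨fun j => (h.1 j).add (h'.1 j), fun i j => (h.2 i j).add (h'.2 i j)⟩

lemma HasPhaseDerivs.smul {f : L2Phase} {G : Fin 3 → L2Phase}
    {H : Fin 3 → Fin 3 → L2Phase} (a : ℝ) (h : HasPhaseDerivs f G H) :
    HasPhaseDerivs (a • f) (a • G) (a • H) :=
  ⟨fun j => (h.1 j).smul a, fun i j => (h.2 i j).smul a⟩

lemma HasPosDerivs.add {f f' : L2Pos} {G G' : Fin 2 → L2Pos}
    {H H' : Fin 2 → Fin 2 → L2Pos} (h : HasPosDerivs f G H) (h' : HasPosDerivs f' G' H') :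
    HasPosDerivs (f + f') (G + G') (H + H') :=
  ⟨fun j => (h.1 j).add (h'.1 j), fun i j => (h.2 i j).add (h'.2 i j)⟩

lemma HasPosDerivs.smul {f : L2Pos} {G : Fin 2 → L2Pos}
    {H : Fin 2 → Fin 2 → L2Pos} (a : ℝ) (h : HasPosDerivs f G H) :
    HasPosDerivs (a • f) (a • G) (a • H) :=
  ⟨fun j => (h.1 j).smul a, fun i j => (h.2 i j).smul a⟩

/-- The Sobolev space `H²₀`: functions in `L²₀` with all weak derivatives up to order two in
`L²`. -/
def H20 : Submodule ℝ L20 where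
  carrier := {f | ∃ G H, HasPhaseDerivs f G H}
  zero_mem' := by
    have h0 : ∀ m n, phaseCoeff (0 : L2Phase) m n = 0 := fun m n => by
      simpa using phaseCoeff_smul 0 (0 : L2Phase) m n
    have h1 : ∀ j, IsPhaseDeriv j 0 0 := fun j m n => by rw [h0, mul_zero]
    exact ⟨0, 0, fun j => h1 j, fun _ j => h1 j⟩
  add_mem' := fun ⟨_, _, h⟩ ⟨_, _, h'⟩ => ⟨_, _, h.add h'⟩
  smul_mem' := fun a _ ⟨_, _, h⟩ => ⟨_, _, h.smul a⟩

/-! ## The linearized operator -/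

def cosA (θ : Ang) : ℝ := (AddCircle.toCircle θ : ℂ).re
def sinA (θ : Ang) : ℝ := (AddCircle.toCircle θ : ℂ).im

lemma cosA_coe (t : ℝ) : cosA (t : Ang) = Real.cos t := by
  simp [cosA, AddCircle.toCircle_apply_mk, Circle.coe_exp, Complex.exp_ofReal_mul_I_re]

lemma sinA_coe (t : ℝ) : sinA (t : Ang) = Real.sin t := by
  simp [sinA, AddCircle.toCircle_apply_mk, Circle.coe_exp, Complex.exp_ofReal_mul_I_im]

/-- The unit vector `v_θ = (cos θ, sin θ)`. -/
def dir (θ : Ang) : Fin 2 → ℝ := ![cosA θ, sinA θ]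

/-- The rotated unit vector `v_θ^⊥ = (-sin θ, cos θ)`. -/
def dirPerp (θ : Ang) : Fin 2 → ℝ := ![-sinA θ, cosA θ]

/-- The derivative of a differentiable function on the circle. -/
def angleDeriv {V : Type*} [NormedAddCommGroup V] [NormedSpace ℝ V] (F : Ang → V) (θ : Ang) : V :=
  deriv (fun t : ℝ => F (θ + (t : Ang))) 0

/-- `v_θ^⊥ · d + τ v_θ^⊥ · (K v_θ)`, which is the turning rate `B_τ` of a chemical field with
gradient `d` and Hessian `K`. -/
def turning (τ : ℝ) (d : Fin 2 → ℝ) (K : Matrix (Fin 2) (Fin 2) ℝ) (θ : Ang) : ℝ :=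
  dirPerp θ ⬝ᵥ d + τ * (dirPerp θ ⬝ᵥ (K *ᵥ dir θ))

/-- `c`, with gradient `D` and Hessian `K`, is the solution in `H²` of
`γ c - σ_c Δ c = ∫ f dθ`. -/
def IsPotential (γ σc : ℝ) (f : L2Phase) (c : L2Pos) (D : Fin 2 → L2Pos)
    (K : Fin 2 → Fin 2 → L2Pos) : Prop :=
  HasPosDerivs c D K ∧
    ∀ᵐ x : Pos, γ * c x - σc * (K 0 0 x + K 1 1 x) = ∫ θ : Ang, f (x, θ)

/-- The value of
`σ_x Δ_x f + σ_θ ∂_θθ f - λ v_θ · ∇_x f - (χ / 2π) ∂_θ B_τ[f]`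
in terms of the derivatives `G`, `H` of `f` and the derivatives `D`, `K` of the potential. -/
def linExpr (σx σθ lam τ χ : ℝ) (G : Fin 3 → L2Phase) (H : Fin 3 → Fin 3 → L2Phase)
    (D : Fin 2 → L2Pos) (K : Fin 2 → Fin 2 → L2Pos) (p : Phase) : ℝ :=
  σx * (H 0 0 p + H 1 1 p) + σθ * H 2 2 p - lam * (dir p.2 ⬝ᵥ ![G 0 p, G 1 p])
    - χ / (2 * Real.pi) *
      angleDeriv (turning τ (fun i => D i p.1) (Matrix.of fun i j => K i j p.1)) p.2

/-- `g` is the image of `f` under the linearized operator: `f` is in `H²₀` and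
`g = σ_x Δ_x f + σ_θ ∂_θθ f - λ v_θ · ∇_x f - (χ / 2π) ∂_θ B_τ[f]`. -/
def IsLin (σx σθ lam γ σc τ χ : ℝ) (f g : L20) : Prop :=
  ∃ G H c D K, HasPhaseDerivs f G H ∧ IsPotential γ σc f c D K ∧
    ((g : L2Phase) : Phase → ℝ) =ᵐ[volume] linExpr σx σθ lam τ χ G H D K

lemma hasDerivAt_cosA (θ : Ang) : HasDerivAt (fun t : ℝ => cosA (θ + (t : Ang))) (-sinA θ) 0 := by
  induction θ using QuotientAddGroup.induction_on with | _ s => ?_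
  have h := ((hasDerivAt_id (0 : ℝ)).const_add s).cos
  simp only [id, add_zero, mul_one] at h
  change HasDerivAt (fun t : ℝ => cosA ((s : Ang) + (t : Ang))) (-sinA (s : Ang)) 0
  simp_rw [← AddCircle.coe_add, cosA_coe, sinA_coe]
  exact h

lemma hasDerivAt_sinA (θ : Ang) : HasDerivAt (fun t : ℝ => sinA (θ + (t : Ang))) (cosA θ) 0 := by
  induction θ using QuotientAddGroup.induction_on with | _ s => ?_
  have h := ((hasDerivAt_id (0 : ℝ)).const_add s).sin
  simp only [id, add_zero, mul_one] at h
  change HasDerivAt (fun t : ℝ => sinA ((s : Ang) + (t : Ang))) (cosA (s : Ang)) 0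
  simp_rw [← AddCircle.coe_add, cosA_coe, sinA_coe]
  exact h

lemma angleDeriv_turning (τ : ℝ) (d : Fin 2 → ℝ) (K : Matrix (Fin 2) (Fin 2) ℝ) (θ : Ang) :
    angleDeriv (turning τ d K) θ = -cosA θ * d 0 - sinA θ * d 1
      + τ * ((sinA θ ^ 2 - cosA θ ^ 2) * (K 0 0 - K 1 1)
        - 2 * sinA θ * cosA θ * (K 0 1 + K 1 0)) := by
  have hc := hasDerivAt_cosA θ
  have hs := hasDerivAt_sinA θ
  have h : HasDerivAt (fun t : ℝ => turning τ d K (θ + (t : Ang)))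
      (-cosA θ * d 0 - sinA θ * d 1
      + τ * ((sinA θ ^ 2 - cosA θ ^ 2) * (K 0 0 - K 1 1)
        - 2 * sinA θ * cosA θ * (K 0 1 + K 1 0))) 0 := by
    have hK0 := (hc.const_mul (K 0 0)).add (hs.const_mul (K 0 1))
    have hK1 := (hc.const_mul (K 1 0)).add (hs.const_mul (K 1 1))
    have := ((hs.neg.mul_const (d 0)).add (hc.mul_const (d 1))).add
      (((hs.neg.mul hK0).add (hc.mul hK1)).const_mul τ)
    convert! this using 1
    · ext t
      simp [turning, dir, dirPerp, dotProduct, Matrix.mulVec, Fin.sum_univ_two]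
    · simp
      ring
  exact h.deriv

/-! ### The linearized operator is well defined -/

lemma linExpr_add (σx σθ lam τ χ : ℝ) (G G' : Fin 3 → L2Phase) (H H' : Fin 3 → Fin 3 → L2Phase)
    (D D' : Fin 2 → L2Pos) (K K' : Fin 2 → Fin 2 → L2Pos) :
    linExpr σx σθ lam τ χ (G + G') (H + H') (D + D') (K + K') =ᵐ[volume]
      linExpr σx σθ lam τ χ G H D K + linExpr σx σθ lam τ χ G' H' D' K' := by
  have q : Measure.QuasiMeasurePreserving (Prod.fst : Phase → Pos) volume volume :=
    Measure.quasiMeasurePreserving_fst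
  have hG := fun i => Lp.coeFn_add (G i) (G' i)
  have hH := fun i j => Lp.coeFn_add (H i j) (H' i j)
  have hD := fun i => q.ae (Lp.coeFn_add (D i) (D' i))
  have hK := fun i j => q.ae (Lp.coeFn_add (K i j) (K' i j))
  filter_upwards [hG 0, hG 1, hH 0 0, hH 1 1, hH 2 2, hD 0, hD 1, hK 0 0, hK 0 1, hK 1 0, hK 1 1]
    with p g0 g1 h0 h1 h2 d0 d1 k00 k01 k10 k11
  simp only [linExpr, angleDeriv_turning, Matrix.of_apply, Pi.add_apply, g0, g1, h0, h1, h2, d0,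
    d1, k00, k01, k10, k11, dotProduct, Fin.sum_univ_two, dir, Matrix.cons_val_zero,
    Matrix.cons_val_one]
  ring

lemma linExpr_smul (σx σθ lam τ χ : ℝ) (a : ℝ) (G : Fin 3 → L2Phase) (H : Fin 3 → Fin 3 → L2Phase)
    (D : Fin 2 → L2Pos) (K : Fin 2 → Fin 2 → L2Pos) :
    linExpr σx σθ lam τ χ (a • G) (a • H) (a • D) (a • K) =ᵐ[volume]
      a • linExpr σx σθ lam τ χ G H D K := by
  have q : Measure.QuasiMeasurePreserving (Prod.fst : Phase → Pos) volume volume :=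
    Measure.quasiMeasurePreserving_fst
  have hG := fun i => Lp.coeFn_smul a (G i)
  have hH := fun i j => Lp.coeFn_smul a (H i j)
  have hD := fun i => q.ae (Lp.coeFn_smul a (D i))
  have hK := fun i j => q.ae (Lp.coeFn_smul a (K i j))
  filter_upwards [hG 0, hG 1, hH 0 0, hH 1 1, hH 2 2, hD 0, hD 1, hK 0 0, hK 0 1, hK 1 0, hK 1 1]
    with p g0 g1 h0 h1 h2 d0 d1 k00 k01 k10 k11
  simp only [linExpr, angleDeriv_turning, Matrix.of_apply, Pi.smul_apply, g0, g1, h0, h1, h2, d0,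
    d1, k00, k01, k10, k11, dotProduct, Fin.sum_univ_two, dir, Matrix.cons_val_zero,
    Matrix.cons_val_one, smul_eq_mul]
  ring

lemma ae_slice {f g : Phase → ℝ} (h : f =ᵐ[volume] g) :
    ∀ᵐ x : Pos, ∀ᵐ θ : Ang, f (x, θ) = g (x, θ) :=
  Measure.ae_ae_of_ae_prod h

lemma integrable_slice (f : L2Phase) : ∀ᵐ x : Pos, Integrable fun θ : Ang => f (x, θ) :=
  (integrable_L2Phase f).prod_right_ae

lemma IsPotential.add {γ σc : ℝ} {f f' : L2Phase} {c c' : L2Pos} {D D' : Fin 2 → L2Pos}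
    {K K' : Fin 2 → Fin 2 → L2Pos} (h : IsPotential γ σc f c D K)
    (h' : IsPotential γ σc f' c' D' K') :
    IsPotential γ σc (f + f') (c + c') (D + D') (K + K') := by
  refine ⟨h.1.add h'.1, ?_⟩
  filter_upwards [h.2, h'.2, ae_slice (Lp.coeFn_add f f'), integrable_slice f, integrable_slice f',
    Lp.coeFn_add c c', Lp.coeFn_add (K 0 0) (K' 0 0), Lp.coeFn_add (K 1 1) (K' 1 1)]
    with x h1 h2 h3 i1 i2 h4 h5 h6
  rw [integral_congr_ae h3]
  simp only [Pi.add_apply] at h4 h5 h6 ⊢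
  rw [integral_add i1 i2, ← h1, ← h2, h4, h5, h6]
  ring

lemma IsPotential.smul {γ σc : ℝ} {f : L2Phase} {c : L2Pos} {D : Fin 2 → L2Pos}
    {K : Fin 2 → Fin 2 → L2Pos} (a : ℝ) (h : IsPotential γ σc f c D K) :
    IsPotential γ σc (a • f) (a • c) (a • D) (a • K) := by
  refine ⟨h.1.smul a, ?_⟩
  filter_upwards [h.2, ae_slice (Lp.coeFn_smul a f),
    Lp.coeFn_smul a c, Lp.coeFn_smul a (K 0 0), Lp.coeFn_smul a (K 1 1)]
    with x h1 h3 h4 h5 h6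
  rw [integral_congr_ae h3]
  simp only [Pi.smul_apply, smul_eq_mul] at h4 h5 h6 ⊢
  rw [integral_const_mul, ← h1, h4, h5, h6]
  ring

lemma IsLin.add {σx σθ lam γ σc τ χ : ℝ} {f g f' g' : L20}
    (h : IsLin σx σθ lam γ σc τ χ f g) (h' : IsLin σx σθ lam γ σc τ χ f' g') :
    IsLin σx σθ lam γ σc τ χ (f + f') (g + g') := by
  obtain ⟨G, H, c, D, K, h1, h2, h3⟩ := h
  obtain ⟨G', H', c', D', K', h1', h2', h3'⟩ := h'
  refine ⟨_, _, _, _, _, h1.add h1', h2.add h2', ?_⟩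
  exact (Lp.coeFn_add _ _).trans ((h3.add h3').trans (linExpr_add ..).symm)

lemma IsLin.smul {σx σθ lam γ σc τ χ : ℝ} {f g : L20} (a : ℝ)
    (h : IsLin σx σθ lam γ σc τ χ f g) :
    IsLin σx σθ lam γ σc τ χ (a • f) (a • g) := by
  obtain ⟨G, H, c, D, K, h1, h2, h3⟩ := h
  refine ⟨_, _, _, _, _, h1.smul a, h2.smul a, ?_⟩
  exact (Lp.coeFn_smul _ _).trans ((h3.const_smul a).trans (linExpr_smul ..).symm)

/-- Completeness of a family of continuous functions with dense span. -/
lemma eq_zero_of_integral_eq_zero {X ι : Type*} [TopologicalSpace X] [CompactSpace X] [T2Space X]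
    [MeasurableSpace X] [BorelSpace X] [SecondCountableTopology X]
    {μ : Measure X} [IsFiniteMeasure μ] [μ.WeaklyRegular] (e : ι → C(X, ℂ))
    (he : (span ℂ (Set.range e)).topologicalClosure = ⊤) (f : Lp ℝ 2 μ)
    (h : ∀ i, ∫ x, conj (e i x) * (f x : ℂ) ∂μ = 0) : f = 0 := by
  have hF : MemLp (fun x => (f x : ℂ)) 2 μ := (Lp.memLp f).ofReal
  set F : Lp ℂ 2 μ := hF.toLp with hFdef
  have hd := (ContinuousMap.toLp_denseRange ℂ μ ℂ
    (p := 2) (by norm_num)).topologicalClosure_map_submodule he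
  have horth : F ∈ (span ℂ (Set.range e) |>.map (ContinuousMap.toLp (E := ℂ) 2 μ ℂ).toLinearMap)ᗮ
      := by
    rw [Submodule.map_span, Submodule.mem_orthogonal]
    intro u hu
    induction hu using Submodule.span_induction with
    | mem u hu =>
      obtain ⟨_, ⟨i, rfl⟩, rfl⟩ := hu
      rw [L2.inner_def, ← h i]
      refine integral_congr_ae ?_
      filter_upwards [hF.coeFn_toLp, ContinuousMap.coeFn_toLp (𝕜 := ℂ) (p := 2) μ (e i)]
        with x h1 h2
      rw [← hFdef] at h1
      simp only [ContinuousLinearMap.coe_coe, RCLike.inner_apply]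
      rw [h1, h2, mul_comm]
    | zero => simp
    | add u v _ _ hu hv => rw [inner_add_left, hu, hv, add_zero]
    | smul a u _ hu => rw [inner_smul_left, hu, mul_zero]
  rw [← Submodule.orthogonal_closure, hd, Submodule.top_orthogonal_eq_bot,
    Submodule.mem_bot] at horth
  refine Lp.ext ?_
  have h0 : (F : X → ℂ) =ᵐ[μ] 0 := by rw [horth]; exact Lp.coeFn_zero _ _ _
  filter_upwards [hF.coeFn_toLp, h0, Lp.coeFn_zero ℝ 2 μ] with x h1 h2 h3
  rw [← hFdef, h2] at h1
  rw [h3]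
  simpa using h1.symm

lemma posCoeff_injective (f : L2Pos) (h : ∀ m, posCoeff f m = 0) : f = 0 := by
  refine eq_zero_of_integral_eq_zero (fun m => UnitAddTorus.mFourier m)
    UnitAddTorus.span_mFourier_closure_eq_top f fun m => ?_
  simpa [posCoeff, UnitAddTorus.mFourier_neg] using h m

/-- The characters of the phase space. -/
def phaseChar (q : (Fin 2 → ℤ) × ℤ) : C(Phase, ℂ) where
  toFun p := UnitAddTorus.mFourier q.1 p.1 * fourier q.2 p.2
  continuous_toFun := by fun_prop

def phaseCharAlgebra : StarSubalgebra ℂ C(Phase, ℂ) where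
  toSubalgebra := Algebra.adjoin ℂ (Set.range phaseChar)
  star_mem' := by
    change Algebra.adjoin ℂ (Set.range phaseChar) ≤ star (Algebra.adjoin ℂ (Set.range phaseChar))
    refine Algebra.adjoin_le ?_
    rintro _ ⟨q, rfl⟩
    refine Algebra.subset_adjoin ⟨-q, ?_⟩
    ext1 p
    simp [phaseChar, UnitAddTorus.mFourier_neg]

lemma phaseCharAlgebra_coe :
    phaseCharAlgebra.toSubalgebra.toSubmodule = span ℂ (Set.range phaseChar) := by
  apply Algebra.adjoin_eq_span_of_subset
  refine .trans (fun x ↦ Submonoid.closure_induction (fun _ ↦ id) ⟨0, ?_⟩ ?_) subset_span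
  · ext z
    simp [phaseChar, UnitAddTorus.mFourier_zero]
  · rintro _ _ _ _ ⟨m, rfl⟩ ⟨n, rfl⟩
    refine ⟨m + n, ?_⟩
    ext z
    simp only [phaseChar, Prod.fst_add, Prod.snd_add, UnitAddTorus.mFourier_add, fourier_add,
      ContinuousMap.coe_mk, ContinuousMap.mul_apply]
    ring

lemma phaseCharAlgebra_separates : phaseCharAlgebra.SeparatesPoints := by
  intro p q hpq
  by_cases h1 : p.1 = q.1
  · have h2 : p.2 ≠ q.2 := fun h => hpq (Prod.ext h1 h)
    refine ⟨_, ⟨phaseChar (0, 1), Algebra.subset_adjoin ⟨(0, 1), rfl⟩, rfl⟩, ?_⟩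
    simp only [phaseChar, UnitAddTorus.mFourier_zero, ContinuousMap.coe_mk,
      ContinuousMap.one_apply, one_mul, fourier_one, ne_eq, Circle.coe_inj]
    exact fun h => h2 (AddCircle.injective_toCircle Real.two_pi_pos.ne' h)
  · obtain ⟨i, hi⟩ := Function.ne_iff.mp h1
    refine ⟨_, ⟨phaseChar (Pi.single i 1, 0), Algebra.subset_adjoin ⟨_, rfl⟩, rfl⟩, ?_⟩
    simp only [phaseChar, UnitAddTorus.mFourier_single, ContinuousMap.coe_mk, fourier_zero,
      mul_one, fourier_one, ne_eq, Circle.coe_inj]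
    exact fun h => hi (AddCircle.injective_toCircle one_ne_zero h)

lemma phaseCoeff_injective (f : L2Phase) (h : ∀ m n, phaseCoeff f m n = 0) : f = 0 := by
  refine eq_zero_of_integral_eq_zero phaseChar ?_ f fun q => ?_
  · rw [← phaseCharAlgebra_coe]
    exact congr_arg (Subalgebra.toSubmodule <| StarSubalgebra.toSubalgebra ·)
      (ContinuousMap.starSubalgebra_topologicalClosure_eq_top_of_separatesPoints _
        phaseCharAlgebra_separates)
  · simpa [phaseCoeff, phaseChar, UnitAddTorus.mFourier_neg] using h q.1 q.2

lemma HasPhaseDerivs.eq_zero {G : Fin 3 → L2Phase} {H : Fin 3 → Fin 3 → L2Phase}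
    (h : HasPhaseDerivs 0 G H) : G = 0 ∧ H = 0 := by
  have h0 : ∀ m n, phaseCoeff (0 : L2Phase) m n = 0 := fun m n => by
    simpa using phaseCoeff_smul 0 (0 : L2Phase) m n
  have hG : ∀ j, G j = 0 := fun j => phaseCoeff_injective _ fun m n => by
    rw [h.1 j, h0, mul_zero]
  refine ⟨funext hG, funext fun i => funext fun j => phaseCoeff_injective _ fun m n => ?_⟩
  rw [h.2 i j, hG, h0, mul_zero]

/-- The symbol `γ + 4π² σ_c |m|²` of `γ - σ_c Δ`. -/
def ellSymbol (γ σc : ℝ) (m : Fin 2 → ℤ) : ℝ :=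
  γ + 4 * Real.pi ^ 2 * σc * ((m 0 : ℝ) ^ 2 + (m 1 : ℝ) ^ 2)

lemma ellSymbol_pos {γ σc : ℝ} (hγ : 0 < γ) (hσc : 0 < σc) (m : Fin 2 → ℤ) :
    0 < ellSymbol γ σc m := by
  unfold ellSymbol; positivity

lemma posCoeff_ell {γ σc : ℝ} {c : L2Pos} {D : Fin 2 → L2Pos} {K : Fin 2 → Fin 2 → L2Pos}
    (h : HasPosDerivs c D K) (m : Fin 2 → ℤ) :
    posCoeff (γ • c + (-σc) • (K 0 0 + K 1 1) : L2Pos) m = ellSymbol γ σc m * posCoeff c m := by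
  rw [posCoeff_add, posCoeff_smul, posCoeff_smul, posCoeff_add, h.2, h.2, h.1, h.1]
  simp only [ellSymbol]
  push_cast
  linear_combination (-(σc * 4 * Real.pi ^ 2 * posCoeff c m * (m 0 ^ 2 + m 1 ^ 2)) : ℂ)
    * Complex.I_sq

lemma coeFn_ell (γ σc : ℝ) (c k l : L2Pos) :
    (γ • c + (-σc) • (k + l) : L2Pos) =ᵐ[volume] fun x => γ * c x - σc * (k x + l x) := by
  filter_upwards [Lp.coeFn_add (γ • c) ((-σc) • (k + l)), Lp.coeFn_smul γ c,
    Lp.coeFn_smul (-σc) (k + l), Lp.coeFn_add k l] with x h1 h2 h3 h4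
  simp only [h1, h2, h3, h4, Pi.add_apply, Pi.smul_apply, smul_eq_mul]
  ring

lemma IsPotential.eq_zero {γ σc : ℝ} (hγ : 0 < γ) (hσc : 0 < σc) {c : L2Pos}
    {D : Fin 2 → L2Pos} {K : Fin 2 → Fin 2 → L2Pos} (h : IsPotential γ σc 0 c D K) :
    D = 0 ∧ K = 0 := by
  have hz : (γ • c + (-σc) • (K 0 0 + K 1 1) : L2Pos) = 0 := by
    refine Lp.ext ?_
    filter_upwards [h.2, coeFn_ell γ σc c (K 0 0) (K 1 1), Lp.coeFn_zero ℝ 2 (volume : Measure Pos),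
      ae_slice (Lp.coeFn_zero ℝ 2 (volume : Measure Phase))] with x h1 h2 h3 h4
    rw [h2, h3, h1, integral_congr_ae h4]
    simp
  have h0 : ∀ m, posCoeff (0 : L2Pos) m = 0 := fun m => by
    simpa using posCoeff_smul 0 (0 : L2Pos) m
  have hc : ∀ m, posCoeff c m = 0 := fun m => by
    have := posCoeff_ell (γ := γ) (σc := σc) h.1 m
    rw [hz, h0] at this
    rcases mul_eq_zero.mp this.symm with h' | h'
    · exact absurd (Complex.ofReal_eq_zero.mp h') (ellSymbol_pos hγ hσc m).ne'
    · exact h'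
  have hD : ∀ j, D j = 0 := fun j => posCoeff_injective _ fun m => by rw [h.1.1 j, hc, mul_zero]
  refine ⟨funext hD, funext fun i => funext fun j => posCoeff_injective _ fun m => ?_⟩
  rw [h.1.2 i j, hD, h0, mul_zero]

lemma IsLin.eq_zero {σx σθ lam γ σc τ χ : ℝ} (hγ : 0 < γ) (hσc : 0 < σc) {g : L20}
    (h : IsLin σx σθ lam γ σc τ χ 0 g) : g = 0 := by
  obtain ⟨G, H, c, D, K, h1, h2, h3⟩ := h
  obtain ⟨rfl, rfl⟩ := HasPhaseDerivs.eq_zero h1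
  obtain ⟨rfl, rfl⟩ := IsPotential.eq_zero hγ hσc h2
  have h4 := linExpr_smul σx σθ lam τ χ 0 0 0 0 0
  simp only [smul_zero, zero_smul] at h4
  refine Subtype.ext (Lp.ext ?_)
  exact (h3.trans h4).trans (Lp.coeFn_zero ℝ 2 _).symm

lemma IsLin.unique {σx σθ lam γ σc τ χ : ℝ} (hγ : 0 < γ) (hσc : 0 < σc) {f g g' : L20}
    (h : IsLin σx σθ lam γ σc τ χ f g) (h' : IsLin σx σθ lam γ σc τ χ f g') : g = g' := by
  have := h.add (h'.smul (-1))
  rw [neg_one_smul, neg_one_smul, add_neg_cancel] at this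
  exact add_neg_eq_zero.mp (this.eq_zero hγ hσc)

lemma integral_fourier_unit (n : ℤ) :
    ∫ t : UnitAddCircle, (fourier n t : ℂ) = if n = 0 then 1 else 0 := by
  have h := congrFun (fourierCoeff_fourier (T := 1) n) 0
  have hv : (volume : Measure UnitAddCircle) = AddCircle.haarAddCircle := by
    rw [AddCircle.volume_eq_smul_haarAddCircle]; simp
  rw [hv]
  simpa [fourierCoeff, Pi.single_apply, eq_comm] using h

lemma integral_mFourier (m : Fin 2 → ℤ) :
    ∫ x : Pos, (UnitAddTorus.mFourier m x : ℂ) = if m = 0 then 1 else 0 := by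
  simp only [UnitAddTorus.mFourier, ContinuousMap.coe_mk]
  rw [integral_fintype_prod_volume_eq_prod]
  simp only [integral_fourier_unit, Fin.prod_univ_two]
  by_cases h0 : m 0 = 0 <;> by_cases h1 : m 1 = 0 <;> simp [funext_iff, h0, h1]

lemma orthonormal_posChar :
    Orthonormal ℂ fun m => ContinuousMap.toLp (E := ℂ) 2 (volume : Measure Pos) ℂ
      (UnitAddTorus.mFourier m) := by
  rw [orthonormal_iff_ite]
  intro m n
  simp only [ContinuousMap.inner_toLp, ← UnitAddTorus.mFourier_neg, ← UnitAddTorus.mFourier_add]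
  rw [integral_mFourier]
  refine if_congr ?_ rfl rfl
  constructor
  · intro h; exact (add_neg_eq_zero.mp h).symm
  · rintro rfl; exact add_neg_cancel _

def posBasis : HilbertBasis (Fin 2 → ℤ) ℂ (Lp ℂ 2 (volume : Measure Pos)) :=
  HilbertBasis.mk orthonormal_posChar (by
    have := (ContinuousMap.toLp_denseRange ℂ (volume : Measure Pos) ℂ
      (p := 2) (by norm_num)).topologicalClosure_map_submodule
        (UnitAddTorus.span_mFourier_closure_eq_top (d := Fin 2))
    rw [Submodule.map_span, ← Set.range_comp] at this
    exact this.ge)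

lemma posBasis_repr (f : Lp ℂ 2 (volume : Measure Pos)) (m : Fin 2 → ℤ) :
    posBasis.repr f m = ∫ x, UnitAddTorus.mFourier (-m) x * f x := by
  rw [posBasis.repr_apply_apply, posBasis, HilbertBasis.coe_mk, L2.inner_def]
  refine integral_congr_ae ?_
  filter_upwards [ContinuousMap.coeFn_toLp (𝕜 := ℂ) (p := 2) (volume : Measure Pos)
    (UnitAddTorus.mFourier m)] with x hx
  rw [RCLike.inner_apply, hx, UnitAddTorus.mFourier_neg, mul_comm]

/-- Bounded Fourier multipliers act on real square integrable functions. -/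
lemma exists_multiplier (s : (Fin 2 → ℤ) → ℂ) (C : ℝ) (hs : ∀ m, ‖s m‖ ≤ C)
    (hs' : ∀ m, s (-m) = conj (s m)) (ρ : L2Pos) :
    ∃ c : L2Pos, ∀ m, posCoeff c m = s m * posCoeff ρ m := by
  have hR : MemLp (fun x => (ρ x : ℂ)) 2 volume := (Lp.memLp ρ).ofReal
  set R : Lp ℂ 2 (volume : Measure Pos) := hR.toLp with hRdef
  have hRc : ∀ m, posBasis.repr R m = posCoeff ρ m := fun m => by
    rw [posBasis_repr, posCoeff]
    refine integral_congr_ae ?_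
    filter_upwards [hR.coeFn_toLp] with x hx
    rw [hRdef, hx]
  have hmem : Memℓp (fun m => s m * posBasis.repr R m) 2 := by
    refine memℓp_gen ?_
    have := (memℓp_gen_iff (p := 2) (by norm_num)).mp (lp.memℓp (posBasis.repr R))
    refine Summable.of_nonneg_of_le (fun _ => by positivity) (fun m => ?_) (this.mul_left (C ^ 2))
    simp only [ENNReal.toReal_ofNat, Real.rpow_ofNat, norm_mul, mul_pow]
    gcongr
    exact hs m
  set Z : Lp ℂ 2 (volume : Measure Pos) := posBasis.repr.symm ⟨_, hmem⟩ with hZ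
  have hZc : ∀ m, ∫ x, UnitAddTorus.mFourier (-m) x * Z x = s m * posCoeff ρ m := fun m => by
    rw [← posBasis_repr, hZ, LinearIsometryEquiv.apply_symm_apply]
    change s m * posBasis.repr R m = _
    rw [hRc]
  have hre : MemLp (fun x => (Z x).re) 2 volume := (Lp.memLp Z).re
  have hconj : ∀ m, posCoeff ρ (-m) = conj (posCoeff ρ m) := fun m => by
    rw [posCoeff, posCoeff, ← integral_conj]
    simp [UnitAddTorus.mFourier_neg]
  refine ⟨hre.toLp, fun m => ?_⟩
  have hi : ∀ m, Integrable fun x => UnitAddTorus.mFourier (-m) x * Z x := fun m => by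
    refine ((Lp.memLp Z).integrable (by norm_num)).bdd_mul (c := 1) ?_ ?_
    · exact (UnitAddTorus.mFourier (-m)).continuous.aestronglyMeasurable
    · exact Filter.Eventually.of_forall fun p =>
        ((UnitAddTorus.mFourier (-m)).norm_coe_le_norm _).trans UnitAddTorus.mFourier_norm.le
  have hi' : Integrable fun x => conj (UnitAddTorus.mFourier (- -m) x * Z x) :=
    (hi (-m)).congr' (by
      exact (Complex.continuous_conj.comp_aestronglyMeasurable (hi (-m)).1)) (by simp)
  have h2 : posCoeff hre.toLp m = ((∫ x, UnitAddTorus.mFourier (-m) x * Z x)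
      + ∫ x, conj (UnitAddTorus.mFourier (- -m) x * Z x)) / 2 := by
    rw [← integral_add (hi m) hi', posCoeff, ← integral_div]
    refine integral_congr_ae ?_
    filter_upwards [hre.coeFn_toLp] with x hx
    rw [hx, map_mul, ← UnitAddTorus.mFourier_neg, neg_neg, ← mul_add, Complex.add_conj]
    push_cast
    ring
  rw [h2, integral_conj, hZc, hZc, hs', hconj]
  simp

lemma memLp_massDensity (f : L2Phase) : MemLp (fun x : Pos => ∫ θ : Ang, f (x, θ)) 2 volume := by
  have hm : AEStronglyMeasurable (fun x : Pos => ∫ θ : Ang, f (x, θ)) volume :=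
    (Lp.aestronglyMeasurable f).integral_prod_right'
  have hsq : Integrable (fun p : Phase => f p ^ 2) := (Lp.memLp f).integrable_sq
  rw [memLp_two_iff_integrable_sq hm]
  have hsq' : Integrable (fun x : Pos => ∫ θ : Ang, f (x, θ) ^ 2) := hsq.integral_prod_left
  refine (hsq'.const_mul (2 * Real.pi)).mono' (hm.pow 2) ?_
  filter_upwards [integrable_slice f, hsq.prod_right_ae] with x h1 h2
  rw [Real.norm_of_nonneg (sq_nonneg _)]
  have hV : (volume : Measure Ang).real Set.univ = 2 * Real.pi := by
    simp [Measure.real, AddCircle.measure_univ, Real.pi_pos.le]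
  set a : ℝ := ∫ θ : Ang, f (x, θ) with ha
  have h3 : 0 ≤ ∫ θ : Ang, (2 * Real.pi * f (x, θ) - a) ^ 2 := integral_nonneg fun _ => sq_nonneg _
  have h4 : ∫ θ : Ang, (2 * Real.pi * f (x, θ) - a) ^ 2
      = (2 * Real.pi) ^ 2 * (∫ θ : Ang, f (x, θ) ^ 2) - 2 * (2 * Real.pi) * a * a
        + a ^ 2 * (2 * Real.pi) := by
    have : ∀ θ : Ang, (2 * Real.pi * f (x, θ) - a) ^ 2 = (2 * Real.pi) ^ 2 * f (x, θ) ^ 2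
      - 2 * (2 * Real.pi) * a * f (x, θ) + a ^ 2 := fun θ => by ring
    simp_rw [this]
    rw [integral_add (by fun_prop) (integrable_const _), integral_sub (by fun_prop) (by fun_prop),
      integral_const_mul, integral_const_mul, integral_const, hV, ← ha, smul_eq_mul]
    ring
  rw [h4] at h3
  have := Real.pi_pos
  nlinarith

lemma exists_potential {γ σc : ℝ} (hγ : 0 < γ) (hσc : 0 < σc) (f : L2Phase) :
    ∃ c D K, IsPotential γ σc f c D K := by
  set ρ : L2Pos := (memLp_massDensity f).toLp with hρ
  have hE := ellSymbol_pos hγ hσc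
  obtain ⟨b, hb, hbE⟩ : ∃ b : ℝ, 0 < b ∧ ∀ m : Fin 2 → ℤ,
      b * (1 + ((m 0 : ℝ) ^ 2 + (m 1 : ℝ) ^ 2)) ≤ ellSymbol γ σc m := by
    refine ⟨min γ (4 * Real.pi ^ 2 * σc), by positivity, fun m => ?_⟩
    rw [mul_add, mul_one, ellSymbol]
    gcongr
    · exact min_le_left _ _
    · exact min_le_right _ _
  have key : ∀ (t : (Fin 2 → ℤ) → ℂ) (C : ℝ),
      (∀ m, ‖t m‖ ≤ C * (1 + ((m 0 : ℝ) ^ 2 + (m 1 : ℝ) ^ 2))) →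
      (∀ m, t (-m) = conj (t m)) →
      ∃ c : L2Pos, ∀ m, posCoeff c m = t m / ellSymbol γ σc m * posCoeff ρ m := by
    intro t C ht ht'
    refine exists_multiplier _ (C / b) (fun m => ?_) (fun m => ?_) ρ
    · rw [norm_div, Complex.norm_real, Real.norm_of_nonneg (hE m).le, div_le_div_iff₀ (hE m) hb]
      have hC : 0 ≤ C := by simpa using (norm_nonneg _).trans (ht 0)
      calc ‖t m‖ * b ≤ C * (1 + ((m 0 : ℝ) ^ 2 + (m 1 : ℝ) ^ 2)) * b := by gcongr; exact ht m
        _ = C * (b * (1 + ((m 0 : ℝ) ^ 2 + (m 1 : ℝ) ^ 2))) := by ring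
        _ ≤ _ := by gcongr; exact hbE m
    · rw [map_div₀, Complex.conj_ofReal, ht']
      simp [ellSymbol]
  have hle : ∀ (m : Fin 2 → ℤ) i, (m i : ℝ) ^ 2 ≤ (m 0 : ℝ) ^ 2 + (m 1 : ℝ) ^ 2 := fun m i => by
    fin_cases i <;> simp <;> positivity
  obtain ⟨c, hc⟩ := key (fun _ => 1) 1 (fun m => by simp; positivity) (by simp)
  have hD := fun i : Fin 2 => key (fun m => 2 * Real.pi * Complex.I * m i) (2 * Real.pi)
    (fun m => by
      simp only [norm_mul, Complex.norm_ofNat, Complex.norm_real, Complex.norm_I, mul_one,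
        Complex.norm_intCast, Real.norm_of_nonneg Real.pi_pos.le]
      have := hle m i
      gcongr
      nlinarith [sq_abs (m i : ℝ), sq_nonneg (|(m i : ℝ)| - 1)])
    (by simp [Complex.conj_ofNat])
  have hK := fun i j : Fin 2 => key
    (fun m => (2 * Real.pi * Complex.I * m j) * (2 * Real.pi * Complex.I * m i))
    ((2 * Real.pi) * (2 * Real.pi))
    (fun m => by
      simp only [norm_mul, Complex.norm_ofNat, Complex.norm_real, Complex.norm_I, mul_one,
        Complex.norm_intCast, Real.norm_of_nonneg Real.pi_pos.le]
      have h1 := hle m i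
      have h2 := hle m j
      rw [mul_mul_mul_comm]
      gcongr
      nlinarith [sq_abs (m i : ℝ), sq_abs (m j : ℝ), sq_nonneg (|(m i : ℝ)| - |(m j : ℝ)|)])
    (by simp [Complex.conj_ofNat])
  choose D hD using hD
  choose K hK using hK
  have hder : HasPosDerivs c D K :=
    ⟨fun j m => by rw [hD, hc]; ring, fun i j m => by rw [hK, hD]; ring⟩
  refine ⟨c, D, K, hder, ?_⟩
  have heq : (γ • c + (-σc) • (K 0 0 + K 1 1) : L2Pos) = ρ := by
    rw [← sub_eq_zero, sub_eq_add_neg, ← neg_one_smul ℝ ρ]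
    refine posCoeff_injective _ fun m => ?_
    have h1 : (ellSymbol γ σc m : ℂ) ≠ 0 := Complex.ofReal_ne_zero.mpr (hE m).ne'
    rw [posCoeff_add, posCoeff_ell hder, hc, posCoeff_smul]
    field_simp
    simp
  filter_upwards [coeFn_ell γ σc c (K 0 0) (K 1 1), (memLp_massDensity f).coeFn_toLp] with x h1 h2
  rw [← h1, heq, hρ, h2]

lemma continuous_cosA : Continuous cosA := by
  unfold cosA; fun_prop

lemma continuous_sinA : Continuous sinA := by
  unfold sinA; fun_prop

lemma memLp_bdd_mul {a : Ang → ℝ} (ha : Continuous a) {F : Phase → ℝ} (hF : MemLp F 2 volume) :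
    MemLp (fun p : Phase => a p.2 * F p) 2 volume := by
  refine hF.of_le_mul (c := ‖(⟨a, ha⟩ : C(Ang, ℝ))‖) ?_ ?_
  · exact (ha.comp continuous_snd).aestronglyMeasurable.mul hF.1
  · refine Filter.Eventually.of_forall fun p => ?_
    rw [norm_mul]
    gcongr
    exact (⟨a, ha⟩ : C(Ang, ℝ)).norm_coe_le_norm p.2

lemma integral_L2Phase (f : L2Phase) : ((∫ p, f p : ℝ) : ℂ) = phaseCoeff f 0 0 := by
  simp [phaseCoeff, UnitAddTorus.mFourier_zero, integral_complex_ofReal]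

lemma integral_phaseDeriv {j : Fin 3} {f g : L2Phase} (h : IsPhaseDeriv j f g) :
    ∫ p, g p = 0 := by
  have := integral_L2Phase g
  rw [h] at this
  fin_cases j <;> simpa [phaseSymbol] using this

lemma integral_posDeriv {j : Fin 2} {f g : L2Pos} (h : IsPosDeriv j f g) : ∫ x, g x = 0 := by
  have h1 : ((∫ x, g x : ℝ) : ℂ) = posCoeff g 0 := by
    simp [posCoeff, UnitAddTorus.mFourier_zero, integral_complex_ofReal]
  rw [h] at h1
  simpa using h1

lemma integral_fourier_mul {j : Fin 3} (hj : j ≠ 2) {f g : L2Phase} (h : IsPhaseDeriv j f g) :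
    ∫ p : Phase, cosA p.2 * g p = 0 ∧ ∫ p : Phase, sinA p.2 * g p = 0 := by
  have h1 : phaseCoeff g 0 (-1) = 0 := by
    rw [h]
    fin_cases j
    · simp [phaseSymbol]
    · simp [phaseSymbol]
    · exact absurd rfl hj
  have hc := (memLp_bdd_mul continuous_cosA (Lp.memLp g)).integrable (by norm_num)
  have hs := (memLp_bdd_mul continuous_sinA (Lp.memLp g)).integrable (by norm_num)
  have h2 : phaseCoeff g 0 (-1) = ((∫ p : Phase, cosA p.2 * g p : ℝ) : ℂ)
      + ((∫ p : Phase, sinA p.2 * g p : ℝ) : ℂ) * Complex.I := by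
    rw [← integral_complex_ofReal, ← integral_complex_ofReal, ← integral_mul_const,
      ← integral_add hc.ofReal (hs.ofReal.mul_const _), phaseCoeff]
    refine integral_congr_ae (Filter.Eventually.of_forall fun p => ?_)
    simp only [neg_zero, UnitAddTorus.mFourier_zero, ContinuousMap.one_apply, one_mul, neg_neg,
      fourier_one, Complex.ofReal_mul]
    conv_lhs => rw [← Complex.re_add_im (AddCircle.toCircle p.2 : ℂ)]
    simp only [cosA, sinA]
    ring
  rw [h1] at h2
  have hre := congrArg Complex.re h2
  have him := congrArg Complex.im h2
  simp at hre him
  exact ⟨hre.symm, him.symm⟩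

lemma integral_angle_mul (a : Ang → ℝ) {j : Fin 2} {f g : L2Pos} (h : IsPosDeriv j f g) :
    ∫ p : Phase, a p.2 * g p.1 = 0 := by
  have := integral_prod_mul (μ := (volume : Measure Pos)) (ν := (volume : Measure Ang)) g a
  rw [integral_posDeriv h, zero_mul] at this
  rw [← this]
  exact integral_congr_ae (Filter.Eventually.of_forall fun p => mul_comm _ _)

lemma linExpr_spec (σx σθ lam τ χ : ℝ) {f : L2Phase} {c : L2Pos} {G : Fin 3 → L2Phase}
    {H : Fin 3 → Fin 3 → L2Phase} {D : Fin 2 → L2Pos} {K : Fin 2 → Fin 2 → L2Pos}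
    (h : HasPhaseDerivs f G H) (h' : HasPosDerivs c D K) :
    MemLp (linExpr σx σθ lam τ χ G H D K) 2 volume ∧
      ∫ p, linExpr σx σθ lam τ χ G H D K p = 0 := by
  have hadd : ∀ F F' : Phase → ℝ, (MemLp F 2 volume ∧ ∫ p, F p = 0) →
      (MemLp F' 2 volume ∧ ∫ p, F' p = 0) →
      (MemLp (fun p => F p + F' p) 2 volume ∧ ∫ p, (F p + F' p) = 0) := by
    intro F F' hF hF'
    refine ⟨hF.1.add hF'.1, ?_⟩
    rw [integral_add (hF.1.integrable (by norm_num)) (hF'.1.integrable (by norm_num)), hF.2, hF'.2,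
      add_zero]
  have hsmul : ∀ (a : ℝ) (F : Phase → ℝ), (MemLp F 2 volume ∧ ∫ p, F p = 0) →
      (MemLp (fun p => a * F p) 2 volume ∧ ∫ p, a * F p = 0) := by
    intro a F hF
    exact ⟨hF.1.const_mul a, by rw [integral_const_mul, hF.2, mul_zero]⟩
  have hH : ∀ i j, MemLp (H i j) 2 volume ∧ ∫ p, H i j p = 0 := fun i j =>
    ⟨Lp.memLp _, integral_phaseDeriv (h.2 i j)⟩
  have hc0 : MemLp (fun p : Phase => cosA p.2 * G 0 p) 2 volume ∧ ∫ p : Phase, cosA p.2 * G 0 p = 0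
    := ⟨memLp_bdd_mul continuous_cosA (Lp.memLp _), (integral_fourier_mul (by decide) (h.1 0)).1⟩
  have hs1 : MemLp (fun p : Phase => sinA p.2 * G 1 p) 2 volume ∧ ∫ p : Phase, sinA p.2 * G 1 p = 0
    := ⟨memLp_bdd_mul continuous_sinA (Lp.memLp _), (integral_fourier_mul (by decide) (h.1 1)).2⟩
  have hpos : ∀ (a : Ang → ℝ) (_ : Continuous a) (j : Fin 2) (u w : L2Pos), IsPosDeriv j u w →
      MemLp (fun p : Phase => a p.2 * w p.1) 2 volume ∧ ∫ p : Phase, a p.2 * w p.1 = 0 :=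
    fun a ha j u w hw => ⟨memLp_bdd_mul ha ((Lp.memLp w).comp_fst volume),
      integral_angle_mul a hw⟩
  have hcc := continuous_cosA
  have hsc := continuous_sinA
  have hall := hadd _ _ (hadd _ _ (hadd _ _ (hsmul σx _ (hadd _ _ (hH 0 0) (hH 1 1)))
    (hsmul σθ _ (hH 2 2))) (hsmul (-lam) _ (hadd _ _ hc0 hs1)))
    (hsmul (-(χ / (2 * Real.pi))) _ (hadd _ _ (hadd _ _
      (hpos (fun θ => -cosA θ) (by fun_prop) 0 _ _ (h'.1 0))
      (hpos (fun θ => -sinA θ) (by fun_prop) 1 _ _ (h'.1 1)))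
      (hsmul τ _ (hadd _ _ (hadd _ _
        (hpos (fun θ => sinA θ ^ 2 - cosA θ ^ 2) (by fun_prop) 0 _ _ (h'.2 0 0))
        (hpos (fun θ => -(sinA θ ^ 2 - cosA θ ^ 2)) (by fun_prop) 1 _ _ (h'.2 1 1)))
        (hadd _ _ (hpos (fun θ => -(2 * sinA θ * cosA θ)) (by fun_prop) 1 _ _ (h'.2 0 1))
        (hpos (fun θ => -(2 * sinA θ * cosA θ)) (by fun_prop) 0 _ _ (h'.2 1 0)))))))
  convert! hall using 2
  · ext p
    simp only [linExpr, angleDeriv_turning, Matrix.of_apply, dotProduct, Fin.sum_univ_two, dir,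
      Matrix.cons_val_zero, Matrix.cons_val_one]
    ring
  · congr 1
    ext p
    simp only [linExpr, angleDeriv_turning, Matrix.of_apply, dotProduct, Fin.sum_univ_two, dir,
      Matrix.cons_val_zero, Matrix.cons_val_one]
    ring

lemma exists_isLin (σx σθ lam τ χ : ℝ) {γ σc : ℝ} (hγ : 0 < γ) (hσc : 0 < σc) (f : H20) :
    ∃ g, IsLin σx σθ lam γ σc τ χ f g := by
  obtain ⟨G, H, h⟩ := f.2
  obtain ⟨c, D, K, h'⟩ := exists_potential hγ hσc ((f : L20) : L2Phase)
  obtain ⟨h1, h2⟩ := linExpr_spec σx σθ lam τ χ h h'.1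
  refine ⟨⟨h1.toLp, ?_⟩, G, H, c, D, K, h, h', h1.coeFn_toLp⟩
  rw [mem_L20, integral_congr_ae h1.coeFn_toLp, h2]

/-- The linearized operator
`L_χ = σ_x Δ_x + σ_θ ∂_θθ - λ v_θ · ∇_x - (χ / 2π) ∂_θ B_τ[·]`,
as an operator in `L²₀` with domain `H²₀`. -/
def linOp (σx σθ lam τ χ : ℝ) {γ σc : ℝ} (hγ : 0 < γ) (hσc : 0 < σc) : L20 →ₗ.[ℝ] L20 where
  domain := H20
  toFun :=
    { toFun := fun f => (exists_isLin σx σθ lam τ χ hγ hσc f).choose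
      map_add' := fun f g => (exists_isLin σx σθ lam τ χ hγ hσc (f + g)).choose_spec.unique hγ hσc
        ((exists_isLin σx σθ lam τ χ hγ hσc f).choose_spec.add
          (exists_isLin σx σθ lam τ χ hγ hσc g).choose_spec)
      map_smul' := fun a f => (exists_isLin σx σθ lam τ χ hγ hσc (a • f)).choose_spec.unique hγ hσc
        ((exists_isLin σx σθ lam τ χ hγ hσc f).choose_spec.smul a) }

/-- `linOp` is given by the defining formula of the linearized operator. -/
lemma linOp_spec (σx σθ lam τ χ : ℝ) {γ σc : ℝ} (hγ : 0 < γ) (hσc : 0 < σc) (f : H20) :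
    IsLin σx σθ lam γ σc τ χ f (linOp σx σθ lam τ χ hγ hσc f) :=
  (exists_isLin σx σθ lam τ χ hγ hσc f).choose_spec

/-- The kernel of an operator in `L²₀`, as a subspace of `L²₀`. -/
def kernel (T : L20 →ₗ.[ℝ] L20) : Submodule ℝ L20 := (LinearMap.ker T.toFun).map T.domain.subtype

/-- The range of an operator in `L²₀`; the cokernel is `L20 ⧸ range T`, and `(range T)ᗮ` in the
Hilbert space picture. -/
def range (T : L20 →ₗ.[ℝ] L20) : Submodule ℝ L20 := LinearMap.range T.toFun

/-! ## The functions spanning the kernel and the cokernel -/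

/-- An integer wave vector as a real vector. -/
def waveVec (ℓ : Fin 2 → ℤ) : Fin 2 → ℝ := fun i => ℓ i

/-- The multiplier `4π² σ_x |ℓ|² + 2πi λ v_θ · ℓ` of `-σ_x Δ_x + λ v_θ · ∇_x`. -/
def transportMult (σx lam : ℝ) (ℓ : Fin 2 → ℤ) (θ : Ang) : ℂ :=
  ((4 * Real.pi ^ 2 * σx * (waveVec ℓ ⬝ᵥ waveVec ℓ) : ℝ) : ℂ)
    + Complex.I * ((2 * Real.pi * lam * (dir θ ⬝ᵥ waveVec ℓ) : ℝ) : ℂ)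

/-- The multiplier of `B_τ`,
`(2πi v_θ^⊥ · ℓ - 4π² τ v_θ^⊥ · (ℓ ⊗ ℓ) v_θ) / (γ + 4π² σ_c |ℓ|²)`. -/
def turningMult (γ σc τ : ℝ) (ℓ : Fin 2 → ℤ) (θ : Ang) : ℂ :=
  (Complex.I * ((2 * Real.pi * (dirPerp θ ⬝ᵥ waveVec ℓ) : ℝ) : ℂ)
    - ((4 * Real.pi ^ 2 * τ *
        (dirPerp θ ⬝ᵥ (Matrix.vecMulVec (waveVec ℓ) (waveVec ℓ) *ᵥ dir θ)) : ℝ) : ℂ))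
    / (ellSymbol γ σc ℓ : ℂ)

/-- `u ∈ H²` solves `(-M_ℓ + σ_θ ∂_θθ) u = g` on the circle, where `M_ℓ` is the multiplier
`transportMult`. -/
def SolvesResolvent (σx lam σθ : ℝ) (ℓ : Fin 2 → ℤ) (g : Ang → ℂ) (u : L2Ang) : Prop :=
  ∃ u₁ u₂ : L2Ang, IsAngDeriv u u₁ ∧ IsAngDeriv u₁ u₂ ∧
    ∀ᵐ θ : Ang, -transportMult σx lam ℓ θ * u θ + σθ * u₂ θ = g θ

open Classical in
/-- The resolvent `(-M_ℓ + σ_θ ∂_θθ)⁻¹ g`. For `σ_x, σ_θ > 0`, `ℓ ≠ 0` and square integrable `g` the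
equation has exactly one solution, because the real part of `M_ℓ` is a positive constant. -/
def resolvent (σx lam σθ : ℝ) (ℓ : Fin 2 → ℤ) (g : Ang → ℂ) : L2Ang :=
  if h : ∃ u, SolvesResolvent σx lam σθ ℓ g u then h.choose else 0

/-- `U^ℓ = (-M_ℓ + σ_θ ∂_θθ)⁻¹ ∂_θ B_ℓ`. -/
def modeU (σx lam γ σc τ σθ : ℝ) (ℓ : Fin 2 → ℤ) : L2Ang :=
  resolvent σx lam σθ ℓ (angleDeriv (turningMult γ σc τ ℓ))

/-- `V^ℓ = -(-M_{-ℓ} + σ_θ ∂_θθ)⁻¹ 1`. -/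
def modeV (σx lam σθ : ℝ) (ℓ : Fin 2 → ℤ) : L2Ang :=
  -resolvent σx lam σθ (-ℓ) (fun _ => 1)

lemma memLp_wave (ℓ : Fin 2 → ℤ) (a : L2Ang) :
    MemLp (fun p : Phase => UnitAddTorus.mFourier ℓ p.1 * a p.2) 2 volume := by
  have ha : MemLp (fun p : Phase => a p.2) 2 volume := (Lp.memLp a).comp_snd volume
  refine ha.of_le_mul (c := 1) ?_ (Filter.Eventually.of_forall fun p => ?_)
  · exact ((UnitAddTorus.mFourier ℓ).continuous.comp continuous_fst).aestronglyMeasurable.mul ha.1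
  · rw [norm_mul]
    gcongr
    exact ((UnitAddTorus.mFourier ℓ).norm_coe_le_norm _).trans UnitAddTorus.mFourier_norm.le

lemma memLp_realWave (ℓ : Fin 2 → ℤ) (a b : L2Ang) :
    MemLp (fun p : Phase => (UnitAddTorus.mFourier ℓ p.1 * a p.2
      + UnitAddTorus.mFourier (-ℓ) p.1 * b p.2).re) 2 volume :=
  ((memLp_wave ℓ a).add (memLp_wave (-ℓ) b)).re

/-- The function `a(θ) e^{2πi ℓ·x} + b(θ) e^{-2πi ℓ·x}`, whose partial Fourier transform in `x` is
`a` at `ℓ`, `b` at `-ℓ` and zero elsewhere. It is used only for `b = conj a`, where it is real; the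
real part is there to make it a real function by type. -/
def realWave (ℓ : Fin 2 → ℤ) (a b : L2Ang) : L2Phase := (memLp_realWave ℓ a b).toLp

/-- `φ^ℓ`, with partial Fourier modes `U^ℓ` at `ℓ` and `U^{-ℓ}` at `-ℓ`. -/
def phi (σx lam γ σc τ σθ : ℝ) (ℓ : Fin 2 → ℤ) : L2Phase :=
  realWave ℓ (modeU σx lam γ σc τ σθ ℓ) (modeU σx lam γ σc τ σθ (-ℓ))

/-- The translate of `φ^ℓ`, with partial Fourier modes `i U^ℓ` at `ℓ` and `-i U^{-ℓ}` at `-ℓ`. -/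
def phiBis (σx lam γ σc τ σθ : ℝ) (ℓ : Fin 2 → ℤ) : L2Phase :=
  realWave ℓ (Complex.I • modeU σx lam γ σc τ σθ ℓ) (-Complex.I • modeU σx lam γ σc τ σθ (-ℓ))

/-- `ψ^ℓ`, with partial Fourier modes `V^ℓ` at `ℓ` and `V^{-ℓ}` at `-ℓ`. -/
def psi (σx lam σθ : ℝ) (ℓ : Fin 2 → ℤ) : L2Phase :=
  realWave ℓ (modeV σx lam σθ ℓ) (modeV σx lam σθ (-ℓ))

/-- The translate of `ψ^ℓ`, with partial Fourier modes `i V^ℓ` at `ℓ` and `-i V^{-ℓ}` at `-ℓ`. -/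
def psiBis (σx lam σθ : ℝ) (ℓ : Fin 2 → ℤ) : L2Phase :=
  realWave ℓ (Complex.I • modeV σx lam σθ ℓ) (-Complex.I • modeV σx lam σθ (-ℓ))

/-- `k²` is not a sum of two positive squares. -/
def NonPythagorean (k : ℕ) : Prop := ∀ l m : ℕ, 0 < l → 0 < m → k ^ 2 ≠ l ^ 2 + m ^ 2

/-- The number of lattice points on the circle of radius `k`, the origin excluded. -/
def latticeCount (k : ℕ) : ℕ :=
  Set.ncard {m : Fin 2 → ℤ | m ≠ 0 ∧ m 0 ^ 2 + m 1 ^ 2 = (k : ℤ) ^ 2}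

end AntModel
end

/-! In Fourier coefficients f̂(m,n) over the phase space the operator splits over the wave vectors
m. Multiplication by cos θ and sin θ shifts n by one, so diffusion and transport become minus an
operator A_m on sequences over ℤ (`modeOp`): a positive diagonal plus a skew-adjoint pair of shifts.
The potential sees f only through its integral over θ, so the chemotactic term is rank one on each
m: the fixed finite sequence `turnCoeff` times χ f̂(m,0) (`phaseCoeff_linExpr`).

For m ≠ 0 the skew part drops out of the energy, hence A_m is coercive, invertible on ℓ² and gains
the diagonal (`exists_diagSkew_eq`, `diagSkew_energy`, `diagSkew_regularity`). The gain is uniform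
in m, so L_0, the operator with χ = 0, is a bijection from H²₀ onto L²₀ (`linOp_zero_bijective`).
Every g is therefore some L_0 h, and L_χ f = L_0 h says f̂(m,·) = ĥ(m,·) + χ f̂(m,0) K_m with A_m
K_m = -`turnCoeff`, that is, K_m = U^m/2π (`kernelMode`). At n = 0 this closes into one scalar
equation per wave vector, (1 - χ K_m(0)) f̂(m,0) = ĥ(m,0). A rotation shows that K_m(0) = Y(|m|)
depends only on the length of m (`kernelMode_zero`, `radialMass`).

So take χ = 1/Y(k). The set C of critical wave vectors, those with χ Y(|m|) = 1, is exactly the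
circle |m| = k as soon as Y(k) > 0 and Y(√N) ≠ Y(k) for every other integer N ≥ 1. This is where
small σ_θ enters (`exists_diffusion_threshold`). Without angular diffusion the radial recurrence has
constant coefficients and is solved by a geometric sequence; one corrector gives Y = Y₀ + σ_θ Y₁ +
O(σ_θ²) in closed form (`abs_radialMass_sub_expansion_le`). Two lengths may share the same Y₀, but
then their Y₁ differ: equality of Y₀ forces κ = λτ/σ_x > 1, and for κ > 1 the ratio Y₁/Y₀ is
strictly monotone (`massCorr_ne`, `corrFun_mul_leadFun_lt`). Each single N is thus excluded for
small σ_θ, and the decay Y(r) = O(1/r²), uniform in σ_θ, leaves finitely many N to treat.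

The rest is linear algebra. An element of the kernel is determined by its values f̂(m,0) on C, which
are arbitrary up to the reality condition, so the dimension is card C. L_0 h lies in the range
exactly when ĥ(m,0) = 0 on C (`IsCritical.mem_range_iff`), since 1 - χ Y stays away from zero off C.
Because V^ℓ solves the adjoint mode equation with right-hand side 1, pairing L_0 h with ψ^ℓ and its
bis companion reads off the real and imaginary parts of ĥ(ℓ,0) (`inner_psi`, `inner_psiBis`). The
range is therefore the orthogonal complement of the finite-dimensional span of the ψ's, and that
span is the kernel of the adjoint. For non-Pythagorean k, the vectors k₁ and k₂ represent the circle
up to sign. -/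

noncomputable section
namespace AntModel
open MeasureTheory Submodule Matrix
open scoped ComplexConjugate

/-! ## Square summable families -/

/-- Square summability of a family of complex numbers. -/
def SqSum {ι : Type*} (x : ι → ℂ) : Prop := Summable fun i => ‖x i‖ ^ 2

section SqSum
variable {ι : Type*} {x y : ι → ℂ}

lemma SqSum.of_le (hy : SqSum y) (C : ℝ) (h : ∀ i, ‖x i‖ ≤ C * ‖y i‖) : SqSum x := by
  refine Summable.of_nonneg_of_le (fun _ => by positivity) (fun i => ?_) (Summable.mul_left (C ^ 2) hy)
  rw [← mul_pow]
  exact pow_le_pow_left₀ (norm_nonneg _) (h i) 2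

lemma SqSum.const_mul (hx : SqSum x) (c : ℂ) : SqSum fun i => c * x i :=
  hx.of_le ‖c‖ fun _ => (norm_mul _ _).le

lemma norm_add_sq_le (a b : ℂ) : ‖a + b‖ ^ 2 ≤ 2 * ‖a‖ ^ 2 + 2 * ‖b‖ ^ 2 := by
  have := norm_add_le a b
  nlinarith [sq_nonneg (‖a‖ - ‖b‖), norm_nonneg (a + b)]

lemma SqSum.add (hx : SqSum x) (hy : SqSum y) : SqSum fun i => x i + y i :=
  Summable.of_nonneg_of_le (fun _ => by positivity) (fun _ => norm_add_sq_le _ _)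
    ((Summable.mul_left 2 hx).add (Summable.mul_left 2 hy))

lemma SqSum.neg (hx : SqSum x) : SqSum fun i => -x i := by simpa [SqSum] using hx

lemma SqSum.sub (hx : SqSum x) (hy : SqSum y) : SqSum fun i => x i - y i := by
  simpa [sub_eq_add_neg] using hx.add hy.neg

lemma SqSum.comp {κ : Type*} (hx : SqSum x) {e : κ → ι} (he : Function.Injective e) :
    SqSum fun i => x (e i) :=
  Summable.comp_injective hx he

lemma SqSum.shift {x : ℤ → ℂ} (hx : SqSum x) (k : ℤ) : SqSum fun n => x (n + k) :=
  hx.comp (add_left_injective k)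

lemma SqSum.of_finite (h : (Function.support x).Finite) : SqSum x :=
  summable_of_hasFiniteSupport (h.subset fun _ hi => by
    simp only [Function.mem_support] at hi ⊢
    rintro h; simp [h] at hi)

lemma SqSum.conj_mul (hx : SqSum x) (hy : SqSum y) : Summable fun i => conj (x i) * y i := by
  refine Summable.of_norm_bounded (g := fun i => ‖x i‖ ^ 2 + ‖y i‖ ^ 2) (Summable.add hx hy)
    fun i => ?_
  rw [norm_mul, RCLike.norm_conj]
  nlinarith [sq_nonneg (‖x i‖ - ‖y i‖), norm_nonneg (x i), norm_nonneg (y i)]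

lemma sqSum_iff_memℓp : SqSum x ↔ Memℓp x 2 := by
  rw [memℓp_gen_iff (by norm_num)]
  simp [SqSum]

lemma sqSum_coe (z : lp (fun _ : ι => ℂ) 2) : SqSum z := sqSum_iff_memℓp.mpr (lp.memℓp z)

/-- A square summable family as an element of `ℓ²`. -/
def SqSum.toLp (hx : SqSum x) : lp (fun _ : ι => ℂ) 2 := ⟨x, sqSum_iff_memℓp.mp hx⟩

@[simp] lemma SqSum.coe_toLp (hx : SqSum x) : ⇑hx.toLp = x := rfl

lemma SqSum.norm_tsum_le (hx : SqSum x) (hy : SqSum y) :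
    ‖∑' i, conj (x i) * y i‖ ≤ √(∑' i, ‖x i‖ ^ 2) * √(∑' i, ‖y i‖ ^ 2) := by
  have h := norm_inner_le_norm (𝕜 := ℂ) hx.toLp hy.toLp
  have hn : ∀ {z : ι → ℂ} (hz : SqSum z), ‖hz.toLp‖ = √(∑' i, ‖z i‖ ^ 2) := fun hz => by
    have := lp.norm_rpow_eq_tsum (p := 2) (by norm_num) hz.toLp
    simp only [ENNReal.toReal_ofNat, Real.rpow_ofNat, SqSum.coe_toLp] at this
    rw [← this, Real.sqrt_sq (norm_nonneg _)]
  rw [hn, hn, lp.inner_eq_tsum] at h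
  simpa [mul_comm] using h

lemma SqSum.norm_sq_le (hx : SqSum x) (i : ι) : ‖x i‖ ^ 2 ≤ ∑' i, ‖x i‖ ^ 2 :=
  Summable.le_tsum hx i fun _ _ => by positivity

end SqSum

lemma tsum_shift {M : Type*} [AddCommMonoid M] [TopologicalSpace M] (f : ℤ → M) (k : ℤ) :
    ∑' n, f (n + k) = ∑' n, f n := (Equiv.addRight k).tsum_eq f

/-! ## Diagonal operators perturbed by a skew-adjoint pair of shifts -/

/-- The skew-adjoint operator `x ↦ μ x(· - 1) - conj μ x(· + 1)` on sequences. -/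
def skewShift (μ : ℂ) (x : ℤ → ℂ) (n : ℤ) : ℂ := μ * x (n - 1) - conj μ * x (n + 1)

/-- The operator `x ↦ D x + μ x(· - 1) - conj μ x(· + 1)` on sequences. -/
def diagSkew (D : ℤ → ℝ) (μ : ℂ) (x : ℤ → ℂ) (n : ℤ) : ℂ := D n * x n + skewShift μ x n

lemma SqSum.skewShift {x : ℤ → ℂ} (hx : SqSum x) (μ : ℂ) : SqSum (skewShift μ x) :=
  ((hx.shift (-1)).const_mul μ).sub ((hx.shift 1).const_mul (conj μ))

lemma diagSkew_add (D : ℤ → ℝ) (μ : ℂ) (x y : ℤ → ℂ) (n : ℤ) :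
    diagSkew D μ (fun n => x n + y n) n = diagSkew D μ x n + diagSkew D μ y n := by
  simp only [diagSkew, skewShift]; ring

lemma diagSkew_const_mul (D : ℤ → ℝ) (μ c : ℂ) (x : ℤ → ℂ) (n : ℤ) :
    diagSkew D μ (fun n => c * x n) n = c * diagSkew D μ x n := by
  simp only [diagSkew, skewShift]; ring

/-- The two unit shifts are adjoint to each other by translation invariance of the sum over ℤ, and
the coefficients μ and -conj μ are placed so that the adjoint returns with the opposite sign. -/
lemma tsum_conj_skewShift (μ : ℂ) {x y : ℤ → ℂ} (hx : SqSum x) (hy : SqSum y) :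
    ∑' n, conj (x n) * skewShift μ y n = -∑' n, conj (skewShift μ x n) * y n := by
  have s1 := ((hx.const_mul (conj μ)).conj_mul (hy.shift (-1)))
  have s2 := ((hx.const_mul μ).conj_mul (hy.shift 1))
  have s3 := (((hx.shift (-1)).const_mul μ).conj_mul hy)
  have s4 := (((hx.shift 1).const_mul (conj μ)).conj_mul hy)
  have e1 : ∑' n, conj (x n) * skewShift μ y n = ∑' n, conj (conj μ * x n) * y (n + -1)
      - ∑' n, conj (μ * x n) * y (n + 1) := by
    rw [← s1.tsum_sub s2]
    refine tsum_congr fun n => ?_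
    simp only [skewShift, map_mul, Complex.conj_conj, ← sub_eq_add_neg]; ring
  have e2 : ∑' n, conj (skewShift μ x n) * y n = ∑' n, conj (μ * x (n + -1)) * y n
      - ∑' n, conj (conj μ * x (n + 1)) * y n := by
    rw [← s3.tsum_sub s4]
    refine tsum_congr fun n => ?_
    simp only [skewShift, map_mul, map_sub, Complex.conj_conj, ← sub_eq_add_neg]; ring
  rw [e1, e2, ← tsum_shift (fun n => conj (conj μ * x n) * y (n + -1)) 1,
    ← tsum_shift (fun n => conj (μ * x n) * y (n + 1)) (-1)]
  simp

/-- Every operator `diagSkew` with positive diagonal bounded below is onto `ℓ²`. -/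
lemma exists_diagSkew_eq {D : ℤ → ℝ} {d : ℝ} (hd : 0 < d) (hD : ∀ n, d ≤ D n) (μ : ℂ)
    {g : ℤ → ℂ} (hg : SqSum g) : ∃ x, SqSum x ∧ ∀ n, diagSkew D μ x n = g n := by
  -- Symmetrise with w = D^(-1/2), which is bounded by d^(-1/2). With x = w z and S the skew shift,
  -- the equation multiplied by w reads z + w S w z = w g, and w S w is skew-adjoint.
  set w : ℤ → ℝ := fun n => (√(D n))⁻¹ with hw
  have hDp : ∀ n, 0 < D n := fun n => hd.trans_le (hD n)
  have hw0 : ∀ n, 0 < w n := fun n => inv_pos.mpr (Real.sqrt_pos.mpr (hDp n))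
  have hwD : ∀ n, D n * w n * w n = 1 := fun n => by
    have h1 := Real.mul_self_sqrt (hDp n).le
    have h2 := (Real.sqrt_pos.mpr (hDp n)).ne'
    simp only [hw]
    field_simp
    rw [pow_two, h1]
  have hwb : ∀ n, w n ≤ (√d)⁻¹ := fun n =>
    inv_anti₀ (Real.sqrt_pos.mpr hd) (Real.sqrt_le_sqrt (hD n))
  have hws : ∀ {x : ℤ → ℂ}, SqSum x → SqSum fun n => (w n : ℂ) * x n := fun hx =>
    hx.of_le (√d)⁻¹ fun n => by
      rw [norm_mul, Complex.norm_real, Real.norm_of_nonneg (hw0 n).le]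
      gcongr
      exact hwb n
  have hNs : ∀ z : lp (fun _ : ℤ => ℂ) 2,
      SqSum fun n => -Complex.I * ((w n : ℂ) * skewShift μ (fun n => w n * z n) n) := fun z =>
    (hws ((hws (sqSum_coe z)).skewShift μ)).const_mul _
  let T : lp (fun _ : ℤ => ℂ) 2 →ₗ[ℂ] lp (fun _ : ℤ => ℂ) 2 :=
    { toFun := fun z => (hNs z).toLp
      map_add' := fun z z' => by
        ext n
        simp only [SqSum.coe_toLp, lp.coeFn_add, Pi.add_apply, skewShift]
        ring
      map_smul' := fun c z => by
        ext n
        simp only [SqSum.coe_toLp, lp.coeFn_smul, Pi.smul_apply, skewShift, smul_eq_mul,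
          RingHom.id_apply]
        ring }
  have hT : T.IsSymmetric := by
    intro z z'
    rw [lp.inner_eq_tsum, lp.inner_eq_tsum]
    have h := tsum_conj_skewShift μ (hws (sqSum_coe z)) (hws (sqSum_coe z'))
    have e1 : ∑' n, inner ℂ (T z n) (z' n)
        = Complex.I * ∑' n, conj (skewShift μ (fun n => (w n : ℂ) * z n) n) * (w n * z' n) := by
      rw [← tsum_mul_left]
      refine tsum_congr fun n => ?_
      simp only [T, LinearMap.coe_mk, AddHom.coe_mk, SqSum.coe_toLp, RCLike.inner_apply, map_mul,
        map_neg, Complex.conj_I, Complex.conj_ofReal]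
      ring
    have e2 : ∑' n, inner ℂ (z n) (T z' n)
        = -Complex.I * ∑' n, conj ((w n : ℂ) * z n) * skewShift μ (fun n => (w n : ℂ) * z' n) n := by
      rw [← tsum_mul_left]
      refine tsum_congr fun n => ?_
      simp only [T, LinearMap.coe_mk, AddHom.coe_mk, SqSum.coe_toLp, RCLike.inner_apply, map_mul,
        Complex.conj_ofReal]
      ring
    rw [e1, e2, h]
    ring
  -- T = -i w S w is symmetric and everywhere defined, hence bounded and self-adjoint
  -- (Hellinger–Toeplitz). Its spectrum is real, so i - T is invertible, and (i - T) z = i (z + w S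
  -- w z).
  set S := hT.toSelfAdjoint with hS
  have hu : IsUnit (algebraMap ℂ (lp (fun _ : ℤ => ℂ) 2 →L[ℂ] lp (fun _ : ℤ => ℂ) 2) Complex.I
      - (S : lp (fun _ : ℤ => ℂ) 2 →L[ℂ] lp (fun _ : ℤ => ℂ) 2)) := by
    by_contra hcon
    have := S.2.im_eq_zero_of_mem_spectrum (z := Complex.I) hcon
    simp at this
  obtain ⟨v, hv⟩ := hu.exists_right_inv
  set z := v ((hws hg).const_mul Complex.I).toLp with hz
  have hzeq : Complex.I • z - T z = ((hws hg).const_mul Complex.I).toLp := by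
    have := DFunLike.congr_fun hv ((hws hg).const_mul Complex.I).toLp
    simp [Algebra.algebraMap_eq_smul_one] at this
    exact this
  refine ⟨fun n => w n * z n, hws (sqSum_coe z), fun n => ?_⟩
  have hn := congrFun (congrArg (fun f : lp (fun _ : ℤ => ℂ) 2 => (f : ℤ → ℂ)) hzeq) n
  simp only [lp.coeFn_sub, Pi.sub_apply, lp.coeFn_smul, Pi.smul_apply, smul_eq_mul,
    SqSum.coe_toLp, T, LinearMap.coe_mk, AddHom.coe_mk] at hn
  have hwc : (w n : ℂ) ≠ 0 := Complex.ofReal_ne_zero.mpr (hw0 n).ne'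
  have hwD' : (D n : ℂ) * w n * w n = 1 := by exact_mod_cast hwD n
  refine mul_left_cancel₀ (mul_ne_zero Complex.I_ne_zero hwc) ?_
  rw [diagSkew]
  linear_combination hn + Complex.I * z n * hwD'

/-- The energy estimate for `diagSkew`. -/
lemma diagSkew_energy {D : ℤ → ℝ} {d : ℝ} (hd : 0 < d) (hD : ∀ n, d ≤ D n) (μ : ℂ)
    {x : ℤ → ℂ} (hx : SqSum x) (hg : SqSum (diagSkew D μ x)) :
    d ^ 2 * ∑' n, ‖x n‖ ^ 2 ≤ ∑' n, ‖diagSkew D μ x n‖ ^ 2 := by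
  have hk := hx.skewShift μ
  have hDx : SqSum fun n => (D n : ℂ) * x n := by
    simpa [diagSkew] using hg.sub hk
  have h1 : ∑' n, conj (x n) * diagSkew D μ x n = ∑' n, conj (x n) * (D n * x n)
      + ∑' n, conj (x n) * skewShift μ x n := by
    rw [← (hx.conj_mul hDx).tsum_add (hx.conj_mul hk)]
    exact tsum_congr fun n => by rw [diagSkew]; ring
  -- By skewness the sum is minus its own conjugate.
  have h2 : (∑' n, conj (x n) * skewShift μ x n).re = 0 := by
    have h := congrArg Complex.re (tsum_conj_skewShift μ hx hx)
    have h' : ∑' n, conj (skewShift μ x n) * x n = conj (∑' n, conj (x n) * skewShift μ x n) := by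
      rw [Complex.conj_tsum]
      exact tsum_congr fun n => by simp [mul_comm]
    rw [h', Complex.neg_re, Complex.conj_re] at h
    linarith
  have h3 : d * ∑' n, ‖x n‖ ^ 2 ≤ (∑' n, conj (x n) * (D n * x n)).re := by
    rw [Complex.re_tsum (hx.conj_mul hDx), ← tsum_mul_left]
    have e : ∀ n, (conj (x n) * (D n * x n)).re = D n * ‖x n‖ ^ 2 := fun n => by
      rw [mul_left_comm, Complex.conj_mul', ← Complex.ofReal_pow, ← Complex.ofReal_mul,
        Complex.ofReal_re]
    refine Summable.tsum_le_tsum (fun n => ?_) (Summable.mul_left d hx) ?_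
    · rw [e]; gcongr; exact hD n
    · exact (Complex.reCLM.summable (hx.conj_mul hDx))
  have h4 := (Complex.re_le_norm _).trans (hx.norm_tsum_le hg)
  rw [h1, Complex.add_re, h2, add_zero] at h4
  set A := ∑' n, ‖x n‖ ^ 2
  set B := ∑' n, ‖diagSkew D μ x n‖ ^ 2
  have hA : 0 ≤ A := tsum_nonneg fun _ => by positivity
  have hB : 0 ≤ B := tsum_nonneg fun _ => by positivity
  have h5 : d * √A * √A ≤ √A * √B := by
    rw [mul_assoc, Real.mul_self_sqrt hA]; exact h3.trans h4
  have h6 : d * √A ≤ √B := by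
    rcases (Real.sqrt_nonneg A).eq_or_lt with h0 | h0
    · rw [← h0]; simp
    · exact le_of_mul_le_mul_right (by linarith) h0
  calc d ^ 2 * A = (d * √A) ^ 2 := by rw [mul_pow, Real.sq_sqrt hA]
    _ ≤ (√B) ^ 2 := pow_le_pow_left₀ (by positivity) h6 2
    _ = B := Real.sq_sqrt hB

/-- The energy estimate applied to the difference, whose image vanishes. -/
lemma diagSkew_injective {D : ℤ → ℝ} {d : ℝ} (hd : 0 < d) (hD : ∀ n, d ≤ D n) (μ : ℂ)
    {x y : ℤ → ℂ} (hx : SqSum x) (hy : SqSum y)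
    (h : ∀ n, diagSkew D μ x n = diagSkew D μ y n) : x = y := by
  have hz := hx.add (hy.const_mul (-1))
  have h0 : ∀ n, diagSkew D μ (fun n => x n + -1 * y n) n = 0 := fun n => by
    rw [diagSkew_add, diagSkew_const_mul, h]; ring
  have hs : SqSum (diagSkew D μ fun n => x n + -1 * y n) := by
    simp only [SqSum, h0]
    simp [summable_zero]
  have := diagSkew_energy hd hD μ hz hs
  simp only [h0, norm_zero, ne_eq, OfNat.ofNat_ne_zero, not_false_eq_true, zero_pow,
    tsum_zero] at this
  have h1 : ∑' n, ‖x n + -1 * y n‖ ^ 2 ≤ 0 := by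
    by_contra hc
    push Not at hc
    nlinarith [mul_pos (pow_pos hd 2) hc]
  funext n
  have h2 := (hz.norm_sq_le n).trans h1
  have h3 : x n + -1 * y n = 0 := norm_eq_zero.mp (by nlinarith [norm_nonneg (x n + -1 * y n)])
  linear_combination h3

/-- The diagonal part of `diagSkew` is controlled by `diagSkew`. -/
lemma diagSkew_regularity {D : ℤ → ℝ} {d : ℝ} (hd : 0 < d) (hD : ∀ n, d ≤ D n) (μ : ℂ)
    {x : ℤ → ℂ} (hx : SqSum x) (hg : SqSum (diagSkew D μ x)) :
    SqSum (fun n => (D n : ℂ) * x n) ∧ ∑' n, ‖(D n : ℂ) * x n‖ ^ 2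
      ≤ (2 + 8 * ‖μ‖ ^ 2 / d ^ 2) * ∑' n, ‖diagSkew D μ x n‖ ^ 2 := by
  have hk := hx.skewShift μ
  have hDx : SqSum fun n => (D n : ℂ) * x n := by
    simpa [diagSkew] using hg.sub hk
  refine ⟨hDx, ?_⟩
  -- Solve for D x and use ‖a + b‖² ≤ 2‖a‖² + 2‖b‖² twice. The two shifted copies of 4‖μ‖²‖x‖²
  -- become the term 8‖μ‖²/d² through the energy estimate.
  have hb : ∀ n, ‖(D n : ℂ) * x n‖ ^ 2 ≤ 2 * ‖diagSkew D μ x n‖ ^ 2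
      + (4 * ‖μ‖ ^ 2 * ‖x (n + -1)‖ ^ 2 + 4 * ‖μ‖ ^ 2 * ‖x (n + 1)‖ ^ 2) := fun n => by
    have e : (D n : ℂ) * x n = diagSkew D μ x n + (-(μ * x (n + -1)) + conj μ * x (n + 1)) := by
      rw [diagSkew, skewShift]; ring_nf
    have h1 := norm_add_sq_le (diagSkew D μ x n) (-(μ * x (n + -1)) + conj μ * x (n + 1))
    have h2 := norm_add_sq_le (-(μ * x (n + -1))) (conj μ * x (n + 1))
    rw [← e] at h1
    rw [norm_neg, norm_mul, norm_mul, RCLike.norm_conj, mul_pow, mul_pow] at h2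
    linarith
  have s1 := Summable.mul_left (4 * ‖μ‖ ^ 2) (hx.shift (-1))
  have s2 := Summable.mul_left (4 * ‖μ‖ ^ 2) (hx.shift 1)
  have s0 := Summable.mul_left 2 hg
  have h := Summable.tsum_le_tsum hb hDx (s0.add (s1.add s2))
  rw [s0.tsum_add (s1.add s2), s1.tsum_add s2, tsum_mul_left, tsum_mul_left, tsum_mul_left,
    tsum_shift (fun n => ‖x n‖ ^ 2), tsum_shift (fun n => ‖x n‖ ^ 2)] at h
  have he := diagSkew_energy hd hD μ hx hg
  have hx' : ∑' n, ‖x n‖ ^ 2 ≤ (∑' n, ‖diagSkew D μ x n‖ ^ 2) / d ^ 2 := by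
    rw [le_div_iff₀ (by positivity)]; linarith
  calc _ ≤ _ := h
    _ ≤ 2 * (∑' n, ‖diagSkew D μ x n‖ ^ 2)
      + (4 * ‖μ‖ ^ 2 * ((∑' n, ‖diagSkew D μ x n‖ ^ 2) / d ^ 2)
        + 4 * ‖μ‖ ^ 2 * ((∑' n, ‖diagSkew D μ x n‖ ^ 2) / d ^ 2)) := by gcongr
    _ = _ := by ring

/-- The duality between `diagSkew D μ` and its adjoint `diagSkew D (-μ)`. -/
lemma tsum_conj_diagSkew {D : ℤ → ℝ} (μ : ℂ) {x y : ℤ → ℂ} (hx : SqSum x) (hy : SqSum y)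
    (hx' : SqSum (diagSkew D (-μ) x)) (hy' : SqSum (diagSkew D μ y)) :
    ∑' n, conj (x n) * diagSkew D μ y n = ∑' n, conj (diagSkew D (-μ) x n) * y n := by
  have hDx : SqSum fun n => (D n : ℂ) * x n := by
    simpa [diagSkew] using hx'.sub (hx.skewShift (-μ))
  have hDy : SqSum fun n => (D n : ℂ) * y n := by
    simpa [diagSkew] using hy'.sub (hy.skewShift μ)
  have e1 : ∑' n, conj (x n) * diagSkew D μ y n = ∑' n, conj (x n) * (D n * y n)
      + ∑' n, conj (x n) * skewShift μ y n := by
    rw [← (hx.conj_mul hDy).tsum_add (hx.conj_mul (hy.skewShift μ))]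
    exact tsum_congr fun n => by rw [diagSkew]; ring
  have e2 : ∑' n, conj (diagSkew D (-μ) x n) * y n = ∑' n, conj (D n * x n) * y n
      + ∑' n, conj (skewShift (-μ) x n) * y n := by
    rw [← (hDx.conj_mul hy).tsum_add ((hx.skewShift (-μ)).conj_mul hy)]
    exact tsum_congr fun n => by rw [diagSkew, map_add]; ring
  rw [e1, e2, tsum_conj_skewShift μ hx hy, ← tsum_neg]
  congr 1
  · exact tsum_congr fun n => by simp; ring
  · exact tsum_congr fun n => by simp [skewShift]; ring

/-- The square summable solution `x` of `diagSkew D μ x = g`. -/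
def modeSol (D : ℤ → ℝ) (μ : ℂ) (g : ℤ → ℂ) : ℤ → ℂ :=
  Classical.epsilon fun x => SqSum x ∧ ∀ n, diagSkew D μ x n = g n

lemma modeSol_spec {D : ℤ → ℝ} {d : ℝ} (hd : 0 < d) (hD : ∀ n, d ≤ D n) (μ : ℂ)
    {g : ℤ → ℂ} (hg : SqSum g) :
    SqSum (modeSol D μ g) ∧ ∀ n, diagSkew D μ (modeSol D μ g) n = g n :=
  Classical.epsilon_spec (exists_diagSkew_eq hd hD μ hg)

lemma eq_modeSol {D : ℤ → ℝ} {d : ℝ} (hd : 0 < d) (hD : ∀ n, d ≤ D n) {μ : ℂ}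
    {g x : ℤ → ℂ} (hg : SqSum g) (hx : SqSum x) (h : ∀ n, diagSkew D μ x n = g n) :
    x = modeSol D μ g :=
  diagSkew_injective hd hD μ hx (modeSol_spec hd hD μ hg).1
    fun n => by rw [h, (modeSol_spec hd hD μ hg).2]

end AntModel
end

noncomputable section
namespace AntModel
open MeasureTheory Submodule Matrix
open scoped ComplexConjugate

/-! ## Sequences on `ℤ` with the parity `y (-n) = (-1)^n y n` -/

/-- The extension of a sequence on `ℕ` by `y (-n) = (-1)^n y n`. -/
def parityExt (p : ℕ → ℝ) : ℤ → ℝ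
  | Int.ofNat k => p k
  | Int.negSucc k => (-1) ^ (k + 1) * p (k + 1)

lemma parityExt_natCast (p : ℕ → ℝ) (k : ℕ) : parityExt p (k : ℤ) = p k := rfl

lemma parityExt_zero (p : ℕ → ℝ) : parityExt p 0 = p 0 := rfl

lemma parityExt_neg (p : ℕ → ℝ) (k : ℕ) : parityExt p (-(k : ℤ)) = (-1) ^ k * p k := by
  cases k with
  | zero => simp [parityExt_zero]
  | succ k => rfl

lemma sqSum_parityExt {p : ℕ → ℝ} (hp : SqSum fun n => (p n : ℂ)) :
    SqSum fun n => (parityExt p n : ℂ) := by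
  refine Summable.of_nat_of_neg (f := fun n : ℤ => ‖(parityExt p n : ℂ)‖ ^ 2) ?_ ?_
  · exact hp
  · refine Summable.congr hp fun k => ?_
    rw [parityExt_neg]
    simp

/-- With an even diagonal and a real coefficient the operator preserves the parity, so only the
equations at n ≥ 0 remain. At n = 0 the neighbours are -p 1 and p 1, whence the factor 2 in the
boundary equation. -/
lemma diagSkew_parityExt {D b p : ℕ → ℝ} {μ : ℝ} (h0 : D 0 * p 0 - 2 * μ * p 1 = b 0)
    (h1 : ∀ k, D (k + 1) * p (k + 1) + μ * (p k - p (k + 2)) = b (k + 1)) (n : ℤ) :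
    diagSkew (fun n => D n.natAbs) μ (fun n => (parityExt p n : ℂ)) n = (parityExt b n : ℂ) := by
  have key : D n.natAbs * parityExt p n + μ * (parityExt p (n - 1) - parityExt p (n + 1))
      = parityExt b n := by
    obtain ⟨k, rfl | rfl⟩ := n.eq_nat_or_neg
    · cases k with
      | zero =>
        have e1 := parityExt_neg p 1
        have e2 := parityExt_natCast p 1
        push_cast at e1 e2
        simp only [Nat.cast_zero, zero_sub, zero_add, e1, e2, parityExt_zero, Int.natAbs_zero]
        linarith
      | succ k =>
        have e1 : ((k + 1 : ℕ) : ℤ) - 1 = (k : ℕ) := by push_cast; ring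
        have e2 : ((k + 1 : ℕ) : ℤ) + 1 = (k + 2 : ℕ) := by push_cast; ring
        rw [e1, e2, parityExt_natCast, parityExt_natCast, parityExt_natCast, parityExt_natCast,
          Int.natAbs_natCast, h1]
    · cases k with
      | zero =>
        have e1 := parityExt_neg p 1
        have e2 := parityExt_natCast p 1
        push_cast at e1 e2
        simp only [Nat.cast_zero, neg_zero, zero_sub, zero_add, e1, e2, parityExt_zero,
          Int.natAbs_zero]
        linarith
      | succ k =>
        have e1 : -((k + 1 : ℕ) : ℤ) - 1 = -((k + 2 : ℕ) : ℤ) := by push_cast; ring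
        have e2 : -((k + 1 : ℕ) : ℤ) + 1 = -(k : ℤ) := by push_cast; ring
        rw [e1, e2, parityExt_neg, parityExt_neg, parityExt_neg, parityExt_neg, Int.natAbs_neg,
          Int.natAbs_natCast, ← h1]
        ring
  simp only [diagSkew, skewShift, Complex.conj_ofReal]
  rw [← key]
  push_cast
  ring

lemma sqSum_pow_mul_geometric (j : ℕ) {q : ℝ} (h0 : 0 ≤ q) (h1 : q < 1) :
    SqSum fun n : ℕ => (((n : ℝ) ^ j * (-q) ^ n : ℝ) : ℂ) := by
  have := summable_pow_mul_geometric_of_norm_lt_one (R := ℝ) (2 * j) (r := q ^ 2) (by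
    rw [Real.norm_of_nonneg (by positivity)]; nlinarith)
  refine this.congr fun n => ?_
  rw [Complex.norm_real, Real.norm_eq_abs, sq_abs, mul_pow, ← pow_mul, ← pow_mul, ← pow_mul,
    mul_comm n 2, pow_mul (-q), neg_sq, mul_comm j 2, pow_mul q]

lemma sqSum_ite (n₀ : ℕ) (c : ℝ) : SqSum fun n : ℕ => ((if n = n₀ then c else 0 : ℝ) : ℂ) :=
  SqSum.of_finite ((Set.finite_singleton n₀).subset fun n hn => by
    by_contra h
    simp only [Set.mem_singleton_iff] at h
    simp [h] at hn)

/-! ## The radial mode problem -/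

/-- The diagonal of `-σ_x Δ_x - σ_θ ∂_θθ` on the modes with `|ℓ|² = N`. -/
def modeDiag (σx σθ N : ℝ) (n : ℤ) : ℝ := 4 * Real.pi ^ 2 * σx * N + σθ * (n : ℝ) ^ 2

/-- The symbol of `γ - σ_c Δ` at wave number `r`. -/
def ellRadial (γ σc r : ℝ) : ℝ := γ + 4 * Real.pi ^ 2 * σc * r ^ 2

/-- The angular Fourier coefficients of the source term, up to the phase. -/
def radialSource (γ σc τ r : ℝ) (n : ℕ) : ℝ :=
  (if n = 1 then Real.pi * r / ellRadial γ σc r else 0)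
    + if n = 2 then 2 * Real.pi ^ 2 * τ * r ^ 2 / ellRadial γ σc r else 0

/-- The angular Fourier coefficients of the mode `U^ℓ` with `|ℓ| = r`, up to the phase. -/
def radialSol (σx lam γ σc τ σθ r : ℝ) : ℤ → ℂ :=
  modeSol (modeDiag σx σθ (r ^ 2)) ((Real.pi * lam * r : ℝ) : ℂ)
    fun n => (parityExt (radialSource γ σc τ r) n : ℂ)

/-- The mass of the mode `U^ℓ` with `|ℓ| = r`, divided by `2π`. -/
def radialMass (σx lam γ σc τ σθ r : ℝ) : ℝ := (radialSol σx lam γ σc τ σθ r 0).re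

lemma ellRadial_pos {γ σc : ℝ} (hγ : 0 < γ) (hσc : 0 < σc) (r : ℝ) : 0 < ellRadial γ σc r := by
  unfold ellRadial; positivity

lemma le_modeDiag {σx σθ : ℝ} (hσθ : 0 ≤ σθ) (N : ℝ) (n : ℤ) :
    4 * Real.pi ^ 2 * σx * N ≤ modeDiag σx σθ N n := by
  unfold modeDiag; nlinarith [mul_nonneg hσθ (sq_nonneg (n : ℝ))]

lemma sqSum_radialSource (γ σc τ r : ℝ) :
    SqSum fun n => (parityExt (radialSource γ σc τ r) n : ℂ) := by
  refine sqSum_parityExt ?_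
  simp only [radialSource, Complex.ofReal_add]
  exact (sqSum_ite 1 _).add (sqSum_ite 2 _)

section radial
variable {σx lam γ σc τ σθ r : ℝ}

lemma radialSol_spec (hσx : 0 < σx) (hσθ : 0 ≤ σθ) (hr : 0 < r) :
    SqSum (radialSol σx lam γ σc τ σθ r) ∧ ∀ n,
      diagSkew (modeDiag σx σθ (r ^ 2)) ((Real.pi * lam * r : ℝ) : ℂ)
        (radialSol σx lam γ σc τ σθ r) n = (parityExt (radialSource γ σc τ r) n : ℂ) :=
  modeSol_spec (d := 4 * Real.pi ^ 2 * σx * r ^ 2) (by positivity)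
    (fun n => le_modeDiag hσθ _ n) _ (sqSum_radialSource γ σc τ r)

/-- The data are real, so the conjugate solves the same problem, and the solution is unique. -/
lemma conj_radialSol (hσx : 0 < σx) (hσθ : 0 ≤ σθ) (hr : 0 < r) (n : ℤ) :
    conj (radialSol σx lam γ σc τ σθ r n) = radialSol σx lam γ σc τ σθ r n := by
  obtain ⟨h1, h2⟩ := radialSol_spec (σx := σx) (lam := lam) (γ := γ) (σc := σc) (τ := τ)
    (σθ := σθ) (r := r) hσx hσθ hr
  have h3 : SqSum fun n => conj (radialSol σx lam γ σc τ σθ r n) := by simpa [SqSum] using h1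
  refine congrFun (diagSkew_injective (d := 4 * Real.pi ^ 2 * σx * r ^ 2) (by positivity)
    (fun n => le_modeDiag hσθ _ n) ((Real.pi * lam * r : ℝ) : ℂ) h3 h1 fun n => ?_) n
  rw [h2, ← Complex.conj_ofReal (parityExt _ n), ← h2]
  simp only [diagSkew, skewShift, map_add, map_sub, map_mul, Complex.conj_ofReal]

lemma radialSol_zero (hσx : 0 < σx) (hσθ : 0 ≤ σθ) (hr : 0 < r) :
    radialSol σx lam γ σc τ σθ r 0 = radialMass σx lam γ σc τ σθ r :=
  (Complex.conj_eq_iff_re.mp (conj_radialSol hσx hσθ hr 0)).symm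

/-- An a posteriori estimate: the residual of an approximate solution bounds its error by
coercivity. The coercivity constant does not involve σ_θ, so the bound survives the singular limit
σ_θ → 0. -/
lemma abs_radialMass_sub_le (hσx : 0 < σx) (hσθ : 0 ≤ σθ) (hr : 0 < r) {x : ℤ → ℝ}
    (hx : SqSum fun n => (x n : ℂ)) {ε : ℤ → ℝ} (hε : SqSum fun n => (ε n : ℂ))
    (h : ∀ n, diagSkew (modeDiag σx σθ (r ^ 2)) ((Real.pi * lam * r : ℝ) : ℂ)
      (fun n => (x n : ℂ)) n = (parityExt (radialSource γ σc τ r) n : ℂ) + ε n) :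
    4 * Real.pi ^ 2 * σx * r ^ 2 * |radialMass σx lam γ σc τ σθ r - x 0|
      ≤ √(∑' n, ε n ^ 2) := by
  obtain ⟨h1, h2⟩ := radialSol_spec (σx := σx) (lam := lam) (γ := γ) (σc := σc) (τ := τ)
    (σθ := σθ) (r := r) hσx hσθ hr
  have h3 := h1.add (hx.const_mul (-1))
  have h4 : ∀ n, diagSkew (modeDiag σx σθ (r ^ 2)) ((Real.pi * lam * r : ℝ) : ℂ)
      (fun n => radialSol σx lam γ σc τ σθ r n + -1 * (x n : ℂ)) n = -(ε n : ℂ) := fun n => by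
    rw [diagSkew_add, diagSkew_const_mul, h2, h]; ring
  have h5 : SqSum (diagSkew (modeDiag σx σθ (r ^ 2)) ((Real.pi * lam * r : ℝ) : ℂ)
      (fun n => radialSol σx lam γ σc τ σθ r n + -1 * (x n : ℂ))) := by
    simp only [SqSum, h4]
    exact hε.neg
  have h6 := diagSkew_energy (d := 4 * Real.pi ^ 2 * σx * r ^ 2) (by positivity)
    (fun n => le_modeDiag hσθ _ n) _ h3 h5
  have h7 := h3.norm_sq_le 0
  simp only [h4, norm_neg, Complex.norm_real, Real.norm_eq_abs, sq_abs] at h6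
  rw [radialSol_zero hσx hσθ hr, neg_one_mul, ← sub_eq_add_neg, ← Complex.ofReal_sub,
    Complex.norm_real, Real.norm_eq_abs] at h7
  refine Real.le_sqrt_of_sq_le ?_
  rw [mul_pow]
  exact (mul_le_mul_of_nonneg_left h7 (by positivity)).trans h6

/-- The mass decays as `r → ∞`, uniformly in `σ_θ`. -/
lemma abs_radialMass_le (hσx : 0 < σx) (hγ : 0 < γ) (hσc : 0 < σc) (hτ : 0 ≤ τ) :
    ∃ C, ∀ σθ r, 0 ≤ σθ → 1 ≤ r → |radialMass σx lam γ σc τ σθ r| ≤ C / r ^ 2 := by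
  have hπ := Real.pi_pos
  set A : ℝ := Real.pi / (4 * Real.pi ^ 2 * σc) with hA
  set B : ℝ := 2 * Real.pi ^ 2 * τ / (4 * Real.pi ^ 2 * σc) with hB
  refine ⟨√(2 * A ^ 2 + 2 * B ^ 2) / (4 * Real.pi ^ 2 * σx), fun σθ r hσθ hr => ?_⟩
  have hr0 : 0 < r := by linarith
  -- Zero serves as approximate solution, with residual minus the source. The four nonzero source
  -- coefficients stay bounded for r ≥ 1 because the denominator is at least 4π²σ_c r²; the gain r²
  -- is the coercivity constant.
  have h := abs_radialMass_sub_le (σx := σx) (lam := lam) (γ := γ) (σc := σc) (τ := τ)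
    (σθ := σθ) (r := r) hσx hσθ hr0 (x := fun _ => 0) (by simp [SqSum, summable_zero])
    (ε := fun n => -parityExt (radialSource γ σc τ r) n)
    (by simpa using (sqSum_radialSource γ σc τ r).neg) (fun n => by simp [diagSkew, skewShift])
  rw [sub_zero] at h
  have hE := ellRadial_pos hγ hσc r
  have hEr : 4 * Real.pi ^ 2 * σc * r ^ 2 ≤ ellRadial γ σc r := by unfold ellRadial; linarith
  have hsum : ∑' n, (-parityExt (radialSource γ σc τ r) n) ^ 2 ≤ 2 * A ^ 2 + 2 * B ^ 2 := by
    have e1 : parityExt (radialSource γ σc τ r) 1 = radialSource γ σc τ r 1 :=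
      parityExt_natCast _ 1
    have e2 : parityExt (radialSource γ σc τ r) 2 = radialSource γ σc τ r 2 :=
      parityExt_natCast _ 2
    have e3 : parityExt (radialSource γ σc τ r) (-1) = -radialSource γ σc τ r 1 := by
      simpa using parityExt_neg (radialSource γ σc τ r) 1
    have e4 : parityExt (radialSource γ σc τ r) (-2) = radialSource γ σc τ r 2 := by
      simpa using parityExt_neg (radialSource γ σc τ r) 2
    have hz : ∀ k : ℕ, k ≠ 1 → k ≠ 2 → radialSource γ σc τ r k = 0 := fun k h1 h2 => by
      simp [radialSource, h1, h2]
    rw [tsum_eq_sum (s := {1, -1, 2, -2})]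
    · have n1 : radialSource γ σc τ r 1 = Real.pi * r / ellRadial γ σc r := by simp [radialSource]
      have n2 : radialSource γ σc τ r 2 = 2 * Real.pi ^ 2 * τ * r ^ 2 / ellRadial γ σc r := by
        simp [radialSource]
      have b1 : radialSource γ σc τ r 1 ≤ A := by
        rw [n1, hA, div_le_div_iff₀ hE (by positivity)]
        calc Real.pi * r * (4 * Real.pi ^ 2 * σc) ≤ Real.pi * (4 * Real.pi ^ 2 * σc * r ^ 2) := by
              rw [mul_assoc, mul_comm r]
              gcongr
              nlinarith
          _ ≤ _ := by gcongr
      have b2 : radialSource γ σc τ r 2 ≤ B := by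
        rw [n2, hB, div_le_div_iff₀ hE (by positivity), mul_assoc (_ * τ), mul_comm (r ^ 2)]
        gcongr
      have b3 : 0 ≤ radialSource γ σc τ r 1 := by rw [n1]; positivity
      have b4 : 0 ≤ radialSource γ σc τ r 2 := by rw [n2]; positivity
      rw [Finset.sum_insert (by decide), Finset.sum_insert (by decide),
        Finset.sum_insert (by decide), Finset.sum_singleton, e1, e2, e3, e4]
      have b5 := pow_le_pow_left₀ b3 b1 2
      have b6 := pow_le_pow_left₀ b4 b2 2
      linarith
    · intro n hn
      obtain ⟨k, rfl | rfl⟩ := n.eq_nat_or_neg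
      · rw [parityExt_natCast, hz]
        · simp
        · rintro rfl; simp at hn
        · rintro rfl; simp at hn
      · rw [parityExt_neg, hz]
        · simp
        · rintro rfl; simp at hn
        · rintro rfl; simp at hn
  rw [div_div, le_div_iff₀ (by positivity), mul_comm]
  exact h.trans (Real.sqrt_le_sqrt hsum)

end radial
end AntModel
end

noncomputable section
namespace AntModel
open MeasureTheory Submodule Matrix
open scoped ComplexConjugate

/-! ## Expansion of the radial mass for small angular diffusion -/

/-- The coefficient of the geometric part of `leadSeq`. -/
def leadCoef (a κ e : ℝ) : ℝ := (-a + κ * a * (2 * a ^ 2 + 1)) / (a + e)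

/-- The solution of the normalised mode problem without angular diffusion. -/
def leadSeq (a κ e : ℝ) (n : ℕ) : ℝ :=
  leadCoef a κ e * (-e) ^ n + (if n = 0 then 1 - 2 * κ * a ^ 2 else 0)
    + if n = 1 then κ * a else 0

/-- The first order corrector of the normalised mode problem. -/
def corrSeq (a κ e : ℝ) (n : ℕ) : ℝ :=
  -leadCoef a κ e * ((1 / (3 * (a + e)) * (n : ℝ) ^ 3 + a / (2 * (a + e) ^ 2) * (n : ℝ) ^ 2
      + (a ^ 2 / (2 * (a + e) ^ 3) - 1 / (3 * (a + e))) * n - a / (2 * (a + e) ^ 4)) * (-e) ^ n)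
    + 2 * κ * a ^ 2 / (a + e) * (-e) ^ n + if n = 0 then -2 * κ * a else 0

section seqs
variable {a κ e : ℝ}

/-- The boundary equation at n = 0, divided by 2μ. It determines `leadCoef`, the free multiple of
the homogeneous solution. -/
lemma leadSeq_zero_eq (he : 0 < e) (ha : a = (1 - e ^ 2) / (2 * e)) :
    a * leadSeq a κ e 0 - leadSeq a κ e 1 = 0 := by
  have h1 : (1 - e ^ 2) / (2 * e) + e = (1 + e ^ 2) / (2 * e) := by field_simp; ring
  subst ha
  simp only [leadSeq, leadCoef, pow_zero, pow_one, h1]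
  norm_num
  field_simp
  ring

/-- -e is a root of the characteristic equation a q + (1 - q²)/2 = 0, so the geometric part is
homogeneous. The extra value κ a at n = 1 produces the source at 2, and the extra value 1 - 2κa² at
n = 0 corrects the equation at 1. -/
lemma leadSeq_succ_eq (he : 0 < e) (ha : a = (1 - e ^ 2) / (2 * e)) (k : ℕ) :
    a * leadSeq a κ e (k + 1) + (leadSeq a κ e k - leadSeq a κ e (k + 2)) / 2
      = (if k + 1 = 1 then 1 / 2 else 0) + if k + 1 = 2 then κ * a / 2 else 0 := by
  have h : a * (-e) + (1 - (-e) ^ 2) / 2 = 0 := by subst ha; field_simp; ring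
  have hp : a * (-e) ^ (k + 1) + ((-e) ^ k - (-e) ^ (k + 2)) / 2 = 0 := by
    linear_combination (-e) ^ k * h
  match k with
  | 0 => simp [leadSeq]; norm_num at hp; linear_combination leadCoef a κ e * hp
  | 1 => simp [leadSeq]; norm_num at hp; linear_combination leadCoef a κ e * hp
  | k + 2 => simp [leadSeq]; linear_combination leadCoef a κ e * hp

/-- The constant term of the cubic and the coefficient 2κa²/(a + e) multiply homogeneous solutions;
they are chosen to make this boundary equation hold. -/
lemma corrSeq_zero_eq (he : 0 < e) (ha : a = (1 - e ^ 2) / (2 * e)) :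
    a * corrSeq a κ e 0 - corrSeq a κ e 1 = 0 := by
  have h1 : (1 - e ^ 2) / (2 * e) + e = (1 + e ^ 2) / (2 * e) := by field_simp; ring
  subst ha
  simp only [corrSeq, leadCoef, pow_zero, pow_one, h1]
  norm_num
  field_simp
  ring

/-- The forcing n² times a homogeneous solution is resonant, so it needs a cubic polynomial times
that solution, found by undetermined coefficients. The isolated value κ a of `leadSeq` at n = 1 is
matched by the value -2κa at n = 0. -/
lemma corrSeq_succ_eq (he : 0 < e) (ha : a = (1 - e ^ 2) / (2 * e)) (k : ℕ) :
    a * corrSeq a κ e (k + 1) + (corrSeq a κ e k - corrSeq a κ e (k + 2)) / 2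
      = -((k + 1 : ℝ) ^ 2 * leadSeq a κ e (k + 1)) := by
  have h : a * (-e) + (1 - (-e) ^ 2) / 2 = 0 := by subst ha; field_simp; ring
  have hg : a * (-e) ^ (k + 1) + ((-e) ^ k - (-e) ^ (k + 2)) / 2 = 0 := by
    linear_combination (-e) ^ k * h
  set c : ℝ → ℝ := fun n => 1 / (3 * (a + e)) * n ^ 3 + a / (2 * (a + e) ^ 2) * n ^ 2
      + (a ^ 2 / (2 * (a + e) ^ 3) - 1 / (3 * (a + e))) * n - a / (2 * (a + e) ^ 4) with hc
  have hcub : a * (c (k + 1) * (-e) ^ (k + 1)) + (c k * (-e) ^ k - c (k + 2) * (-e) ^ (k + 2)) / 2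
      = (k + 1 : ℝ) ^ 2 * (-e) ^ (k + 1) := by
    have h1 : (1 - e ^ 2) / (2 * e) + e = (1 + e ^ 2) / (2 * e) := by field_simp; ring
    have : a * (c (k + 1) * (-e)) + (c k - c (k + 2) * (-e) ^ 2) / 2 = (k + 1 : ℝ) ^ 2 * (-e) := by
      subst ha
      simp only [hc, h1]
      field_simp
      ring
    linear_combination (-e) ^ k * this
  match k with
  | 0 =>
    simp only [corrSeq, leadSeq]
    simp only [hc] at hcub
    norm_num at hcub hg ⊢
    linear_combination (-leadCoef a κ e) * hcub + 2 * κ * a ^ 2 / (a + e) * hg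
  | k + 1 =>
    simp only [corrSeq, leadSeq]
    simp only [hc] at hcub
    push_cast at hcub hg ⊢
    simp only [add_zero]
    linear_combination (-leadCoef a κ e) * hcub + 2 * κ * a ^ 2 / (a + e) * hg

lemma sqSum_leadSeq (he : 0 < e) (he1 : e < 1) : SqSum fun n => (leadSeq a κ e n : ℂ) := by
  have h := sqSum_pow_mul_geometric 0 he.le he1
  have := ((h.const_mul (leadCoef a κ e)).add (sqSum_ite 0 (1 - 2 * κ * a ^ 2))).add
    (sqSum_ite 1 (κ * a))
  simpa [leadSeq] using this

lemma sqSum_pow_mul_corrSeq (j : ℕ) (he : 0 < e) (he1 : e < 1) :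
    SqSum fun n : ℕ => (((n : ℝ) ^ j * corrSeq a κ e n : ℝ) : ℂ) := by
  have h := fun i => sqSum_pow_mul_geometric i he.le he1
  have h1 := ((((h (j + 3)).const_mul (-leadCoef a κ e * (1 / (3 * (a + e))) : ℝ)).add
    ((h (j + 2)).const_mul (-leadCoef a κ e * (a / (2 * (a + e) ^ 2)) : ℝ))).add
    ((h (j + 1)).const_mul (-leadCoef a κ e *
      (a ^ 2 / (2 * (a + e) ^ 3) - 1 / (3 * (a + e))) : ℝ))).add
    ((h j).const_mul (leadCoef a κ e * (a / (2 * (a + e) ^ 4)) + 2 * κ * a ^ 2 / (a + e) : ℝ))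
  have h2 := h1.add (sqSum_ite 0 ((0 : ℝ) ^ j * (-2 * κ * a)))
  refine h2.of_le 1 fun n => le_of_eq ?_
  rw [one_mul]
  congr 1
  simp only [← Complex.ofReal_mul, ← Complex.ofReal_add]
  congr 1
  rcases Nat.eq_zero_or_pos n with rfl | hn
  · simp only [corrSeq, if_true, Nat.cast_zero]
    ring
  · simp only [corrSeq, hn.ne', if_false, add_zero]
    ring

end seqs

/-- The ratio `2π σ_x r / λ`. -/
def damping (σx lam r : ℝ) : ℝ := 2 * Real.pi * σx * r / lam

/-- The decay rate of the geometric part: the positive root of `e² + 2 a e = 1`. -/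
def decay (a : ℝ) : ℝ := √(a ^ 2 + 1) - a

lemma decay_spec {a : ℝ} (ha : 0 < a) :
    0 < decay a ∧ decay a < 1 ∧ a = (1 - decay a ^ 2) / (2 * decay a) := by
  have h1 := Real.sq_sqrt (show 0 ≤ a ^ 2 + 1 by positivity)
  have h2 : a < √(a ^ 2 + 1) := Real.lt_sqrt_of_sq_lt (by linarith)
  have h3 : √(a ^ 2 + 1) < a + 1 := by
    rw [Real.sqrt_lt' (by linarith)]; nlinarith
  have h0 : 0 < decay a := by unfold decay; linarith
  refine ⟨h0, by unfold decay; linarith, ?_⟩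
  rw [eq_div_iff (by positivity)]
  unfold decay
  nlinarith

/-- The limit of the radial mass as `σ_θ → 0`. -/
def massLead (σx lam γ σc τ r : ℝ) : ℝ :=
  leadSeq (damping σx lam r) (lam * τ / σx) (decay (damping σx lam r)) 0
    / (lam * ellRadial γ σc r)

/-- The first order coefficient of the radial mass as `σ_θ → 0`. -/
def massCorr (σx lam γ σc τ r : ℝ) : ℝ :=
  corrSeq (damping σx lam r) (lam * τ / σx) (decay (damping σx lam r)) 0
    / (2 * Real.pi * lam * r) / (lam * ellRadial γ σc r)

/-- With the leading term and the corrector inserted, the only residual is σ_θ n² acting on the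
corrector, which is of order σ_θ². It is square summable because the geometric decay absorbs n² and
the cubic, and the a posteriori estimate concludes. -/
lemma abs_radialMass_sub_expansion_le {σx lam γ σc τ r : ℝ} (hσx : 0 < σx) (hlam : 0 < lam)
    (hγ : 0 < γ) (hσc : 0 < σc) (hr : 0 < r) :
    ∃ C, ∀ σθ, 0 ≤ σθ → |radialMass σx lam γ σc τ σθ r
      - (massLead σx lam γ σc τ r + σθ * massCorr σx lam γ σc τ r)| ≤ C * σθ ^ 2 := by
  have hπ := Real.pi_pos
  have hE := ellRadial_pos hγ hσc r
  set E := ellRadial γ σc r with hEdef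
  set a := damping σx lam r with hadef
  have ha0 : 0 < a := by rw [hadef, damping]; positivity
  obtain ⟨he0, he1, hae⟩ := decay_spec ha0
  set e := decay a with hedef
  set κ := lam * τ / σx with hκ
  set p := leadSeq a κ e with hp
  set q := corrSeq a κ e with hq
  set μ := Real.pi * lam * r with hμ
  have hμ0 : 0 < μ := by rw [hμ]; positivity
  set R : ℕ → ℝ := fun n => (n : ℝ) ^ 2 * q n with hR
  have hRs : SqSum fun n => (parityExt R n : ℂ) :=
    sqSum_parityExt (sqSum_pow_mul_corrSeq 2 he0 he1)
  set K := √(∑' n, parityExt R n ^ 2) with hK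
  refine ⟨1 / (2 * μ * lam * E) * K / (4 * Real.pi ^ 2 * σx * r ^ 2), fun σθ hσθ => ?_⟩
  -- The diagonal is 2μ(a + s n²), so s is the small parameter of the equation divided by 2μ; the
  -- factor 1/(λE) in `x` restores the size of the source.
  set s := σθ / (2 * μ) with hs
  set x : ℕ → ℝ := fun n => (p n + s * q n) / (lam * E) with hx
  set b : ℕ → ℝ := fun n => radialSource γ σc τ r n + σθ ^ 2 / (2 * μ * lam * E) * R n with hb
  have hd : 4 * Real.pi ^ 2 * σx * r ^ 2 = 2 * μ * a := by
    rw [hμ, hadef, damping]; field_simp; ring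
  have hsμ : σθ = 2 * μ * s := by rw [hs]; field_simp
  have hκa : κ * a = 2 * Real.pi * τ * r := by
    rw [hκ, hadef, damping]; field_simp
  have hxs : SqSum fun n => (parityExt x n : ℂ) := by
    refine sqSum_parityExt ?_
    have h2 : SqSum fun n => (q n : ℂ) := by simpa using sqSum_pow_mul_corrSeq 0 he0 he1
    have h3 := ((sqSum_leadSeq (a := a) (κ := κ) he0 he1).add (h2.const_mul s)).const_mul
      (lam * E : ℂ)⁻¹
    refine h3.of_le 1 fun n => le_of_eq ?_
    rw [one_mul]; congr 1
    simp only [hx]; push_cast; ring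
  have hbn : ∀ n, (parityExt b n : ℂ) = (parityExt (radialSource γ σc τ r) n : ℂ)
      + ((σθ ^ 2 / (2 * μ * lam * E) * parityExt R n : ℝ) : ℂ) := by
    intro n
    norm_cast
    cases n <;> simp only [parityExt, hb]
    ring
  have key : ∀ n, diagSkew (modeDiag σx σθ (r ^ 2)) (μ : ℂ) (fun n => (parityExt x n : ℂ)) n
      = (parityExt b n : ℂ) := by
    have hD : modeDiag σx σθ (r ^ 2)
        = fun n : ℤ => (fun k : ℕ => 2 * μ * a + σθ * (k : ℝ) ^ 2) n.natAbs := by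
      funext n
      simp only [modeDiag, hd]
      congr 2
      rw [Nat.cast_natAbs, Int.cast_abs, sq_abs]
    rw [hD]
    refine fun n => diagSkew_parityExt (D := fun k : ℕ => 2 * μ * a + σθ * (k : ℝ) ^ 2) ?_
      (fun k => ?_) n
    · have e1 := leadSeq_zero_eq (κ := κ) he0 hae
      have e2 := corrSeq_zero_eq (κ := κ) he0 hae
      rw [← hp] at e1
      rw [← hq] at e2
      simp only [hx, hb, hR, radialSource]
      norm_num
      field_simp
      linear_combination 2 * μ * (e1 + s * e2)
    · have e1 := leadSeq_succ_eq (κ := κ) he0 hae k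
      have e2 := corrSeq_succ_eq (κ := κ) he0 hae k
      rw [← hp] at e1 e2
      rw [← hq] at e2
      have hsrc : radialSource γ σc τ r (k + 1) = 2 * μ / (lam * E) *
          ((if k + 1 = 1 then 1 / 2 else 0) + if k + 1 = 2 then κ * a / 2 else 0) := by
        rw [radialSource, hκa, mul_add, mul_ite, mul_ite, mul_zero, ← hEdef, hμ]
        congr 2 <;> field_simp
      simp only [hb, hsrc, ← e1, hx, hR]
      rw [hsμ]
      push_cast
      field_simp
      linear_combination (2 * s) * e2
  have hfin := abs_radialMass_sub_le hσx hσθ hr hxs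
    (ε := fun n => σθ ^ 2 / (2 * μ * lam * E) * parityExt R n)
    (by push_cast; exact hRs.const_mul _) (fun n => by rw [key, hbn])
  have hx0 : parityExt x 0 = massLead σx lam γ σc τ r + σθ * massCorr σx lam γ σc τ r := by
    rw [parityExt_zero]
    simp only [hx, massLead, massCorr, ← hEdef, ← hadef, ← hκ, ← hedef, ← hp, ← hq, hs, hμ]
    ring
  have hsqrt : √(∑' n, (σθ ^ 2 / (2 * μ * lam * E) * parityExt R n) ^ 2)
      = σθ ^ 2 / (2 * μ * lam * E) * K := by
    simp_rw [mul_pow (σθ ^ 2 / (2 * μ * lam * E))]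
    rw [tsum_mul_left, Real.sqrt_mul (by positivity), Real.sqrt_sq (by positivity)]
  rw [hx0, hsqrt] at hfin
  rw [mul_comm (_ / _) (σθ ^ 2), ← mul_div_assoc, le_div_iff₀ (by positivity), mul_comm]
  exact hfin.trans (le_of_eq (by ring))

end AntModel
end

noncomputable section
namespace AntModel
open MeasureTheory Submodule Matrix Filter Topology
open scoped ComplexConjugate

/-! ## Different wave numbers have different masses for small angular diffusion -/

/-- The leading term of the expansion of the mass, in the variable `x = a / √(a² + 1)`. -/
def leadFun (κ x : ℝ) : ℝ := (1 - x) * (1 + κ * x / (1 + x))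

/-- The first order term of the expansion of the mass, in the variable `x = a / √(a² + 1)`. -/
def corrFun (κ x : ℝ) : ℝ :=
  (1 - x) * (x * (1 - x) * (1 + x) ^ 2 / 2 + κ * (2 - x * (1 + x) * (1 + x ^ 2) / 2))

/-- The difference has the sign of (κ - 1) - (1 + κ)(x + y + xy), which can be positive only for κ >
1. -/
lemma leadFun_lt_imp {κ x y : ℝ} (hκ : 0 ≤ κ) (hx : 0 < x) (hxy : x < y) (h : leadFun κ x < leadFun κ y) :
    1 < κ := by
  have hy : 0 < y := hx.trans hxy
  have e : leadFun κ y - leadFun κ x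
      = (y - x) * ((κ - 1) - (1 + κ) * (x + y + x * y)) / ((1 + x) * (1 + y)) := by
    unfold leadFun; field_simp; ring
  have h1 : 0 < (y - x) * ((κ - 1) - (1 + κ) * (x + y + x * y)) / ((1 + x) * (1 + y)) := by
    rw [← e]; linarith
  have h2 : 0 < (y - x) * ((κ - 1) - (1 + κ) * (x + y + x * y)) := by
    by_contra hc
    push Not at hc
    exact absurd h1 (not_lt.mpr (div_nonpos_of_nonpos_of_nonneg hc (by positivity)))
  have h3 : 0 < (κ - 1) - (1 + κ) * (x + y + x * y) := (mul_pos_iff_of_pos_left (by linarith)).mp h2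
  have h4 : 0 < x + y + x * y := by positivity
  by_contra hc
  push Not at hc
  nlinarith [mul_nonneg hκ h4.le]

/-- In other words, `corrFun`/`leadFun` is strictly decreasing on (0,1). With κ = 1 + j, the cross
difference is a positive factor times a quadratic polynomial in j whose three coefficients are
positive. -/
lemma corrFun_mul_leadFun_lt {κ x y : ℝ} (hκ : 1 < κ) (hx : 0 < x) (hxy : x < y) (hy : y < 1) :
    corrFun κ y * leadFun κ x < corrFun κ x * leadFun κ y := by
  have hy0 : 0 < y := hx.trans hxy
  obtain ⟨j, hj, rfl⟩ : ∃ j, 0 < j ∧ κ = 1 + j := ⟨κ - 1, by linarith, by ring⟩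
  set h := (x ^ 2 + x * y + y ^ 2) + 2 * (x ^ 3 + x ^ 2 * y + x * y ^ 2 + y ^ 3)
    + (x ^ 4 + x ^ 3 * y + x ^ 2 * y ^ 2 + x * y ^ 3 + y ^ 4) with hh
  set q := (x + y) + (x ^ 2 + x * y + y ^ 2) + (x ^ 3 + x ^ 2 * y + x * y ^ 2 + y ^ 3)
    + (x ^ 4 + x ^ 3 * y + x ^ 2 * y ^ 2 + x * y ^ 3 + y ^ 4) / 2 with hq
  have e : corrFun (1 + j) x * leadFun (1 + j) y - corrFun (1 + j) y * leadFun (1 + j) x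
      = (1 - x) * (1 - y) * (y - x) / ((1 + x) * (1 + y))
        * ((2 - 2 * x ^ 3 - 4 * x ^ 4 - 2 * x ^ 5 + h * (1 + 2 * x))
          + j * (9 / 2 - 2 * x ^ 2 - 3 * x ^ 3 - 4 * x ^ 4 - 2 * x ^ 5 + h * x + q * (1 + 2 * x))
          + j ^ 2 * (2 - x ^ 2 - x ^ 3 - x ^ 4 - x ^ 5 / 2 + q * x)) := by
    rw [hh, hq]
    unfold corrFun leadFun
    field_simp
    ring
  -- As x < y, each monomial of `h` and `q` is at least the corresponding power of x. This gives
  -- lower bounds in x alone, after which positivity follows from the ordering of the powers of x on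
  -- (0,1).
  have hmon : ∀ i l : ℕ, x ^ (i + l) ≤ x ^ i * y ^ l := fun i l => by
    rw [pow_add]; gcongr
  have h20 := hmon 1 1
  have h02 := hmon 0 2
  have h21 := hmon 2 1
  have h12 := hmon 1 2
  have h03 := hmon 0 3
  have h31 := hmon 3 1
  have h22 := hmon 2 2
  have h13 := hmon 1 3
  have h04 := hmon 0 4
  norm_num at h20 h02 h21 h12 h03 h31 h22 h13 h04
  have hhl : 3 * x ^ 2 + 8 * x ^ 3 + 5 * x ^ 4 ≤ h := by rw [hh]; linarith
  have hql : 2 * x + 3 * x ^ 2 + 4 * x ^ 3 + 5 / 2 * x ^ 4 ≤ q := by rw [hq]; linarith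
  have hx1 : x < 1 := hxy.trans hy
  have p1 : 0 < x ^ 2 := by positivity
  have p2 : x ^ 3 < x ^ 2 := pow_lt_pow_right_of_lt_one₀ hx hx1 (by norm_num)
  have p3 : x ^ 4 < x ^ 3 := pow_lt_pow_right_of_lt_one₀ hx hx1 (by norm_num)
  have p4 : x ^ 5 < x ^ 4 := pow_lt_pow_right_of_lt_one₀ hx hx1 (by norm_num)
  have p5 : 0 < x ^ 5 := by positivity
  have hh0 : 0 ≤ h := by linarith
  have hq0 : 0 ≤ q := by linarith
  have hhx : 0 ≤ h * x := mul_nonneg hh0 hx.le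
  have hqx : 2 * x ^ 2 + 3 * x ^ 3 + 4 * x ^ 4 + 5 / 2 * x ^ 5 ≤ q * x :=
    le_trans (le_of_eq (by ring)) (mul_le_mul_of_nonneg_right hql hx.le)
  clear_value h q
  have t0 : 0 < 2 - 2 * x ^ 3 - 4 * x ^ 4 - 2 * x ^ 5 + h * (1 + 2 * x) := by linarith
  have t1 : 0 < 9 / 2 - 2 * x ^ 2 - 3 * x ^ 3 - 4 * x ^ 4 - 2 * x ^ 5 + h * x + q * (1 + 2 * x) := by
    linarith
  have t2 : 0 < 2 - x ^ 2 - x ^ 3 - x ^ 4 - x ^ 5 / 2 + q * x := by linarith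
  have hfac : 0 < (1 - x) * (1 - y) * (y - x) / ((1 + x) * (1 + y)) := by
    have := sub_pos.mpr hx1
    have := sub_pos.mpr hy
    have := sub_pos.mpr hxy
    positivity
  have := mul_pos hfac (add_pos (add_pos t0 (mul_pos hj t1)) (mul_pos (pow_pos hj 2) t2))
  rw [← e] at this
  linarith

/-- The variable `a / √(a² + 1)`, in terms of `a` and `e = √(a² + 1) - a`. -/
lemma leadSeq_zero_eq_leadFun {a κ e : ℝ} (he : 0 < e) (ha : a = (1 - e ^ 2) / (2 * e)) :
    leadSeq a κ e 0 = leadFun κ (a / (a + e)) := by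
  have h1 : (1 - e ^ 2) / (2 * e) + e = (1 + e ^ 2) / (2 * e) := by field_simp; ring
  have h2 : (1 - e ^ 2) / (2 * e) / ((1 + e ^ 2) / (2 * e)) = (1 - e ^ 2) / (1 + e ^ 2) := by
    field_simp
  have h3 : 1 + (1 - e ^ 2) / (1 + e ^ 2) = 2 / (1 + e ^ 2) := by field_simp; ring
  subst ha
  simp only [leadSeq, leadCoef, leadFun, h1, h2, h3]
  norm_num
  field_simp
  ring

lemma corrSeq_zero_eq_corrFun {a κ e : ℝ} (he : 0 < e) (ha : a = (1 - e ^ 2) / (2 * e)) :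
    corrSeq a κ e 0 = -a * corrFun κ (a / (a + e)) := by
  have h1 : (1 - e ^ 2) / (2 * e) + e = (1 + e ^ 2) / (2 * e) := by field_simp; ring
  have h2 : (1 - e ^ 2) / (2 * e) / ((1 + e ^ 2) / (2 * e)) = (1 - e ^ 2) / (1 + e ^ 2) := by
    field_simp
  subst ha
  simp only [corrSeq, leadCoef, corrFun, h1, h2]
  norm_num
  field_simp
  ring

/-- The variable `a / √(a² + 1)` at wave number `r`. -/
def dampVar (σx lam r : ℝ) : ℝ :=
  damping σx lam r / (damping σx lam r + decay (damping σx lam r))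

/-! ### Comparison of the masses at two wave numbers -/

section
variable {σx lam γ σc τ r r' : ℝ}

lemma damping_pos (hσx : 0 < σx) (hlam : 0 < lam) (hr : 0 < r) : 0 < damping σx lam r := by
  have := Real.pi_pos
  unfold damping; positivity

lemma dampVar_mem (hσx : 0 < σx) (hlam : 0 < lam) (hr : 0 < r) :
    0 < dampVar σx lam r ∧ dampVar σx lam r < 1 := by
  have ha := damping_pos hσx hlam hr
  obtain ⟨h1, -, -⟩ := decay_spec ha
  unfold dampVar
  exact ⟨by positivity, by rw [div_lt_one (by positivity)]; linarith⟩

lemma dampVar_strictMono (hσx : 0 < σx) (hlam : 0 < lam) (hr : 0 < r) (h : r < r') :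
    dampVar σx lam r < dampVar σx lam r' := by
  have hπ := Real.pi_pos
  have ha := damping_pos hσx hlam hr
  have ha' := damping_pos hσx hlam (hr.trans h)
  have hlt : damping σx lam r < damping σx lam r' := by unfold damping; gcongr
  have e : ∀ a, a + decay a = √(a ^ 2 + 1) := fun a => by unfold decay; ring
  simp only [dampVar, e]
  set a := damping σx lam r
  set b := damping σx lam r'
  rw [div_lt_div_iff₀ (by positivity) (by positivity)]
  refine lt_of_pow_lt_pow_left₀ 2 (by positivity) ?_
  rw [mul_pow, mul_pow, Real.sq_sqrt (by positivity), Real.sq_sqrt (by positivity)]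
  nlinarith

lemma massLead_eq (hσx : 0 < σx) (hlam : 0 < lam) (hr : 0 < r) :
    massLead σx lam γ σc τ r
      = leadFun (lam * τ / σx) (dampVar σx lam r) / (lam * ellRadial γ σc r) := by
  obtain ⟨h1, -, h2⟩ := decay_spec (damping_pos hσx hlam hr)
  rw [massLead, leadSeq_zero_eq_leadFun h1 h2, dampVar]

/-- The factor a/(2πλr) is σ_x/λ², in which r has cancelled. Hence the leading and first order terms
share the denominator λE, and comparing them reduces to `leadFun` and `corrFun`. -/
lemma massCorr_eq (hσx : 0 < σx) (hlam : 0 < lam) (hr : 0 < r) :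
    massCorr σx lam γ σc τ r
      = -(σx / lam ^ 2) * (corrFun (lam * τ / σx) (dampVar σx lam r)
        / (lam * ellRadial γ σc r)) := by
  obtain ⟨h1, -, h2⟩ := decay_spec (damping_pos hσx hlam hr)
  have hπ := Real.pi_pos
  rw [massCorr, corrSeq_zero_eq_corrFun h1 h2, dampVar]
  rw [show -damping σx lam r * corrFun (lam * τ / σx) (damping σx lam r /
      (damping σx lam r + decay (damping σx lam r))) / (2 * Real.pi * lam * r)
    = -(σx / lam ^ 2) * corrFun (lam * τ / σx) (damping σx lam r /
      (damping σx lam r + decay (damping σx lam r))) by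
      generalize corrFun _ _ = t
      unfold damping
      field_simp]
  ring

lemma massLead_pos (hσx : 0 < σx) (hlam : 0 < lam) (hγ : 0 < γ) (hσc : 0 < σc) (hτ : 0 ≤ τ)
    (hr : 0 < r) : 0 < massLead σx lam γ σc τ r := by
  rw [massLead_eq hσx hlam hr]
  obtain ⟨h1, h2⟩ := dampVar_mem hσx hlam hr
  have := ellRadial_pos hγ hσc r
  have := sub_pos.mpr h2
  unfold leadFun
  positivity

/-- If both coefficients agreed, `corrFun`/`leadFun` would take the same value at two points. But
equal leading terms force κ > 1, where that ratio is strictly monotone. -/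
lemma massCorr_ne_of_lt (hσx : 0 < σx) (hlam : 0 < lam) (hγ : 0 < γ) (hσc : 0 < σc) (hτ : 0 ≤ τ)
    (hr : 0 < r) (h : r < r') (he : massLead σx lam γ σc τ r = massLead σx lam γ σc τ r') :
    massCorr σx lam γ σc τ r ≠ massCorr σx lam γ σc τ r' := by
  intro hc
  have hr' := hr.trans h
  have hπ := Real.pi_pos
  have hE := ellRadial_pos hγ hσc r
  have hE' := ellRadial_pos hγ hσc r'
  have hEE : ellRadial γ σc r < ellRadial γ σc r' := by unfold ellRadial; gcongr
  obtain ⟨hx, -⟩ := dampVar_mem hσx hlam hr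
  obtain ⟨hx', hx1'⟩ := dampVar_mem hσx hlam hr'
  have hxx := dampVar_strictMono hσx hlam hr h
  have hpos := massLead_pos hσx hlam hγ hσc hτ hr'
  rw [massLead_eq hσx hlam hr'] at hpos
  rw [massLead_eq hσx hlam hr, massLead_eq hσx hlam hr',
    div_eq_div_iff (by positivity) (by positivity)] at he
  rw [massCorr_eq hσx hlam hr, massCorr_eq hσx hlam hr'] at hc
  have hc2 := mul_left_cancel₀ (neg_ne_zero.mpr (by positivity)) hc
  rw [div_eq_div_iff (by positivity) (by positivity)] at hc2
  set κ := lam * τ / σx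
  set x := dampVar σx lam r
  set y := dampVar σx lam r'
  set E := ellRadial γ σc r
  set E' := ellRadial γ σc r'
  have hpos' : 0 < leadFun κ y := by
    by_contra hcon
    push Not at hcon
    exact absurd hpos (not_lt.mpr (div_nonpos_of_nonpos_of_nonneg hcon (by positivity)))
  -- The denominator is larger at r', so equal quotients require a larger numerator there.
  have hlt : leadFun κ x < leadFun κ y := by
    have h1 : leadFun κ x * E' = leadFun κ y * E := by
      refine mul_left_cancel₀ hlam.ne' ?_
      linarith
    by_contra hcon
    push Not at hcon
    nlinarith
  have hm := corrFun_mul_leadFun_lt (leadFun_lt_imp (by positivity) hx hxx hlt) hx hxx hx1'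
  have : corrFun κ x * leadFun κ y * (lam * E' * E) = corrFun κ y * leadFun κ x * (lam * E' * E) := by
    linear_combination E * leadFun κ y * hc2 - corrFun κ y * E * he
  exact hm.ne' (mul_right_cancel₀ (by positivity) this)

lemma massCorr_ne (hσx : 0 < σx) (hlam : 0 < lam) (hγ : 0 < γ) (hσc : 0 < σc) (hτ : 0 ≤ τ)
    (hr : 0 < r) (hr' : 0 < r') (h : r ≠ r')
    (he : massLead σx lam γ σc τ r = massLead σx lam γ σc τ r') :
    massCorr σx lam γ σc τ r ≠ massCorr σx lam γ σc τ r' := by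
  rcases h.lt_or_gt with h | h
  · exact massCorr_ne_of_lt hσx hlam hγ hσc hτ hr h he
  · exact (massCorr_ne_of_lt hσx hlam hγ hσc hτ hr' h he.symm).symm

lemma tendsto_radialMass (hσx : 0 < σx) (hlam : 0 < lam) (hγ : 0 < γ) (hσc : 0 < σc)
    (hr : 0 < r) :
    Tendsto (fun σθ => radialMass σx lam γ σc τ σθ r) (𝓝[>] 0) (𝓝 (massLead σx lam γ σc τ r)) := by
  obtain ⟨C, hC⟩ := abs_radialMass_sub_expansion_le (τ := τ) hσx hlam hγ hσc hr
  have h1 : Tendsto (fun σθ : ℝ => |σθ * massCorr σx lam γ σc τ r| + C * σθ ^ 2) (𝓝[>] 0) (𝓝 0) := by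
    have : Continuous fun σθ : ℝ => |σθ * massCorr σx lam γ σc τ r| + C * σθ ^ 2 := by fun_prop
    exact (this.tendsto' 0 0 (by simp)).mono_left nhdsWithin_le_nhds
  refine tendsto_iff_norm_sub_tendsto_zero.mpr ?_
  refine tendsto_of_tendsto_of_tendsto_of_le_of_le' tendsto_const_nhds h1
    (Eventually.of_forall fun _ => norm_nonneg _) ?_
  filter_upwards [self_mem_nhdsWithin] with σθ hσ
  have h2 := hC σθ (le_of_lt hσ)
  have h3 := abs_add_le (radialMass σx lam γ σc τ σθ r - (massLead σx lam γ σc τ r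
    + σθ * massCorr σx lam γ σc τ r)) (σθ * massCorr σx lam γ σc τ r)
  rw [Real.norm_eq_abs]
  rw [show radialMass σx lam γ σc τ σθ r - (massLead σx lam γ σc τ r
    + σθ * massCorr σx lam γ σc τ r) + σθ * massCorr σx lam γ σc τ r
    = radialMass σx lam γ σc τ σθ r - massLead σx lam γ σc τ r by ring] at h3
  linarith

/-- Either the limits differ, or the first order coefficients do; in the second case the gap is
linear in σ_θ and beats the quadratic remainders. -/
lemma eventually_radialMass_ne (hσx : 0 < σx) (hlam : 0 < lam) (hγ : 0 < γ) (hσc : 0 < σc)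
    (hτ : 0 ≤ τ) (hr : 0 < r) (hr' : 0 < r') (h : r ≠ r') :
    ∀ᶠ σθ in 𝓝[>] (0 : ℝ), radialMass σx lam γ σc τ σθ r ≠ radialMass σx lam γ σc τ σθ r' := by
  have t1 := tendsto_radialMass (τ := τ) hσx hlam hγ hσc hr
  have t2 := tendsto_radialMass (τ := τ) hσx hlam hγ hσc hr'
  by_cases he : massLead σx lam γ σc τ r = massLead σx lam γ σc τ r'
  · have hne := massCorr_ne hσx hlam hγ hσc hτ hr hr' h he
    obtain ⟨C, hC⟩ := abs_radialMass_sub_expansion_le (τ := τ) hσx hlam hγ hσc hr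
    obtain ⟨C', hC'⟩ := abs_radialMass_sub_expansion_le (τ := τ) hσx hlam hγ hσc hr'
    have hδ : 0 < |massCorr σx lam γ σc τ r - massCorr σx lam γ σc τ r'| :=
      abs_pos.mpr (sub_ne_zero.mpr hne)
    have hsmall : ∀ᶠ σθ in 𝓝[>] (0 : ℝ), (C + C') * σθ
        < |massCorr σx lam γ σc τ r - massCorr σx lam γ σc τ r'| := by
      have hc : Continuous fun σθ : ℝ => (C + C') * σθ := by fun_prop
      have := hc.tendsto 0
      rw [mul_zero] at this
      exact (this.mono_left nhdsWithin_le_nhds).eventually_lt_const hδ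
    filter_upwards [hsmall, self_mem_nhdsWithin] with σθ h1 hσ hcon
    have hσ0 : 0 < σθ := hσ
    have h2 := hC σθ hσ0.le
    have h3 := hC' σθ hσ0.le
    rw [hcon, he] at h2
    have h4 := abs_sub_le (massLead σx lam γ σc τ r' + σθ * massCorr σx lam γ σc τ r)
      (radialMass σx lam γ σc τ σθ r') (massLead σx lam γ σc τ r' + σθ * massCorr σx lam γ σc τ r')
    rw [abs_sub_comm _ (radialMass σx lam γ σc τ σθ r')] at h4
    rw [show massLead σx lam γ σc τ r' + σθ * massCorr σx lam γ σc τ r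
      - (massLead σx lam γ σc τ r' + σθ * massCorr σx lam γ σc τ r')
      = σθ * (massCorr σx lam γ σc τ r - massCorr σx lam γ σc τ r') by ring, abs_mul,
      abs_of_pos hσ0] at h4
    nlinarith
  · have := (t1.sub t2).eventually_ne (sub_ne_zero.mpr he)
    filter_upwards [this] with σθ h1 hcon
    exact h1 (sub_eq_zero.mpr hcon)

/-- For small angular diffusion, the mass at wave number `k` is positive and differs from the mass
at every other wave number of the lattice. -/
lemma exists_diffusion_threshold (hσx : 0 < σx) (hlam : 0 < lam) (hγ : 0 < γ) (hσc : 0 < σc)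
    (hτ : 0 ≤ τ) {k : ℕ} (hk : 1 ≤ k) :
    ∃ σk : ℝ, 0 < σk ∧ ∀ σθ, 0 < σθ → σθ < σk → 0 < radialMass σx lam γ σc τ σθ k ∧
      ∀ N : ℕ, 1 ≤ N → N ≠ k ^ 2 →
        radialMass σx lam γ σc τ σθ (√N) ≠ radialMass σx lam γ σc τ σθ k := by
  have hk0 : (0 : ℝ) < k := by exact_mod_cast hk
  have hpos := massLead_pos hσx hlam hγ hσc hτ hk0
  -- Half the limiting mass separates: the mass at k stays above it for small σ_θ, while for N > N₀
  -- the uniform decay keeps the mass below it. Only N ≤ N₀ need individual treatment.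
  have h1 := (tendsto_radialMass (τ := τ) hσx hlam hγ hσc hk0).eventually_const_lt
    (half_lt_self hpos)
  obtain ⟨C, hC⟩ := abs_radialMass_le (lam := lam) hσx hγ hσc hτ
  obtain ⟨N₀, hN₀⟩ := exists_nat_gt (C / (massLead σx lam γ σc τ k / 2))
  have h2 : ∀ᶠ σθ in 𝓝[>] (0 : ℝ), ∀ N ∈ Finset.range (N₀ + 1), 1 ≤ N → N ≠ k ^ 2 →
      radialMass σx lam γ σc τ σθ (√N) ≠ radialMass σx lam γ σc τ σθ k := by
    rw [Filter.eventually_all_finset]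
    intro N _
    by_cases hN : 1 ≤ N ∧ N ≠ k ^ 2
    · have hN0 : (0 : ℝ) < √N := Real.sqrt_pos.mpr (by exact_mod_cast hN.1)
      have hne : √(N : ℝ) ≠ k := fun hcon => hN.2 (by
        have := Real.sq_sqrt (Nat.cast_nonneg (α := ℝ) N)
        rw [hcon] at this
        exact_mod_cast this.symm)
      filter_upwards [eventually_radialMass_ne hσx hlam hγ hσc hτ hN0 hk0 hne] with σθ h _ _
      exact h
    · exact Eventually.of_forall fun _ h h' => absurd ⟨h, h'⟩ hN
  obtain ⟨σk, hσk, hsub⟩ := mem_nhdsGT_iff_exists_Ioo_subset.mp (h1.and h2)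
  refine ⟨σk, hσk, fun σθ h0 hlt => ?_⟩
  obtain ⟨h3, h4⟩ := hsub ⟨h0, hlt⟩
  refine ⟨(half_pos hpos).trans h3, fun N hN hNk => ?_⟩
  by_cases hle : N < N₀ + 1
  · exact h4 N (Finset.mem_range.mpr hle) hN hNk
  · have hN1 : (1 : ℝ) ≤ N := by exact_mod_cast hN
    have hgt : C / (massLead σx lam γ σc τ k / 2) < N := hN₀.trans (by
      exact_mod_cast (by omega : N₀ < N))
    have h5 := hC σθ (√N) h0.le (Real.one_le_sqrt.mpr hN1)
    rw [Real.sq_sqrt (by positivity)] at h5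
    rw [div_lt_iff₀ (half_pos hpos)] at hgt
    have h6 : C / N < massLead σx lam γ σc τ k / 2 := by
      rw [div_lt_iff₀ (by positivity)]; linarith
    exact (((le_abs_self _).trans h5).trans_lt (h6.trans h3)).ne

end
end AntModel
end

noncomputable section
namespace AntModel
open MeasureTheory Submodule Matrix
open scoped ComplexConjugate

/-! ## Fourier bases -/

section charBasis
variable {X ι : Type*} [TopologicalSpace X] [CompactSpace X]
  [MeasurableSpace X] [BorelSpace X] {μ : Measure X} [IsFiniteMeasure μ] {e : ι → C(X, ℂ)} {V : ℝ}

/-- V is the common squared norm of the characters; it is 2π both on the circle and on the phase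
space. -/
lemma orthonormal_char (hV : 0 < V) [DecidableEq ι]
    (ho : ∀ i j, ∫ x, conj (e i x) * e j x ∂μ = if i = j then (V : ℂ) else 0) :
    Orthonormal ℂ fun i => ((√V : ℝ) : ℂ)⁻¹ • ContinuousMap.toLp (E := ℂ) 2 μ ℂ (e i) := by
  rw [orthonormal_iff_ite]
  intro i j
  have h : (((√V : ℝ) : ℂ)⁻¹) * ((√V : ℝ) : ℂ)⁻¹ * V = 1 := by
    have h1 : ((√V : ℝ) : ℂ) * ((√V : ℝ) : ℂ) = V := by
      rw [← Complex.ofReal_mul, Real.mul_self_sqrt hV.le]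
    have h2 : ((√V : ℝ) : ℂ) ≠ 0 := Complex.ofReal_ne_zero.mpr (Real.sqrt_pos.mpr hV).ne'
    rw [← h1]
    field_simp
  rw [inner_smul_left, inner_smul_right, ContinuousMap.inner_toLp]
  simp_rw [mul_comm (e j _)]
  rw [ho, map_inv₀, Complex.conj_ofReal, ← mul_assoc]
  split_ifs
  · exact h
  · simp

variable [T2Space X] [SecondCountableTopology X] [μ.WeaklyRegular]

/-- The Hilbert basis of normalised characters. -/
def charBasis (hV : 0 < V) [DecidableEq ι]
    (ho : ∀ i j, ∫ x, conj (e i x) * e j x ∂μ = if i = j then (V : ℂ) else 0)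
    (he : (span ℂ (Set.range e)).topologicalClosure = ⊤) : HilbertBasis ι ℂ (Lp ℂ 2 μ) :=
  HilbertBasis.mk (orthonormal_char hV ho) (by
    have := (ContinuousMap.toLp_denseRange ℂ μ ℂ
      (p := 2) (by norm_num)).topologicalClosure_map_submodule he
    rw [Submodule.map_span, ← Set.range_comp] at this
    refine this.ge.trans (Submodule.topologicalClosure_mono (Submodule.span_le.mpr ?_))
    rintro _ ⟨i, rfl⟩
    have h2 : ((√V : ℝ) : ℂ) ≠ 0 := Complex.ofReal_ne_zero.mpr (Real.sqrt_pos.mpr hV).ne'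
    have h3 := Submodule.smul_mem _ ((√V : ℝ) : ℂ) (Submodule.subset_span (R := ℂ)
      (Set.mem_range_self (f := fun i => ((√V : ℝ) : ℂ)⁻¹ •
        ContinuousMap.toLp (E := ℂ) 2 μ ℂ (e i)) i))
    simpa [smul_smul, h2] using h3)

lemma integral_char_eq (hV : 0 < V) [DecidableEq ι]
    (ho : ∀ i j, ∫ x, conj (e i x) * e j x ∂μ = if i = j then (V : ℂ) else 0)
    (he : (span ℂ (Set.range e)).topologicalClosure = ⊤) (F : Lp ℂ 2 μ) (i : ι) :
    ∫ x, conj (e i x) * F x ∂μ = (√V : ℝ) * (charBasis hV ho he).repr F i := by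
  have h2 : ((√V : ℝ) : ℂ) ≠ 0 := Complex.ofReal_ne_zero.mpr (Real.sqrt_pos.mpr hV).ne'
  rw [HilbertBasis.repr_apply_apply, charBasis, HilbertBasis.coe_mk, inner_smul_left, map_inv₀,
    Complex.conj_ofReal, ← mul_assoc, mul_inv_cancel₀ h2, one_mul, L2.inner_def]
  refine integral_congr_ae ?_
  filter_upwards [ContinuousMap.coeFn_toLp (𝕜 := ℂ) (p := 2) μ (e i)] with x hx
  rw [RCLike.inner_apply, hx, mul_comm]

lemma sqSum_integral_char (hV : 0 < V) [DecidableEq ι]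
    (ho : ∀ i j, ∫ x, conj (e i x) * e j x ∂μ = if i = j then (V : ℂ) else 0)
    (he : (span ℂ (Set.range e)).topologicalClosure = ⊤) (F : Lp ℂ 2 μ) :
    SqSum fun i => ∫ x, conj (e i x) * F x ∂μ := by
  simp_rw [integral_char_eq hV ho he]
  exact (sqSum_coe _).const_mul _

lemma exists_integral_char_eq (hV : 0 < V) [DecidableEq ι]
    (ho : ∀ i j, ∫ x, conj (e i x) * e j x ∂μ = if i = j then (V : ℂ) else 0)
    (he : (span ℂ (Set.range e)).topologicalClosure = ⊤) {a : ι → ℂ} (ha : SqSum a) :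
    ∃ F : Lp ℂ 2 μ, ∀ i, ∫ x, conj (e i x) * F x ∂μ = a i := by
  have h2 : ((√V : ℝ) : ℂ) ≠ 0 := Complex.ofReal_ne_zero.mpr (Real.sqrt_pos.mpr hV).ne'
  refine ⟨(charBasis hV ho he).repr.symm (ha.const_mul ((√V : ℝ) : ℂ)⁻¹).toLp, fun i => ?_⟩
  rw [integral_char_eq hV ho he, LinearIsometryEquiv.apply_symm_apply, SqSum.coe_toLp,
    ← mul_assoc, mul_inv_cancel₀ h2, one_mul]

lemma inner_eq_tsum_integral_char (hV : 0 < V) [DecidableEq ι]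
    (ho : ∀ i j, ∫ x, conj (e i x) * e j x ∂μ = if i = j then (V : ℂ) else 0)
    (he : (span ℂ (Set.range e)).topologicalClosure = ⊤) (F G : Lp ℂ 2 μ) :
    inner ℂ F G = (V : ℂ)⁻¹ * ∑' i, conj (∫ x, conj (e i x) * F x ∂μ)
      * ∫ x, conj (e i x) * G x ∂μ := by
  have h1 : ((√V : ℝ) : ℂ) * ((√V : ℝ) : ℂ) = V := by
    rw [← Complex.ofReal_mul, Real.mul_self_sqrt hV.le]
  have h2 : ((√V : ℝ) : ℂ) ≠ 0 := Complex.ofReal_ne_zero.mpr (Real.sqrt_pos.mpr hV).ne'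
  rw [← (charBasis hV ho he).repr.inner_map_map, lp.inner_eq_tsum, ← tsum_mul_left]
  refine tsum_congr fun i => ?_
  rw [integral_char_eq hV ho he, integral_char_eq hV ho he, RCLike.inner_apply, map_mul,
    Complex.conj_ofReal, ← h1]
  field_simp

lemma eq_of_integral_char_eq (hV : 0 < V) [DecidableEq ι]
    (ho : ∀ i j, ∫ x, conj (e i x) * e j x ∂μ = if i = j then (V : ℂ) else 0)
    (he : (span ℂ (Set.range e)).topologicalClosure = ⊤) {F G : Lp ℂ 2 μ}
    (h : ∀ i, ∫ x, conj (e i x) * F x ∂μ = ∫ x, conj (e i x) * G x ∂μ) : F = G := by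
  have h2 : ((√V : ℝ) : ℂ) ≠ 0 := Complex.ofReal_ne_zero.mpr (Real.sqrt_pos.mpr hV).ne'
  refine (charBasis hV ho he).repr.injective (lp.ext (funext fun i => ?_))
  have := h i
  rw [integral_char_eq hV ho he, integral_char_eq hV ho he] at this
  exact mul_left_cancel₀ h2 this

end charBasis

/-! ### The circle of angles -/

lemma integral_fourier_ang (n : ℤ) :
    ∫ θ : Ang, (fourier n θ : ℂ) = if n = 0 then ((2 * Real.pi : ℝ) : ℂ) else 0 := by
  have h := congrFun (fourierCoeff_fourier (T := 2 * Real.pi) n) 0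
  rw [AddCircle.volume_eq_smul_haarAddCircle, integral_smul_measure]
  simp only [fourierCoeff, Pi.single_apply, neg_zero, fourier_zero, one_smul] at h
  rw [h, ENNReal.toReal_ofReal Real.two_pi_pos.le]
  by_cases hn : n = 0 <;> simp [hn, eq_comm]

lemma integral_conj_fourier_mul (i j : ℤ) :
    ∫ θ : Ang, conj (fourier i θ : ℂ) * fourier j θ
      = if i = j then ((2 * Real.pi : ℝ) : ℂ) else 0 := by
  simp_rw [← fourier_neg, ← fourier_add]
  rw [integral_fourier_ang]
  refine if_congr ?_ rfl rfl
  rw [neg_add_eq_zero]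

lemma angCoeff_eq (u : Ang → ℂ) (n : ℤ) : angCoeff u n = ∫ θ, conj (fourier n θ : ℂ) * u θ := by
  simp_rw [angCoeff, fourier_neg]

lemma span_fourier_ang : (span ℂ (Set.range fun n : ℤ => (fourier n : C(Ang, ℂ)))).topologicalClosure
    = ⊤ := span_fourier_closure_eq_top

lemma sqSum_angCoeff (u : L2Ang) : SqSum (angCoeff u) := by
  have := sqSum_integral_char Real.two_pi_pos integral_conj_fourier_mul span_fourier_ang u
  simpa only [← angCoeff_eq] using this

lemma exists_angCoeff_eq {a : ℤ → ℂ} (ha : SqSum a) : ∃ u : L2Ang, ∀ n, angCoeff u n = a n := by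
  obtain ⟨u, hu⟩ := exists_integral_char_eq Real.two_pi_pos integral_conj_fourier_mul
    span_fourier_ang ha
  exact ⟨u, fun n => by rw [angCoeff_eq, hu]⟩

lemma angCoeff_injective {u w : L2Ang} (h : ∀ n, angCoeff u n = angCoeff w n) : u = w :=
  eq_of_integral_char_eq Real.two_pi_pos integral_conj_fourier_mul span_fourier_ang fun n => by
    simpa only [← angCoeff_eq] using h n

lemma angCoeff_congr {u w : Ang → ℂ} (h : u =ᵐ[volume] w) (n : ℤ) : angCoeff u n = angCoeff w n :=
  integral_congr_ae (by filter_upwards [h] with θ hθ; rw [hθ])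

/-! ### The phase space -/

lemma phaseChar_neg (q : (Fin 2 → ℤ) × ℤ) (p : Phase) :
    phaseChar (-q) p = conj (phaseChar q p) := by
  simp [phaseChar, UnitAddTorus.mFourier_neg]

lemma integral_conj_phaseChar_mul (q q' : (Fin 2 → ℤ) × ℤ) :
    ∫ p, conj (phaseChar q p) * phaseChar q' p
      = if q = q' then ((2 * Real.pi : ℝ) : ℂ) else 0 := by
  have h : ∀ p : Phase, conj (phaseChar q p) * phaseChar q' p
      = UnitAddTorus.mFourier (-q.1 + q'.1) p.1 * fourier (-q.2 + q'.2) p.2 := fun p => by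
    simp only [phaseChar, ContinuousMap.coe_mk, map_mul, UnitAddTorus.mFourier_add,
      UnitAddTorus.mFourier_neg, fourier_add, fourier_neg]
    ring
  simp_rw [h]
  rw [Measure.volume_eq_prod, integral_prod_mul (fun x => UnitAddTorus.mFourier (-q.1 + q'.1) x)
    (fun θ => (fourier (-q.2 + q'.2) θ : ℂ)), integral_mFourier, integral_fourier_ang]
  simp only [neg_add_eq_zero, Prod.ext_iff]
  by_cases h1 : q.1 = q'.1 <;> by_cases h2 : q.2 = q'.2 <;> simp [h1, h2]

lemma span_phaseChar : (span ℂ (Set.range phaseChar)).topologicalClosure = ⊤ := by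
  rw [← phaseCharAlgebra_coe]
  exact congr_arg (Subalgebra.toSubmodule <| StarSubalgebra.toSubalgebra ·)
    (ContinuousMap.starSubalgebra_topologicalClosure_eq_top_of_separatesPoints _
      phaseCharAlgebra_separates)

/-- A real square integrable function as a complex one. -/
def complexify (f : L2Phase) : Lp ℂ 2 (volume : Measure Phase) :=
  (show MemLp (fun p => (f p : ℂ)) 2 volume from (Lp.memLp f).ofReal).toLp

lemma coeFn_complexify (f : L2Phase) : complexify f =ᵐ[volume] fun p => (f p : ℂ) :=
  MemLp.coeFn_toLp _

lemma phaseCoeff_eq (f : Phase → ℝ) (m : Fin 2 → ℤ) (n : ℤ) :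
    phaseCoeff f m n = ∫ p, conj (phaseChar (m, n) p) * (f p : ℂ) := by
  simp [phaseCoeff, phaseChar, UnitAddTorus.mFourier_neg]

lemma phaseCoeff_eq_complexify (f : L2Phase) (m : Fin 2 → ℤ) (n : ℤ) :
    phaseCoeff f m n = ∫ p, conj (phaseChar (m, n) p) * complexify f p := by
  rw [phaseCoeff_eq]
  refine integral_congr_ae ?_
  filter_upwards [coeFn_complexify f] with p hp
  rw [hp]

lemma phaseCoeff_congr {f g : Phase → ℝ} (h : f =ᵐ[volume] g) (m : Fin 2 → ℤ) (n : ℤ) :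
    phaseCoeff f m n = phaseCoeff g m n :=
  integral_congr_ae (by filter_upwards [h] with p hp; rw [hp])

lemma phaseCoeff_neg_neg (f : Phase → ℝ) (m : Fin 2 → ℤ) (n : ℤ) :
    phaseCoeff f (-m) (-n) = conj (phaseCoeff f m n) := by
  rw [phaseCoeff, phaseCoeff, ← integral_conj]
  simp [UnitAddTorus.mFourier_neg]

lemma sqSum_phaseCoeff (f : L2Phase) :
    SqSum fun q : (Fin 2 → ℤ) × ℤ => phaseCoeff f q.1 q.2 := by
  have := sqSum_integral_char Real.two_pi_pos integral_conj_phaseChar_mul span_phaseChar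
    (complexify f)
  simpa only [← phaseCoeff_eq_complexify] using this

/-- Taking the real part of a complex function averages its coefficient at (m,n) with the conjugate
of the one at (-m,-n); by `hc` the average changes nothing. -/
lemma exists_phaseCoeff_eq {a : (Fin 2 → ℤ) → ℤ → ℂ}
    (ha : SqSum fun q : (Fin 2 → ℤ) × ℤ => a q.1 q.2)
    (hc : ∀ m n, a (-m) (-n) = conj (a m n)) :
    ∃ f : L2Phase, ∀ m n, phaseCoeff f m n = a m n := by
  obtain ⟨Z, hZ⟩ := exists_integral_char_eq Real.two_pi_pos integral_conj_phaseChar_mul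
    span_phaseChar ha
  have hre : MemLp (fun x => (Z x).re) 2 volume := (Lp.memLp Z).re
  refine ⟨hre.toLp, fun m n => ?_⟩
  have hi : ∀ q, Integrable fun p => conj (phaseChar q p) * Z p := fun q => by
    have hc := (phaseChar (-q)).continuous
    simp_rw [← phaseChar_neg]
    refine ((Lp.memLp Z).integrable (by norm_num)).bdd_mul (c := ‖phaseChar (-q)‖)
      hc.aestronglyMeasurable ?_
    exact Filter.Eventually.of_forall fun p => (phaseChar (-q)).norm_coe_le_norm p
  have hi' : Integrable fun p => conj (conj (phaseChar (-(m, n)) p) * Z p) :=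
    (hi (-(m, n))).congr' (by
      exact (Complex.continuous_conj.comp_aestronglyMeasurable (hi (-(m, n))).1)) (by simp)
  have h2 : phaseCoeff hre.toLp m n = ((∫ p, conj (phaseChar (m, n) p) * Z p)
      + ∫ p, conj (conj (phaseChar (-(m, n)) p) * Z p)) / 2 := by
    rw [← integral_add (hi (m, n)) hi', phaseCoeff_eq, ← integral_div]
    refine integral_congr_ae ?_
    filter_upwards [hre.coeFn_toLp] with p hp
    rw [hp, map_mul, phaseChar_neg, Complex.conj_conj, ← mul_add, Complex.add_conj]
    push_cast
    ring
  rw [h2, integral_conj, hZ, hZ]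
  simp only [Prod.fst_neg, Prod.snd_neg, hc, Complex.conj_conj]
  ring

lemma phaseCoeff_ext {f g : L2Phase} (h : ∀ m n, phaseCoeff f m n = phaseCoeff g m n) : f = g := by
  rw [← sub_eq_zero, sub_eq_add_neg, ← neg_one_smul ℝ g]
  refine phaseCoeff_injective _ fun m n => ?_
  rw [phaseCoeff_add, phaseCoeff_smul, h]
  simp

lemma inner_L2Phase (f g : L2Phase) : inner ℝ f g = (2 * Real.pi)⁻¹ *
    (∑' q : (Fin 2 → ℤ) × ℤ, conj (phaseCoeff f q.1 q.2) * phaseCoeff g q.1 q.2).re := by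
  have h := inner_eq_tsum_integral_char Real.two_pi_pos integral_conj_phaseChar_mul span_phaseChar
    (complexify f) (complexify g)
  simp only [← phaseCoeff_eq_complexify] at h
  have h2 : inner ℂ (complexify f) (complexify g) = ((inner ℝ f g : ℝ) : ℂ) := by
    rw [L2.inner_def, L2.inner_def, ← integral_complex_ofReal]
    refine integral_congr_ae ?_
    filter_upwards [coeFn_complexify f, coeFn_complexify g] with p h1 h2
    rw [h1, h2]
    simp
  rw [h2] at h
  have h3 := congrArg Complex.re h
  rw [Complex.ofReal_re, ← Complex.ofReal_inv, Complex.re_ofReal_mul] at h3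
  exact h3

end AntModel
end

noncomputable section
namespace AntModel
open MeasureTheory Submodule Matrix
open scoped ComplexConjugate

/-! ## The linearized operator in Fourier coefficients -/

lemma cosA_eq (θ : Ang) : (cosA θ : ℂ) = (fourier 1 θ + fourier (-1) θ) / 2 := by
  rw [fourier_neg, Complex.add_conj, fourier_one, cosA]; push_cast; ring

lemma sinA_eq (θ : Ang) : (sinA θ : ℂ) = -Complex.I * (fourier 1 θ - fourier (-1) θ) / 2 := by
  rw [fourier_neg, Complex.sub_conj, fourier_one, sinA]; push_cast
  linear_combination ((AddCircle.toCircle θ : ℂ).im : ℂ) * Complex.I_sq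

lemma cosA_sq_sub_eq (θ : Ang) :
    ((cosA θ ^ 2 - sinA θ ^ 2 : ℝ) : ℂ) = (fourier 2 θ + fourier (-2) θ) / 2 := by
  have h : ∀ k : ℤ, (fourier (k + k) θ : ℂ) = fourier k θ * fourier k θ := fun k => fourier_add
  push_cast
  rw [cosA_eq, sinA_eq, show (2 : ℤ) = 1 + 1 from rfl, show (-(1 + 1) : ℤ) = -1 + -1 from rfl, h, h]
  linear_combination (-(fourier 1 θ - fourier (-1) θ) ^ 2 / 4 : ℂ) * Complex.I_sq

lemma two_sinA_mul_cosA_eq (θ : Ang) :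
    ((2 * sinA θ * cosA θ : ℝ) : ℂ) = -Complex.I * (fourier 2 θ - fourier (-2) θ) / 2 := by
  have h : ∀ k : ℤ, (fourier (k + k) θ : ℂ) = fourier k θ * fourier k θ := fun k => fourier_add
  push_cast
  rw [cosA_eq, sinA_eq, show (2 : ℤ) = 1 + 1 from rfl, show (-(1 + 1) : ℤ) = -1 + -1 from rfl, h, h]
  ring

/-! ### Angular coefficients of the trigonometric functions -/

lemma angCoeff_fourier (k n : ℤ) :
    angCoeff (fun θ => fourier k θ) n = if n = k then ((2 * Real.pi : ℝ) : ℂ) else 0 := by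
  rw [angCoeff_eq, integral_conj_fourier_mul]

lemma integrable_fourier_mul {u : Ang → ℂ} (hu : Integrable u) (n : ℤ) :
    Integrable fun θ : Ang => (fourier n θ : ℂ) * u θ := by
  refine hu.bdd_mul (c := ‖(fourier n : C(Ang, ℂ))‖) (fourier n).continuous.aestronglyMeasurable ?_
  exact Filter.Eventually.of_forall fun θ => (fourier n : C(Ang, ℂ)).norm_coe_le_norm θ

lemma angCoeff_add {u w : Ang → ℂ} (hu : Integrable u) (hw : Integrable w) (n : ℤ) :
    angCoeff (fun θ => u θ + w θ) n = angCoeff u n + angCoeff w n := by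
  rw [angCoeff, angCoeff, angCoeff,
    ← integral_add (integrable_fourier_mul hu _) (integrable_fourier_mul hw _)]
  simp_rw [mul_add]

lemma angCoeff_const_mul (c : ℂ) (u : Ang → ℂ) (n : ℤ) :
    angCoeff (fun θ => c * u θ) n = c * angCoeff u n := by
  rw [angCoeff, angCoeff, ← integral_const_mul]
  exact integral_congr_ae (Filter.Eventually.of_forall fun θ => by ring)

lemma integrable_of_continuous_ang {u : Ang → ℂ} (hu : Continuous u) : Integrable u :=
  hu.integrable_of_hasCompactSupport (HasCompactSupport.of_compactSpace u)

lemma angCoeff_cosA (n : ℤ) : angCoeff (fun θ => (cosA θ : ℂ)) n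
    = (if n = 1 then (Real.pi : ℂ) else 0) + if n = -1 then (Real.pi : ℂ) else 0 := by
  have : (fun θ : Ang => (cosA θ : ℂ)) = fun θ => 1 / 2 * fourier 1 θ + 1 / 2 * fourier (-1) θ := by
    funext θ; rw [cosA_eq]; ring
  rw [this, angCoeff_add (integrable_of_continuous_ang (by fun_prop))
    (integrable_of_continuous_ang (by fun_prop)), angCoeff_const_mul, angCoeff_const_mul,
    angCoeff_fourier, angCoeff_fourier]
  push_cast
  split_ifs <;> ring

lemma angCoeff_sinA (n : ℤ) : angCoeff (fun θ => (sinA θ : ℂ)) n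
    = (if n = 1 then -Complex.I * Real.pi else 0) + if n = -1 then Complex.I * Real.pi else 0 := by
  have : (fun θ : Ang => (sinA θ : ℂ))
      = fun θ => -Complex.I / 2 * fourier 1 θ + Complex.I / 2 * fourier (-1) θ := by
    funext θ; rw [sinA_eq]; ring
  rw [this, angCoeff_add (integrable_of_continuous_ang (by fun_prop))
    (integrable_of_continuous_ang (by fun_prop)), angCoeff_const_mul, angCoeff_const_mul,
    angCoeff_fourier, angCoeff_fourier]
  push_cast
  split_ifs <;> ring

lemma angCoeff_cosA_sq_sub (n : ℤ) : angCoeff (fun θ => ((cosA θ ^ 2 - sinA θ ^ 2 : ℝ) : ℂ)) n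
    = (if n = 2 then (Real.pi : ℂ) else 0) + if n = -2 then (Real.pi : ℂ) else 0 := by
  have : (fun θ : Ang => ((cosA θ ^ 2 - sinA θ ^ 2 : ℝ) : ℂ))
      = fun θ => 1 / 2 * fourier 2 θ + 1 / 2 * fourier (-2) θ := by
    funext θ; rw [cosA_sq_sub_eq]; ring
  rw [this, angCoeff_add (integrable_of_continuous_ang (by fun_prop))
    (integrable_of_continuous_ang (by fun_prop)), angCoeff_const_mul, angCoeff_const_mul,
    angCoeff_fourier, angCoeff_fourier]
  push_cast
  split_ifs <;> ring

lemma angCoeff_two_sinA_mul_cosA (n : ℤ) : angCoeff (fun θ => ((2 * sinA θ * cosA θ : ℝ) : ℂ)) n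
    = (if n = 2 then -Complex.I * Real.pi else 0) + if n = -2 then Complex.I * Real.pi else 0 := by
  have : (fun θ : Ang => ((2 * sinA θ * cosA θ : ℝ) : ℂ))
      = fun θ => -Complex.I / 2 * fourier 2 θ + Complex.I / 2 * fourier (-2) θ := by
    funext θ; rw [two_sinA_mul_cosA_eq]; ring
  rw [this, angCoeff_add (integrable_of_continuous_ang (by fun_prop))
    (integrable_of_continuous_ang (by fun_prop)), angCoeff_const_mul, angCoeff_const_mul,
    angCoeff_fourier, angCoeff_fourier]
  push_cast
  split_ifs <;> ring

/-! ### Rules for the coefficients on the phase space -/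

lemma integrable_phaseChar_mul {F : Phase → ℂ} (hF : Integrable F) (m : Fin 2 → ℤ) (n : ℤ) :
    Integrable fun p : Phase => UnitAddTorus.mFourier m p.1 * fourier n p.2 * F p := by
  refine hF.bdd_mul (c := ‖phaseChar (m, n)‖) (phaseChar (m, n)).continuous.aestronglyMeasurable ?_
  exact Filter.Eventually.of_forall fun p => (phaseChar (m, n)).norm_coe_le_norm p

lemma integrable_phaseChar_mul_real {F : Phase → ℝ} (hF : Integrable F) (m : Fin 2 → ℤ) (n : ℤ) :
    Integrable fun p : Phase => UnitAddTorus.mFourier m p.1 * fourier n p.2 * (F p : ℂ) :=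
  integrable_phaseChar_mul hF.ofReal m n

lemma phaseCoeff_fun_add {F G : Phase → ℝ} (hF : Integrable F) (hG : Integrable G)
    (m : Fin 2 → ℤ) (n : ℤ) :
    phaseCoeff (fun p => F p + G p) m n = phaseCoeff F m n + phaseCoeff G m n := by
  rw [phaseCoeff, phaseCoeff, phaseCoeff, ← integral_add (integrable_phaseChar_mul_real hF _ _)
    (integrable_phaseChar_mul_real hG _ _)]
  simp_rw [Complex.ofReal_add, mul_add]

lemma phaseCoeff_fun_const_mul (c : ℝ) (F : Phase → ℝ) (m : Fin 2 → ℤ) (n : ℤ) :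
    phaseCoeff (fun p => c * F p) m n = c * phaseCoeff F m n := by
  rw [phaseCoeff, phaseCoeff, ← integral_const_mul]
  exact integral_congr_ae (Filter.Eventually.of_forall fun p => by push_cast; ring)

lemma phaseCoeff_cosA_mul {F : Phase → ℝ} (hF : Integrable F) (m : Fin 2 → ℤ) (n : ℤ) :
    phaseCoeff (fun p => cosA p.2 * F p) m n
      = (phaseCoeff F m (n - 1) + phaseCoeff F m (n + 1)) / 2 := by
  rw [phaseCoeff, phaseCoeff, phaseCoeff, ← integral_add (integrable_phaseChar_mul_real hF _ _)
    (integrable_phaseChar_mul_real hF _ _), ← integral_div]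
  refine integral_congr_ae (Filter.Eventually.of_forall fun p => ?_)
  simp only [Complex.ofReal_mul]
  rw [cosA_eq, show -(n - 1) = -n + 1 by ring, show -(n + 1) = -n + -1 by ring, fourier_add,
    fourier_add]
  ring

lemma phaseCoeff_sinA_mul {F : Phase → ℝ} (hF : Integrable F) (m : Fin 2 → ℤ) (n : ℤ) :
    phaseCoeff (fun p => sinA p.2 * F p) m n
      = -Complex.I * (phaseCoeff F m (n - 1) - phaseCoeff F m (n + 1)) / 2 := by
  rw [phaseCoeff, phaseCoeff, phaseCoeff, ← integral_sub (integrable_phaseChar_mul_real hF _ _)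
    (integrable_phaseChar_mul_real hF _ _), ← integral_const_mul, ← integral_div]
  refine integral_congr_ae (Filter.Eventually.of_forall fun p => ?_)
  simp only [Complex.ofReal_mul]
  rw [sinA_eq, show -(n - 1) = -n + 1 by ring, show -(n + 1) = -n + -1 by ring, fourier_add,
    fourier_add]
  ring

lemma phaseCoeff_angle_mul (a : Ang → ℝ) (g : L2Pos) (m : Fin 2 → ℤ) (n : ℤ) :
    phaseCoeff (fun p => a p.2 * g p.1) m n = posCoeff g m * angCoeff (fun θ => (a θ : ℂ)) n := by
  rw [phaseCoeff, posCoeff, angCoeff, ← integral_prod_mul, Measure.volume_eq_prod]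
  exact integral_congr_ae (Filter.Eventually.of_forall fun p => by push_cast; ring)

lemma posCoeff_massDensity (f : L2Phase) (m : Fin 2 → ℤ) :
    posCoeff (fun x => ∫ θ : Ang, f (x, θ)) m = phaseCoeff f m 0 := by
  have h := integral_prod (μ := (volume : Measure Pos)) (ν := (volume : Measure Ang)) _
    (integrable_phaseChar_mul_real (integrable_L2Phase f) (-m) 0)
  rw [phaseCoeff, posCoeff, neg_zero]
  refine Eq.trans ?_ h.symm
  refine integral_congr_ae (Filter.Eventually.of_forall fun x => ?_)
  simp only [fourier_zero, mul_one]
  rw [integral_const_mul, ← integral_complex_ofReal]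

lemma posCoeff_potential {γ σc : ℝ} {f : L2Phase} {c : L2Pos} {D : Fin 2 → L2Pos}
    {K : Fin 2 → Fin 2 → L2Pos} (h : IsPotential γ σc f c D K) (m : Fin 2 → ℤ) :
    (ellSymbol γ σc m : ℂ) * posCoeff c m = phaseCoeff f m 0 := by
  rw [← posCoeff_ell h.1, ← posCoeff_massDensity]
  refine integral_congr_ae ?_
  filter_upwards [h.2, coeFn_ell γ σc c (K 0 0) (K 1 1)] with x h1 h2
  rw [h2, h1]

/-! ### The symbol of the linearized operator -/

/-- The wave vector as a complex number. -/
def omega (m : Fin 2 → ℤ) : ℂ := m 0 + m 1 * Complex.I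

/-- The squared length of a wave vector. -/
def waveSq (m : Fin 2 → ℤ) : ℝ := (m 0 : ℝ) ^ 2 + (m 1 : ℝ) ^ 2

/-- The coefficient of the skew part of the transport operator on a mode. -/
def transportCoef (lam : ℝ) (m : Fin 2 → ℤ) : ℂ := Real.pi * lam * Complex.I * conj (omega m)

/-- The angular Fourier coefficients of `∂_θ B_ℓ / 2π`. -/
def turnCoeff (γ σc τ : ℝ) (m : Fin 2 → ℤ) (n : ℤ) : ℂ :=
  ((if n = 1 then -(Real.pi * Complex.I * conj (omega m)) else 0)
    + (if n = -1 then -(Real.pi * Complex.I * omega m) else 0)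
    + (if n = 2 then 2 * Real.pi ^ 2 * τ * conj (omega m) ^ 2 else 0)
    + (if n = -2 then 2 * Real.pi ^ 2 * τ * omega m ^ 2 else 0)) / ellSymbol γ σc m

/-- The operator `-σ_x Δ_x - σ_θ ∂_θθ + λ v_θ · ∇_x` on a mode. -/
def modeOp (σx σθ lam : ℝ) (m : Fin 2 → ℤ) : (ℤ → ℂ) → ℤ → ℂ :=
  diagSkew (modeDiag σx σθ (waveSq m)) (transportCoef lam m)

lemma conj_omega (m : Fin 2 → ℤ) : conj (omega m) = m 0 - m 1 * Complex.I := by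
  simp [omega, sub_eq_add_neg]

lemma omega_mul_conj (m : Fin 2 → ℤ) : omega m * conj (omega m) = waveSq m := by
  rw [conj_omega, omega, waveSq]
  push_cast
  linear_combination (-(m 1 : ℂ) ^ 2) * Complex.I_sq


end AntModel
end

/-! ### The linearized operator on each wave vector: coercive part plus rank one -/

noncomputable section
namespace AntModel
open MeasureTheory Submodule Matrix
open scoped ComplexConjugate

/-- The trigonometric polynomial `∂_θ B_ℓ / 2π` in terms of the real trigonometric functions. -/
lemma turnCoeff_eq (γ σc τ : ℝ) (m : Fin 2 → ℤ) (n : ℤ) :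
    2 * Real.pi * turnCoeff γ σc τ m n = (-(2 * Real.pi * Complex.I)
        * (m 0 * angCoeff (fun θ => (cosA θ : ℂ)) n + m 1 * angCoeff (fun θ => (sinA θ : ℂ)) n)
      + 4 * Real.pi ^ 2 * τ
        * ((m 0 ^ 2 - m 1 ^ 2) * angCoeff (fun θ => ((cosA θ ^ 2 - sinA θ ^ 2 : ℝ) : ℂ)) n
          + 2 * m 0 * m 1 * angCoeff (fun θ => ((2 * sinA θ * cosA θ : ℝ) : ℂ)) n))
      / ellSymbol γ σc m := by
  rw [angCoeff_cosA, angCoeff_sinA, angCoeff_cosA_sq_sub, angCoeff_two_sinA_mul_cosA, turnCoeff,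
    conj_omega, omega, ← mul_div_assoc]
  congr 1
  by_cases h1 : n = 1
  · subst h1; norm_num; ring
  by_cases h2 : n = -1
  · subst h2; norm_num; ring
  by_cases h3 : n = 2
  · subst h3; norm_num
    linear_combination (4 * Real.pi ^ 3 * τ * (m 1 : ℂ) ^ 2) * Complex.I_sq
  by_cases h4 : n = -2
  · subst h4; norm_num
    linear_combination (4 * Real.pi ^ 3 * τ * (m 1 : ℂ) ^ 2) * Complex.I_sq
  simp [h1, h2, h3, h4]

/-- Transport shifts the angular index by ±1. The potential depends on f only through its integral
over θ, so the chemotactic term is a fixed sequence times the coefficient at n = 0: a rank one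
perturbation on each wave vector. -/
lemma phaseCoeff_linExpr {σx σθ lam γ σc τ χ : ℝ} (hγ : 0 < γ) (hσc : 0 < σc) {f : L2Phase}
    {c : L2Pos} {G : Fin 3 → L2Phase}
    {H : Fin 3 → Fin 3 → L2Phase} {D : Fin 2 → L2Pos} {K : Fin 2 → Fin 2 → L2Pos}
    (h : HasPhaseDerivs f G H) (h' : IsPotential γ σc f c D K) (m : Fin 2 → ℤ) (n : ℤ) :
    phaseCoeff (linExpr σx σθ lam τ χ G H D K) m n
      = -modeOp σx σθ lam m (phaseCoeff f m) n
        - χ * turnCoeff γ σc τ m n * phaseCoeff f m 0 := by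
  have hadd : ∀ (F F' : Phase → ℝ) (a a' : ℂ), (Integrable F ∧ phaseCoeff F m n = a) →
      (Integrable F' ∧ phaseCoeff F' m n = a') →
      (Integrable (fun p => F p + F' p) ∧ phaseCoeff (fun p => F p + F' p) m n = a + a') :=
    fun F F' a a' hF hF' =>
      ⟨hF.1.add hF'.1, by rw [phaseCoeff_fun_add hF.1 hF'.1, hF.2, hF'.2]⟩
  have hsmul : ∀ (t : ℝ) (F : Phase → ℝ) (a : ℂ), (Integrable F ∧ phaseCoeff F m n = a) →
      (Integrable (fun p => t * F p) ∧ phaseCoeff (fun p => t * F p) m n = t * a) :=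
    fun t F a hF => ⟨hF.1.const_mul t, by rw [phaseCoeff_fun_const_mul, hF.2]⟩
  have hH : ∀ i j, Integrable (H i j) ∧ phaseCoeff (H i j) m n
      = phaseSymbol m n j * (phaseSymbol m n i * phaseCoeff f m n) := fun i j =>
    ⟨integrable_L2Phase _, by rw [h.2 i j, h.1 i]⟩
  have hc0 : Integrable (fun p : Phase => cosA p.2 * G 0 p) ∧
      phaseCoeff (fun p => cosA p.2 * G 0 p) m n = 2 * Real.pi * Complex.I * m 0
        * (phaseCoeff f m (n - 1) + phaseCoeff f m (n + 1)) / 2 :=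
    ⟨(memLp_bdd_mul continuous_cosA (Lp.memLp _)).integrable (by norm_num), by
      rw [phaseCoeff_cosA_mul (integrable_L2Phase _), h.1 0, h.1 0]; simp [phaseSymbol]; ring⟩
  have hs1 : Integrable (fun p : Phase => sinA p.2 * G 1 p) ∧
      phaseCoeff (fun p => sinA p.2 * G 1 p) m n = 2 * Real.pi * m 1
        * (phaseCoeff f m (n - 1) - phaseCoeff f m (n + 1)) / 2 :=
    ⟨(memLp_bdd_mul continuous_sinA (Lp.memLp _)).integrable (by norm_num), by
      rw [phaseCoeff_sinA_mul (integrable_L2Phase _), h.1 1, h.1 1]; simp [phaseSymbol]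
      linear_combination (-(2 * Real.pi * m 1
        * (phaseCoeff f m (n - 1) - phaseCoeff f m (n + 1))) : ℂ) * Complex.I_sq⟩
  have hpos : ∀ (a : Ang → ℝ) (_ : Continuous a) (w : L2Pos),
      Integrable (fun p : Phase => a p.2 * w p.1) ∧ phaseCoeff (fun p => a p.2 * w p.1) m n
        = posCoeff w m * angCoeff (fun θ => (a θ : ℂ)) n :=
    fun a ha w => ⟨(memLp_bdd_mul ha ((Lp.memLp w).comp_fst volume)).integrable (by norm_num),
      phaseCoeff_angle_mul a w m n⟩
  have hcc := continuous_cosA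
  have hsc := continuous_sinA
  have c2 : Continuous fun θ => cosA θ ^ 2 - sinA θ ^ 2 := by fun_prop
  have s2 : Continuous fun θ => 2 * sinA θ * cosA θ := by fun_prop
  -- Integrability and coefficient are carried together through the linear structure of `linExpr`;
  -- the resulting value is what `hcongr` leaves to unification.
  have hall := hadd _ _ _ _ (hadd _ _ _ _ (hadd _ _ _ _ (hsmul σx _ _ (hadd _ _ _ _ (hH 0 0) (hH 1 1)))
    (hsmul σθ _ _ (hH 2 2))) (hsmul (-lam) _ _ (hadd _ _ _ _ hc0 hs1)))
    (hsmul (-(χ / (2 * Real.pi))) _ _ (hadd _ _ _ _ (hsmul (-1) _ _ (hadd _ _ _ _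
      (hpos _ hcc (D 0)) (hpos _ hsc (D 1))))
      (hsmul (-τ) _ _ (hadd _ _ _ _ (hadd _ _ _ _
        (hpos _ c2 (K 0 0)) (hsmul (-1) _ _ (hpos _ c2 (K 1 1))))
        (hadd _ _ _ _ (hpos _ s2 (K 0 1)) (hpos _ s2 (K 1 0)))))))
  have hcongr : phaseCoeff (linExpr σx σθ lam τ χ G H D K) m n = _ := Eq.trans (by
    congr 1
    ext p
    simp only [linExpr, angleDeriv_turning, Matrix.of_apply, dotProduct, Fin.sum_univ_two, dir,
      Matrix.cons_val_zero, Matrix.cons_val_one]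
    ring) hall.2
  rw [hcongr]
  have hE : (ellSymbol γ σc m : ℂ) ≠ 0 := Complex.ofReal_ne_zero.mpr (ellSymbol_pos hγ hσc m).ne'
  have hπ : (Real.pi : ℂ) ≠ 0 := Complex.ofReal_ne_zero.mpr Real.pi_ne_zero
  have hpc : posCoeff c m = phaseCoeff f m 0 / ellSymbol γ σc m := by
    rw [eq_div_iff hE, mul_comm]; exact posCoeff_potential h' m
  have ht := turnCoeff_eq γ σc τ m n
  rw [h'.1.1 0, h'.1.1 1, h'.1.2 0 0, h'.1.2 0 1, h'.1.2 1 0, h'.1.2 1 1, h'.1.1 0, h'.1.1 1, hpc]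
  have ht' : turnCoeff γ σc τ m n = (2 * Real.pi : ℂ)⁻¹ * (2 * Real.pi * turnCoeff γ σc τ m n) := by
    field_simp
  rw [ht', ht]
  simp only [modeOp, diagSkew, skewShift, transportCoef, map_mul, Complex.conj_I,
    Complex.conj_ofReal, Complex.conj_conj]
  rw [conj_omega]
  simp only [omega, modeDiag, waveSq, phaseSymbol, Matrix.cons_val_zero, Matrix.cons_val_one,
    Matrix.cons_val]
  generalize angCoeff (fun θ => (cosA θ : ℂ)) n = C1
  generalize angCoeff (fun θ => (sinA θ : ℂ)) n = S1
  generalize angCoeff (fun θ => ((cosA θ ^ 2 - sinA θ ^ 2 : ℝ) : ℂ)) n = C2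
  generalize angCoeff (fun θ => ((2 * sinA θ * cosA θ : ℝ) : ℂ)) n = S2
  generalize phaseCoeff f m n = y
  generalize phaseCoeff f m (n - 1) = y1
  generalize phaseCoeff f m (n + 1) = y2
  generalize phaseCoeff f m 0 = y0
  push_cast
  field_simp
  ring_nf
  simp only [Complex.I_sq]
  ring

lemma phaseCoeff_linOp {σx σθ lam γ σc τ χ : ℝ} (hγ : 0 < γ) (hσc : 0 < σc) (f : H20)
    (m : Fin 2 → ℤ) (n : ℤ) :
    phaseCoeff (linOp σx σθ lam τ χ hγ hσc f : L20) m n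
      = -modeOp σx σθ lam m (phaseCoeff (f : L20) m) n
        - χ * turnCoeff γ σc τ m n * phaseCoeff (f : L20) m 0 := by
  obtain ⟨G, H, c, D, K, h1, h2, h3⟩ := linOp_spec σx σθ lam τ χ hγ hσc f
  rw [phaseCoeff_congr h3, phaseCoeff_linExpr hγ hσc h1 h2]

/-! ## The radial reduction of a mode -/

lemma waveSq_pos {m : Fin 2 → ℤ} (hm : m ≠ 0) : 0 < waveSq m := by
  unfold waveSq
  by_contra h
  push Not at h
  have h0 : (m 0 : ℝ) = 0 := by nlinarith [sq_nonneg (m 0 : ℝ), sq_nonneg (m 1 : ℝ)]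
  have h1 : (m 1 : ℝ) = 0 := by nlinarith [sq_nonneg (m 0 : ℝ), sq_nonneg (m 1 : ℝ)]
  refine hm (funext fun i => ?_)
  fin_cases i
  · exact_mod_cast h0
  · exact_mod_cast h1

lemma one_le_waveSq {m : Fin 2 → ℤ} (hm : m ≠ 0) : 1 ≤ waveSq m := by
  have h := waveSq_pos hm
  have e : waveSq m = ((m 0 ^ 2 + m 1 ^ 2 : ℤ) : ℝ) := by unfold waveSq; push_cast; ring
  rw [e] at h ⊢
  exact_mod_cast Int.add_one_le_iff.mpr (show 0 < m 0 ^ 2 + m 1 ^ 2 by exact_mod_cast h)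

lemma sqSum_turnCoeff (γ σc τ : ℝ) (m : Fin 2 → ℤ) : SqSum (turnCoeff γ σc τ m) :=
  SqSum.of_finite ((Set.toFinite {1, -1, 2, -2}).subset fun n hn => by
    by_contra h
    simp only [Set.mem_insert_iff, Set.mem_singleton_iff, not_or] at h
    simp [turnCoeff, h.1, h.2.1, h.2.2.1, h.2.2.2] at hn)

/-- The mode `U^ℓ / 2π` in angular Fourier coefficients. -/
def kernelMode (σx lam γ σc τ σθ : ℝ) (m : Fin 2 → ℤ) : ℤ → ℂ :=
  modeSol (modeDiag σx σθ (waveSq m)) (transportCoef lam m) fun n => -turnCoeff γ σc τ m n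

section
variable {σx lam γ σc τ σθ : ℝ} {m : Fin 2 → ℤ}

lemma modeOp_coercive (hσx : 0 < σx) (hσθ : 0 ≤ σθ) (hm : m ≠ 0) :
    0 < 4 * Real.pi ^ 2 * σx * waveSq m ∧
      ∀ n, 4 * Real.pi ^ 2 * σx * waveSq m ≤ modeDiag σx σθ (waveSq m) n := by
  have := waveSq_pos hm
  exact ⟨by positivity, fun n => le_modeDiag hσθ _ n⟩

lemma kernelMode_spec (hσx : 0 < σx) (hσθ : 0 ≤ σθ) (hm : m ≠ 0) :
    SqSum (kernelMode σx lam γ σc τ σθ m) ∧ ∀ n,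
      modeOp σx σθ lam m (kernelMode σx lam γ σc τ σθ m) n = -turnCoeff γ σc τ m n :=
  modeSol_spec (modeOp_coercive hσx hσθ hm).1 (modeOp_coercive hσx hσθ hm).2 _
    (sqSum_turnCoeff γ σc τ m).neg

/-- The mass of `U^ℓ` depends only on the length of `ℓ`. -/
lemma kernelMode_zero (hσx : 0 < σx) (hσθ : 0 ≤ σθ) (hm : m ≠ 0) :
    kernelMode σx lam γ σc τ σθ m 0 = radialMass σx lam γ σc τ σθ (√(waveSq m)) := by
  have hN := waveSq_pos hm
  set r := √(waveSq m) with hr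
  have hr0 : 0 < r := Real.sqrt_pos.mpr hN
  have hr2 : r ^ 2 = waveSq m := Real.sq_sqrt hN.le
  obtain ⟨h1, h2⟩ := radialSol_spec (σx := σx) (lam := lam) (γ := γ) (σc := σc) (τ := τ)
    (σθ := σθ) (r := r) hσx hσθ hr0
  have hrc : (r : ℂ) ≠ 0 := Complex.ofReal_ne_zero.mpr hr0.ne'
  have hww : omega m * conj (omega m) = (r : ℂ) ^ 2 := by
    rw [omega_mul_conj, ← hr2]; push_cast; ring
  -- The unimodular z rotates the frame to the direction of the wave vector. Conjugating by x n ↦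
  -- z^n x n makes both shift coefficients equal to the real number πλr and turns the radial source
  -- into -`turnCoeff`.
  set z : ℂ := Complex.I * conj (omega m) / r with hz
  have hz0 : z ≠ 0 := by
    rw [hz]
    refine div_ne_zero (mul_ne_zero Complex.I_ne_zero fun h => ?_) hrc
    rw [h, mul_zero] at hww
    exact pow_ne_zero 2 hrc hww.symm
  have hzi : z * (-Complex.I * omega m / r) = 1 := by
    rw [hz]
    field_simp
    linear_combination hww - omega m * conj (omega m) * Complex.I_sq
  have hzinv : z⁻¹ = -Complex.I * omega m / r := inv_eq_of_mul_eq_one_right hzi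
  have hznorm : ‖z‖ = 1 := by
    have h : ‖omega m‖ ^ 2 = r ^ 2 := by
      have := congrArg norm hww
      rw [norm_mul, RCLike.norm_conj, norm_pow, Complex.norm_real, Real.norm_of_nonneg hr0.le] at this
      rw [← this]; ring
    have h' : ‖omega m‖ = r := by
      rwa [sq_eq_sq₀ (norm_nonneg _) hr0.le] at h
    rw [hz, norm_div, norm_mul, RCLike.norm_conj, h', Complex.norm_I, one_mul, Complex.norm_real,
      Real.norm_of_nonneg hr0.le, div_self hr0.ne']
  have hx : SqSum fun n => z ^ n * radialSol σx lam γ σc τ σθ r n :=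
    h1.of_le 1 fun n => by rw [norm_mul, norm_zpow, hznorm, _root_.one_zpow]
  have hE : ellRadial γ σc r = ellSymbol γ σc m := by
    rw [ellRadial, ellSymbol, hr2, waveSq]
  have heq : ∀ n, modeOp σx σθ lam m (fun n => z ^ n * radialSol σx lam γ σc τ σθ r n) n
      = -turnCoeff γ σc τ m n := by
    intro n
    have hn : z ^ n * (parityExt (radialSource γ σc τ r) n : ℂ) = -turnCoeff γ σc τ m n := by
      have hsrc : ∀ k : ℕ, radialSource γ σc τ r k = ((if k = 1 then Real.pi * r else 0)
        + if k = 2 then 2 * Real.pi ^ 2 * τ * r ^ 2 else 0) / ellSymbol γ σc m := fun k => by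
        rw [radialSource, hE]
        split_ifs <;> ring
      rw [turnCoeff, ← neg_div]
      by_cases g1 : n = 1
      · subst g1
        rw [show (1 : ℤ) = ((1 : ℕ) : ℤ) from rfl, parityExt_natCast, hsrc]
        norm_num
        rw [hz]; field_simp
      by_cases g2 : n = -1
      · subst g2
        rw [show (-1 : ℤ) = -((1 : ℕ) : ℤ) from rfl, parityExt_neg, hsrc]
        norm_num
        rw [hzinv]; field_simp
      by_cases g3 : n = 2
      · subst g3
        rw [show (2 : ℤ) = ((2 : ℕ) : ℤ) from rfl, parityExt_natCast, hsrc]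
        norm_num
        rw [show z ^ 2 * (2 * Real.pi ^ 2 * τ * r ^ 2 / ellSymbol γ σc m)
          = (z * r) ^ 2 * (2 * Real.pi ^ 2 * τ) / ellSymbol γ σc m by ring,
          show z * r = Complex.I * conj (omega m) by rw [hz]; field_simp]
        rw [mul_pow, Complex.I_sq]; ring
      by_cases g4 : n = -2
      · subst g4
        rw [show (-2 : ℤ) = -((2 : ℕ) : ℤ) from rfl, parityExt_neg, hsrc]
        norm_num
        rw [show (z ^ 2)⁻¹ * (2 * Real.pi ^ 2 * τ * r ^ 2 / ellSymbol γ σc m)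
          = (z⁻¹ * r) ^ 2 * (2 * Real.pi ^ 2 * τ) / ellSymbol γ σc m by ring,
          show z⁻¹ * r = -Complex.I * omega m by rw [hzinv]; field_simp]
        rw [mul_pow, neg_sq, Complex.I_sq]; ring
      have hp0 : parityExt (radialSource γ σc τ r) n = 0 := by
        obtain ⟨k, rfl | rfl⟩ := n.eq_nat_or_neg
        · have k1 : k ≠ 1 := by rintro rfl; exact g1 rfl
          have k2 : k ≠ 2 := by rintro rfl; exact g3 rfl
          simp [parityExt_natCast, radialSource, k1, k2]
        · have k1 : k ≠ 1 := by rintro rfl; exact g2 rfl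
          have k2 : k ≠ 2 := by rintro rfl; exact g4 rfl
          simp [parityExt_neg, radialSource, k1, k2]
      simp [hp0, g1, g2, g3, g4]
    rw [← hn, ← h2]
    have hs1 : transportCoef lam m * z⁻¹ = ((Real.pi * lam * r : ℝ) : ℂ) := by
      rw [transportCoef, hzinv]
      push_cast
      field_simp
      linear_combination lam * ((-Complex.I ^ 2) * hww - (r : ℂ) ^ 2 * Complex.I_sq)
    have hs2 : conj (transportCoef lam m) * z = ((Real.pi * lam * r : ℝ) : ℂ) := by
      rw [transportCoef, hz]
      simp only [map_mul, Complex.conj_ofReal, Complex.conj_I, Complex.conj_conj]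
      push_cast
      field_simp
      linear_combination lam * ((-Complex.I ^ 2) * hww - (r : ℂ) ^ 2 * Complex.I_sq)
    simp only [modeOp, diagSkew, skewShift, zpow_sub_one₀ hz0, zpow_add_one₀ hz0, hr2,
      Complex.conj_ofReal]
    linear_combination (z ^ n * radialSol σx lam γ σc τ σθ r (n - 1)) * hs1
      - (z ^ n * radialSol σx lam γ σc τ σθ r (n + 1)) * hs2
  have := congrFun (eq_modeSol (modeOp_coercive hσx hσθ hm).1 (modeOp_coercive hσx hσθ hm).2
    (sqSum_turnCoeff γ σc τ m).neg hx heq) 0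
  rw [kernelMode, ← this]
  simp only [zpow_zero, one_mul, radialSol_zero hσx hσθ hr0]

end
end AntModel
end

noncomputable section
namespace AntModel
open MeasureTheory Submodule Matrix
open scoped ComplexConjugate

/-! ## The diffusive transport operator is a bijection -/

lemma mem_L20_iff (f : L2Phase) : f ∈ L20 ↔ phaseCoeff f 0 0 = 0 := by
  rw [mem_L20, ← integral_L2Phase, Complex.ofReal_eq_zero]

lemma phaseCoeff_L20 (f : L20) : phaseCoeff (f : L2Phase) 0 0 = 0 := (mem_L20_iff _).mp f.2

lemma sqSum_phaseCoeff_slice (f : L2Phase) (m : Fin 2 → ℤ) : SqSum (phaseCoeff f m) :=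
  (sqSum_phaseCoeff f).comp (e := fun n => (m, n)) fun _ _ h => (Prod.ext_iff.mp h).2

/-- The squared length of a frequency. -/
def freqSq (m : Fin 2 → ℤ) (n : ℤ) : ℝ := waveSq m + (n : ℝ) ^ 2

lemma freqSq_eq (m : Fin 2 → ℤ) (n : ℤ) :
    freqSq m n = ((m 0 ^ 2 + m 1 ^ 2 + n ^ 2 : ℤ) : ℝ) := by
  unfold freqSq waveSq; push_cast; ring

lemma freqSq_nonneg (m : Fin 2 → ℤ) (n : ℤ) : 0 ≤ freqSq m n := by
  unfold freqSq waveSq; positivity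

lemma freqSq_eq_zero_or_one_le (m : Fin 2 → ℤ) (n : ℤ) : freqSq m n = 0 ∨ 1 ≤ freqSq m n := by
  rw [freqSq_eq]
  rcases (show 0 ≤ m 0 ^ 2 + m 1 ^ 2 + n ^ 2 by positivity).eq_or_lt with h | h
  · left; rw [← h]; simp
  · right; exact_mod_cast h

lemma eq_zero_of_freqSq_eq_zero {m : Fin 2 → ℤ} {n : ℤ} (h : freqSq m n = 0) : m = 0 ∧ n = 0 := by
  by_cases hm : m = 0
  · subst hm
    refine ⟨rfl, ?_⟩
    simpa [freqSq, waveSq] using h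
  · have := one_le_waveSq hm
    unfold freqSq at h
    nlinarith [sq_nonneg (n : ℝ)]

/-! ### Symbol bounds and membership in H²₀ -/

lemma norm_phaseSymbol_sq_le (m : Fin 2 → ℤ) (n : ℤ) (j : Fin 3) :
    ‖phaseSymbol m n j‖ ^ 2 ≤ (2 * Real.pi) ^ 2 * freqSq m n := by
  have hπ : 1 ≤ (2 * Real.pi) ^ 2 := by nlinarith [Real.pi_gt_three]
  have e : ∀ a : ℤ, ‖(2 * Real.pi * Complex.I * a : ℂ)‖ ^ 2 = (2 * Real.pi) ^ 2 * (a : ℝ) ^ 2 :=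
    fun a => by simp [mul_pow, abs_of_pos Real.pi_pos]
  fin_cases j
  · simp only [phaseSymbol, Fin.zero_eta, Matrix.cons_val_zero]
    rw [e, freqSq, waveSq]
    gcongr
    nlinarith [sq_nonneg (m 1 : ℝ), sq_nonneg (n : ℝ)]
  · simp only [phaseSymbol, Fin.mk_one, Matrix.cons_val_one, Matrix.cons_val_zero]
    rw [e, freqSq, waveSq]
    gcongr
    nlinarith [sq_nonneg (m 0 : ℝ), sq_nonneg (n : ℝ)]
  · simp only [phaseSymbol, Fin.reduceFinMk, Matrix.cons_val]
    rw [norm_mul, Complex.norm_I, one_mul, Complex.norm_intCast, sq_abs, freqSq, waveSq]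
    nlinarith [sq_nonneg (m 0 : ℝ), sq_nonneg (m 1 : ℝ), sq_nonneg (n : ℝ)]

lemma norm_phaseSymbol_mul_le (m : Fin 2 → ℤ) (n : ℤ) (i j : Fin 3) :
    ‖phaseSymbol m n j * phaseSymbol m n i‖ ≤ (2 * Real.pi) ^ 2 * freqSq m n := by
  have hi := norm_phaseSymbol_sq_le m n i
  have hj := norm_phaseSymbol_sq_le m n j
  rw [norm_mul]
  nlinarith [sq_nonneg (‖phaseSymbol m n j‖ - ‖phaseSymbol m n i‖)]

/-- `freqSq` takes integer values, hence is at most its own square; first derivatives are thus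
controlled like second ones. -/
lemma norm_phaseSymbol_le (m : Fin 2 → ℤ) (n : ℤ) (j : Fin 3) :
    ‖phaseSymbol m n j‖ ≤ 2 * Real.pi * freqSq m n := by
  have h := norm_phaseSymbol_sq_le m n j
  have h2 : freqSq m n ≤ freqSq m n ^ 2 := by
    rcases freqSq_eq_zero_or_one_le m n with h | h
    · rw [h]; norm_num
    · nlinarith
  have := freqSq_nonneg m n
  have := Real.pi_pos
  refine le_of_sq_le_sq (h.trans ?_) (by positivity)
  rw [mul_pow _ (freqSq m n)]
  gcongr

lemma phaseSymbol_neg (m : Fin 2 → ℤ) (n : ℤ) (j : Fin 3) :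
    phaseSymbol (-m) (-n) j = conj (phaseSymbol m n j) := by
  fin_cases j <;> simp [phaseSymbol, Complex.conj_ofNat]

/-- All symbols of order one and two are bounded by a constant times `freqSq`, and their conjugation
symmetry keeps the derivatives real. -/
lemma mem_H20_of_sqSum {f : L20}
    (h : SqSum fun q : (Fin 2 → ℤ) × ℤ => (freqSq q.1 q.2 : ℂ) * phaseCoeff (f : L2Phase) q.1 q.2) :
    f ∈ H20 := by
  have hn : ∀ q : (Fin 2 → ℤ) × ℤ, ‖(freqSq q.1 q.2 : ℂ) * phaseCoeff (f : L2Phase) q.1 q.2‖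
      = freqSq q.1 q.2 * ‖phaseCoeff (f : L2Phase) q.1 q.2‖ := fun q => by
    rw [norm_mul, Complex.norm_real, Real.norm_of_nonneg (freqSq_nonneg _ _)]
  have hG : ∀ j, ∃ g : L2Phase, ∀ m n, phaseCoeff g m n
      = phaseSymbol m n j * phaseCoeff (f : L2Phase) m n := fun j => by
    refine exists_phaseCoeff_eq (h.of_le (2 * Real.pi) fun q => ?_) fun m n => ?_
    · rw [norm_mul, hn, ← mul_assoc]
      gcongr
      exact norm_phaseSymbol_le _ _ _
    · rw [phaseSymbol_neg, phaseCoeff_neg_neg, map_mul]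
  have hH : ∀ i j, ∃ g : L2Phase, ∀ m n, phaseCoeff g m n
      = phaseSymbol m n j * phaseSymbol m n i * phaseCoeff (f : L2Phase) m n := fun i j => by
    refine exists_phaseCoeff_eq (h.of_le ((2 * Real.pi) ^ 2) fun q => ?_) fun m n => ?_
    · rw [norm_mul, hn, ← mul_assoc]
      gcongr
      exact norm_phaseSymbol_mul_le _ _ _ _
    · rw [phaseSymbol_neg, phaseSymbol_neg, phaseCoeff_neg_neg, map_mul, map_mul]
  choose G hG using hG
  choose H hH using hH
  exact ⟨G, H, fun j m n => hG j m n, fun i j m n => by rw [hH, hG, mul_assoc]⟩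

/-! ### Solving the transport equation one wave vector at a time -/

section
variable {σx σθ lam : ℝ}

lemma modeDiag_neg_wave (m : Fin 2 → ℤ) : modeDiag σx σθ (waveSq (-m)) = modeDiag σx σθ (waveSq m) := by
  simp [waveSq]

lemma transportCoef_neg (m : Fin 2 → ℤ) : transportCoef lam (-m) = -transportCoef lam m := by
  simp only [transportCoef, conj_omega, Pi.neg_apply]; push_cast; ring

/-- The differential operator is real, so it commutes with complex conjugation of functions, which
acts on coefficients by (m,n) ↦ (-m,-n) and conjugation. -/
lemma modeOp_conj_neg (m : Fin 2 → ℤ) (x : ℤ → ℂ) (n : ℤ) :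
    modeOp σx σθ lam (-m) (fun n => conj (x (-n))) n = conj (modeOp σx σθ lam m x (-n)) := by
  simp only [modeOp, diagSkew, skewShift, modeDiag_neg_wave, transportCoef_neg, map_add, map_sub,
    map_mul, map_neg, Complex.conj_conj, Complex.conj_ofReal]
  rw [show -(n - 1) = -n + 1 by ring, show -(n + 1) = -n - 1 by ring]
  simp only [modeDiag, Int.cast_neg, neg_sq]
  ring

lemma modeOp_zero_apply (x : ℤ → ℂ) (n : ℤ) :
    modeOp σx σθ lam 0 x n = (σθ * (n : ℝ) ^ 2 : ℝ) * x n := by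
  simp [modeOp, diagSkew, skewShift, transportCoef, omega, modeDiag, waveSq]

lemma norm_omega_sq (m : Fin 2 → ℤ) : ‖omega m‖ ^ 2 = waveSq m := by
  have := congrArg norm (omega_mul_conj m)
  rw [norm_mul, RCLike.norm_conj, Complex.norm_real, Real.norm_of_nonneg
    (by unfold waveSq; positivity)] at this
  rw [← this]; ring

lemma norm_transportCoef_sq (m : Fin 2 → ℤ) :
    ‖transportCoef lam m‖ ^ 2 = (Real.pi * lam) ^ 2 * waveSq m := by
  rw [transportCoef, norm_mul, norm_mul, norm_mul, RCLike.norm_conj, Complex.norm_I, mul_one,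
    mul_pow, norm_omega_sq, ← norm_mul, ← Complex.ofReal_mul, Complex.norm_real, Real.norm_eq_abs, sq_abs]

/-- The solution, in Fourier coefficients, of `σ_x Δ f + σ_θ ∂_θθ f - λ v · ∇ f = g`. -/
def transportInv (σx σθ lam : ℝ) (g : (Fin 2 → ℤ) → ℤ → ℂ) (m : Fin 2 → ℤ) (n : ℤ) : ℂ :=
  -- At m = 0 the operator is the multiplication by σ_θ n², not coercive at n = 0. There the
  -- division by zero gives 0, which is the zero average condition.
  if m = 0 then -g 0 n / (σθ * (n : ℝ) ^ 2 : ℝ)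
  else modeSol (modeDiag σx σθ (waveSq m)) (transportCoef lam m) (fun n => -g m n) n

variable (hσx : 0 < σx) (hσθ : 0 < σθ) {g : (Fin 2 → ℤ) → ℤ → ℂ} (hg : ∀ m, SqSum (g m))
include hσx hσθ hg

lemma transportInv_spec {m : Fin 2 → ℤ} (hm : m ≠ 0) :
    SqSum (transportInv σx σθ lam g m) ∧
      ∀ n, modeOp σx σθ lam m (transportInv σx σθ lam g m) n = -g m n := by
  have e : transportInv σx σθ lam g m
      = modeSol (modeDiag σx σθ (waveSq m)) (transportCoef lam m) (fun n => -g m n) := by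
    funext n; simp [transportInv, hm]
  rw [e]
  exact modeSol_spec (modeOp_coercive hσx hσθ.le hm).1 (modeOp_coercive hσx hσθ.le hm).2 _ (hg m).neg

lemma modeOp_transportInv (h0 : g 0 0 = 0) (m : Fin 2 → ℤ) (n : ℤ) :
    modeOp σx σθ lam m (transportInv σx σθ lam g m) n = -g m n := by
  by_cases hm : m = 0
  · subst hm
    rw [modeOp_zero_apply, transportInv, if_pos rfl]
    rcases eq_or_ne n 0 with rfl | hn
    · simp [h0]
    · refine mul_div_cancel₀ _ (Complex.ofReal_ne_zero.mpr ?_)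
      have : (n : ℝ) ≠ 0 := by exact_mod_cast hn
      positivity
  · exact (transportInv_spec hσx hσθ hg hm).2 n

/-- For m ≠ 0 both sides solve the same mode equation, by conjugation symmetry of the data, and the
solution is unique. -/
lemma transportInv_neg (hc : ∀ m n, g (-m) (-n) = conj (g m n)) (m : Fin 2 → ℤ) (n : ℤ) :
    transportInv σx σθ lam g (-m) (-n) = conj (transportInv σx σθ lam g m n) := by
  by_cases hm : m = 0
  · subst hm
    have := hc 0 n
    rw [neg_zero] at this
    simp [transportInv, this]
  · have hm' : -m ≠ 0 := neg_ne_zero.mpr hm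
    obtain ⟨h1, h2⟩ := transportInv_spec (lam := lam) hσx hσθ hg hm
    obtain ⟨h3, h4⟩ := transportInv_spec (lam := lam) hσx hσθ hg hm'
    have h5 : SqSum fun n => conj (transportInv σx σθ lam g m (-n)) := by
      have := h1.comp (e := fun n : ℤ => -n) neg_injective
      simpa [SqSum] using this
    have := congrFun (diagSkew_injective (modeOp_coercive hσx hσθ.le hm').1
      (modeOp_coercive hσx hσθ.le hm').2 (transportCoef lam (-m)) h3 h5 fun n => ?_) (-n)
    · simpa using this
    · change modeOp σx σθ lam (-m) _ n = modeOp σx σθ lam (-m) _ n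
      rw [h4, modeOp_conj_neg, h2, map_neg, ← hc, neg_neg]

/-- The point is a constant independent of m. In the factor ‖μ‖²/d² of `diagSkew_regularity`, ‖μ‖²
grows like |m|² and d² like |m|⁴, and |m| ≥ 1. -/
lemma transportInv_regularity (m : Fin 2 → ℤ) :
    SqSum (fun n => (modeDiag σx σθ (waveSq m) n : ℂ) * transportInv σx σθ lam g m n) ∧
      ∑' n, ‖(modeDiag σx σθ (waveSq m) n : ℂ) * transportInv σx σθ lam g m n‖ ^ 2
        ≤ (2 + 8 * (Real.pi * lam) ^ 2 / (4 * Real.pi ^ 2 * σx) ^ 2) * ∑' n, ‖g m n‖ ^ 2 := by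
  have hπ := Real.pi_pos
  by_cases hm : m = 0
  · subst hm
    have hle : ∀ n, ‖(modeDiag σx σθ (waveSq 0) n : ℂ) * transportInv σx σθ lam g 0 n‖
        ≤ 1 * ‖g 0 n‖ := fun n => by
      have e : modeDiag σx σθ (waveSq 0) n = σθ * (n : ℝ) ^ 2 := by simp [modeDiag, waveSq]
      rw [transportInv, if_pos rfl, one_mul, e]
      rcases eq_or_ne n 0 with rfl | hn
      · simp
      · rw [mul_div_cancel₀ _ (Complex.ofReal_ne_zero.mpr (by
          have : (n : ℝ) ≠ 0 := by exact_mod_cast hn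
          positivity)), norm_neg]
    have hs := (hg 0).of_le 1 hle
    refine ⟨hs, (Summable.tsum_le_tsum (fun n => ?_) hs (hg 0)).trans
      (le_mul_of_one_le_left (tsum_nonneg fun _ => by positivity) ?_)⟩
    · have := hle n
      rw [one_mul] at this
      gcongr
    · have : 0 ≤ 8 * (Real.pi * lam) ^ 2 / (4 * Real.pi ^ 2 * σx) ^ 2 := by positivity
      linarith
  · obtain ⟨h1, h2⟩ := transportInv_spec (lam := lam) hσx hσθ hg hm
    obtain ⟨hd, hD⟩ := modeOp_coercive (m := m) hσx hσθ.le hm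
    have h3 : SqSum (diagSkew (modeDiag σx σθ (waveSq m)) (transportCoef lam m)
        (transportInv σx σθ lam g m)) := by
      have e : diagSkew (modeDiag σx σθ (waveSq m)) (transportCoef lam m)
        (transportInv σx σθ lam g m) = fun n => -g m n := funext h2
      rw [e]; exact (hg m).neg
    obtain ⟨h4, h5⟩ := diagSkew_regularity hd hD _ h1 h3
    refine ⟨h4, h5.trans ?_⟩
    have e : ∀ n, ‖diagSkew (modeDiag σx σθ (waveSq m)) (transportCoef lam m)
        (transportInv σx σθ lam g m) n‖ ^ 2 = ‖g m n‖ ^ 2 := fun n => by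
      rw [show diagSkew (modeDiag σx σθ (waveSq m)) (transportCoef lam m)
        (transportInv σx σθ lam g m) n = -g m n from h2 n, norm_neg]
    simp_rw [e]
    have hN := one_le_waveSq hm
    refine mul_le_mul_of_nonneg_right ?_ (tsum_nonneg fun _ => by positivity)
    rw [norm_transportCoef_sq]
    gcongr 2 + ?_
    rw [div_le_div_iff₀ (by positivity) (by positivity)]
    have : waveSq m ≤ waveSq m ^ 2 := by nlinarith
    calc 8 * ((Real.pi * lam) ^ 2 * waveSq m) * (4 * Real.pi ^ 2 * σx) ^ 2
        ≤ 8 * ((Real.pi * lam) ^ 2 * waveSq m ^ 2) * (4 * Real.pi ^ 2 * σx) ^ 2 := by gcongr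
      _ = _ := by ring

omit hg in
-- The uniform bound on slices can be summed over m, and `modeDiag` dominates a multiple of
-- `freqSq`.
lemma sqSum_freqSq_transportInv (hg : SqSum fun q : (Fin 2 → ℤ) × ℤ => g q.1 q.2) :
    SqSum fun q : (Fin 2 → ℤ) × ℤ => (freqSq q.1 q.2 : ℂ) * transportInv σx σθ lam g q.1 q.2 := by
  have hπ := Real.pi_pos
  have hgm : ∀ m, SqSum (g m) := fun m =>
    hg.comp (e := fun n => (m, n)) fun _ _ h => (Prod.ext_iff.mp h).2
  have hs : SqSum fun q : (Fin 2 → ℤ) × ℤ =>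
      (modeDiag σx σθ (waveSq q.1) q.2 : ℂ) * transportInv σx σθ lam g q.1 q.2 := by
    refine (summable_prod_of_nonneg fun _ => by positivity).mpr
      ⟨fun m => (transportInv_regularity hσx hσθ hgm m).1, ?_⟩
    refine Summable.of_nonneg_of_le (fun m => tsum_nonneg fun _ => by positivity)
      (fun m => (transportInv_regularity hσx hσθ hgm m).2) (Summable.mul_left _ ?_)
    exact ((summable_prod_of_nonneg fun _ => by positivity).mp hg).2
  have hc : 0 < min (4 * Real.pi ^ 2 * σx) σθ := by positivity
  refine hs.of_le (min (4 * Real.pi ^ 2 * σx) σθ)⁻¹ fun q => ?_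
  have hle : min (4 * Real.pi ^ 2 * σx) σθ * freqSq q.1 q.2 ≤ modeDiag σx σθ (waveSq q.1) q.2 := by
    rw [freqSq, modeDiag, mul_add]
    have : 0 ≤ waveSq q.1 := by unfold waveSq; positivity
    gcongr
    · exact min_le_left _ _
    · exact min_le_right _ _
  have h0 := freqSq_nonneg q.1 q.2
  rw [norm_mul, norm_mul, Complex.norm_real, Complex.norm_real, Real.norm_of_nonneg h0,
    Real.norm_of_nonneg ((mul_nonneg hc.le h0).trans hle), ← mul_assoc]
  gcongr
  rw [← div_eq_inv_mul, le_div_iff₀ hc, mul_comm]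
  exact hle

omit hg in
-- The right-hand side is a family of coefficients rather than a function, so that a chemotactic
-- term can later be added to it.
lemma exists_modeOp_eq (lam : ℝ) (hg : SqSum fun q : (Fin 2 → ℤ) × ℤ => g q.1 q.2) (h0 : g 0 0 = 0)
    (hc : ∀ m n, g (-m) (-n) = conj (g m n)) :
    ∃ f : H20, ∀ m n, modeOp σx σθ lam m (phaseCoeff (f : L20) m) n = -g m n := by
  have hgm : ∀ m, SqSum (g m) := fun m =>
    hg.comp (e := fun n => (m, n)) fun _ _ h => (Prod.ext_iff.mp h).2
  have hs := sqSum_freqSq_transportInv (lam := lam) hσx hσθ hg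
  have h00 : transportInv σx σθ lam g 0 0 = 0 := by simp [transportInv]
  obtain ⟨f, hf⟩ := exists_phaseCoeff_eq (a := transportInv σx σθ lam g) (hs.of_le 1 fun q => by
    rw [one_mul, norm_mul, Complex.norm_real, Real.norm_of_nonneg (freqSq_nonneg _ _)]
    rcases freqSq_eq_zero_or_one_le q.1 q.2 with h | h
    · obtain ⟨h1, h2⟩ := eq_zero_of_freqSq_eq_zero h
      rw [h1, h2, h00]; simp
    · exact le_mul_of_one_le_left (norm_nonneg _) h) (transportInv_neg hσx hσθ hgm hc)
  have hfL : f ∈ L20 := by rw [mem_L20_iff, hf, h00]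
  refine ⟨⟨⟨f, hfL⟩, mem_H20_of_sqSum ?_⟩, fun m n => ?_⟩
  · simpa only [hf] using hs
  · have e : phaseCoeff f m = transportInv σx σθ lam g m := funext (hf m)
    change modeOp σx σθ lam m (phaseCoeff f m) n = _
    rw [e, modeOp_transportInv hσx hσθ hgm h0]

end

section
variable {σx σθ lam γ σc τ : ℝ}

lemma eq_of_modeOp_eq (hσx : 0 < σx) (hσθ : 0 < σθ) {f f' : L20}
    (h : ∀ m n, modeOp σx σθ lam m (phaseCoeff (f : L2Phase) m) n
      = modeOp σx σθ lam m (phaseCoeff (f' : L2Phase) m) n) : f = f' := by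
  refine Subtype.ext (phaseCoeff_ext fun m n => ?_)
  by_cases hm : m = 0
  · subst hm
    have hn := h 0 n
    rw [modeOp_zero_apply, modeOp_zero_apply] at hn
    rcases eq_or_ne n 0 with rfl | hn0
    · rw [phaseCoeff_L20, phaseCoeff_L20]
    · refine mul_left_cancel₀ (Complex.ofReal_ne_zero.mpr ?_) hn
      have : (n : ℝ) ≠ 0 := by exact_mod_cast hn0
      positivity
  · exact congrFun (diagSkew_injective (modeOp_coercive hσx hσθ.le hm).1
      (modeOp_coercive hσx hσθ.le hm).2 _ (sqSum_phaseCoeff_slice _ m)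
      (sqSum_phaseCoeff_slice _ m) (h m)) n

lemma modeOp_eq_neg_linOp (hγ : 0 < γ) (hσc : 0 < σc) (f : H20) (m : Fin 2 → ℤ) (n : ℤ) :
    modeOp σx σθ lam m (phaseCoeff (f : L20) m) n
      = -phaseCoeff (linOp σx σθ lam τ 0 hγ hσc f : L20) m n := by
  rw [phaseCoeff_linOp]; simp

lemma sqSum_modeOp (f : H20) (m : Fin 2 → ℤ) :
    SqSum (modeOp σx σθ lam m (phaseCoeff (f : L20) m)) := by
  -- At χ = 0 the operator does not see γ, σ_c and τ, so arbitrary values of these serve.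
  have e : modeOp σx σθ lam m (phaseCoeff (f : L20) m) = fun n =>
      -phaseCoeff (linOp σx σθ lam 0 0 one_pos one_pos f : L20) m n :=
    funext (modeOp_eq_neg_linOp one_pos one_pos f m)
  rw [e]
  exact (sqSum_phaseCoeff_slice _ m).neg

lemma exists_transport_preimage (hσx : 0 < σx) (hσθ : 0 < σθ) (lam : ℝ) (g : L20) :
    ∃ f : H20, ∀ m n, modeOp σx σθ lam m (phaseCoeff (f : L20) m) n
      = -phaseCoeff (g : L2Phase) m n :=
  exists_modeOp_eq hσx hσθ lam (sqSum_phaseCoeff (g : L2Phase)) (phaseCoeff_L20 g)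
    fun m n => phaseCoeff_neg_neg _ m n

end
end AntModel
end

noncomputable section
namespace AntModel
open MeasureTheory Submodule Matrix
open scoped ComplexConjugate

/-! ## The resolvent on the circle -/

lemma transportMult_eq (σx lam : ℝ) (ℓ : Fin 2 → ℤ) (θ : Ang) :
    transportMult σx lam ℓ θ = (4 * Real.pi ^ 2 * σx * waveSq ℓ : ℝ)
      + transportCoef lam ℓ * fourier 1 θ - conj (transportCoef lam ℓ) * fourier (-1) θ := by
  have hc := cosA_eq θ
  have hs := sinA_eq θ
  simp only [transportMult, waveVec, dotProduct, Fin.sum_univ_two, dir, Matrix.cons_val_zero,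
    Matrix.cons_val_one, transportCoef, map_mul, Complex.conj_ofReal, Complex.conj_I,
    Complex.conj_conj, waveSq]
  rw [conj_omega, omega]
  push_cast
  rw [hc, hs]
  generalize (fourier 1 θ : ℂ) = z
  generalize (fourier (-1) θ : ℂ) = w
  ring_nf

lemma angCoeff_fourier_mul (k : ℤ) (u : Ang → ℂ) (n : ℤ) :
    angCoeff (fun θ => fourier k θ * u θ) n = angCoeff u (n - k) := by
  rw [angCoeff, angCoeff]
  refine integral_congr_ae (Filter.Eventually.of_forall fun θ => ?_)
  simp only
  rw [show -(n - k) = -n + k by ring, fourier_add]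
  ring

lemma integrable_L2Ang (u : L2Ang) : Integrable (u : Ang → ℂ) :=
  (Lp.memLp u).integrable (by norm_num)

lemma angCoeff_resolventExpr (σx lam σθ : ℝ) (ℓ : Fin 2 → ℤ) (u w : L2Ang) (n : ℤ) :
    angCoeff (fun θ => -transportMult σx lam ℓ θ * u θ + σθ * w θ) n
      = -((4 * Real.pi ^ 2 * σx * waveSq ℓ : ℝ) * angCoeff u n
        + skewShift (transportCoef lam ℓ) (angCoeff u) n) + σθ * angCoeff w n := by
  have hu := integrable_L2Ang u
  have hw := integrable_L2Ang w
  have e : (fun θ => -transportMult σx lam ℓ θ * u θ + σθ * w θ) = fun θ =>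
      ((-(4 * Real.pi ^ 2 * σx * waveSq ℓ : ℝ) : ℂ) * u θ
        + (-transportCoef lam ℓ * (fourier 1 θ * u θ)
          + conj (transportCoef lam ℓ) * (fourier (-1) θ * u θ))) + σθ * w θ := by
    funext θ; rw [transportMult_eq]; ring
  have h1 := (integrable_fourier_mul hu 1).const_mul (-transportCoef lam ℓ)
  have h2 := (integrable_fourier_mul hu (-1)).const_mul (conj (transportCoef lam ℓ))
  have h0 := hu.const_mul (-(4 * Real.pi ^ 2 * σx * waveSq ℓ : ℝ) : ℂ)
  have h12 : Integrable fun θ => -transportCoef lam ℓ * (fourier 1 θ * u θ)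
      + conj (transportCoef lam ℓ) * (fourier (-1) θ * u θ) := h1.add h2
  have h012 : Integrable fun θ => (-(4 * Real.pi ^ 2 * σx * waveSq ℓ : ℝ) : ℂ) * u θ
      + (-transportCoef lam ℓ * (fourier 1 θ * u θ)
      + conj (transportCoef lam ℓ) * (fourier (-1) θ * u θ)) := h0.add h12
  rw [e, angCoeff_add h012 (hw.const_mul _), angCoeff_add h0 h12, angCoeff_add h1 h2,
    angCoeff_const_mul, angCoeff_const_mul, angCoeff_const_mul, angCoeff_const_mul,
    angCoeff_fourier_mul, angCoeff_fourier_mul, skewShift, sub_neg_eq_add]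
  ring

section
variable {σx lam σθ : ℝ} {ℓ : Fin 2 → ℤ} {g : Ang → ℂ} {u : L2Ang}

lemma SolvesResolvent.modeOp_eq (h : SolvesResolvent σx lam σθ ℓ g u) (n : ℤ) :
    modeOp σx σθ lam ℓ (angCoeff u) n = -angCoeff g n := by
  obtain ⟨u₁, u₂, h1, h2, h3⟩ := h
  rw [← angCoeff_congr h3, angCoeff_resolventExpr, h2, h1, modeOp, diagSkew, modeDiag]
  push_cast
  linear_combination (σθ * n ^ 2 * angCoeff u n : ℂ) * Complex.I_sq

/-- Regularity makes n² times the coefficients square summable, which provides the two derivatives;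
the equation then holds almost everywhere because both sides have the same coefficients. -/
lemma solvesResolvent_of_modeOp_eq (hσx : 0 < σx) (hσθ : 0 < σθ) (hℓ : ℓ ≠ 0) (hg : MemLp g 2 volume)
    (h : ∀ n, modeOp σx σθ lam ℓ (angCoeff u) n = -angCoeff g n) :
    SolvesResolvent σx lam σθ ℓ g u := by
  obtain ⟨hd, hD⟩ := modeOp_coercive (m := ℓ) hσx hσθ.le hℓ
  have hgs : SqSum (angCoeff g) := by
    have := sqSum_angCoeff hg.toLp
    have e : angCoeff hg.toLp = angCoeff g := funext (angCoeff_congr hg.coeFn_toLp)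
    rwa [e] at this
  have hs : SqSum (diagSkew (modeDiag σx σθ (waveSq ℓ)) (transportCoef lam ℓ) (angCoeff u)) := by
    have e : diagSkew (modeDiag σx σθ (waveSq ℓ)) (transportCoef lam ℓ) (angCoeff u)
        = fun n => -angCoeff g n := funext h
    rw [e]; exact hgs.neg
  have hDu := (diagSkew_regularity hd hD _ (sqSum_angCoeff u) hs).1
  have hle : ∀ n : ℤ, ((n : ℝ) ^ 2) * ‖angCoeff u n‖
      ≤ σθ⁻¹ * ‖(modeDiag σx σθ (waveSq ℓ) n : ℂ) * angCoeff u n‖ := fun n => by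
    rw [norm_mul, Complex.norm_real, Real.norm_of_nonneg (hd.le.trans (hD n)), ← mul_assoc]
    gcongr
    rw [← div_eq_inv_mul, le_div_iff₀ hσθ, modeDiag]
    linarith
  obtain ⟨u₁, hu₁⟩ := exists_angCoeff_eq (a := fun n => Complex.I * n * angCoeff u n)
    (hDu.of_le σθ⁻¹ fun n => by
      refine le_trans ?_ (hle n)
      rw [norm_mul, norm_mul, Complex.norm_I, one_mul, Complex.norm_intCast]
      gcongr
      rw [← sq_abs]
      rcases eq_or_ne n 0 with rfl | hn
      · simp
      · have : (1 : ℝ) ≤ |(n : ℝ)| := by exact_mod_cast Int.one_le_abs hn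
        nlinarith)
  obtain ⟨u₂, hu₂⟩ := exists_angCoeff_eq (a := fun n => Complex.I * n * (Complex.I * n * angCoeff u n))
    (hDu.of_le σθ⁻¹ fun n => by
      refine le_trans (le_of_eq ?_) (hle n)
      rw [norm_mul, norm_mul, norm_mul, norm_mul, Complex.norm_I, one_mul, Complex.norm_intCast,
        ← sq_abs]
      ring)
  refine ⟨u₁, u₂, hu₁, fun n => by rw [hu₂, hu₁], ?_⟩
  have hcont : Continuous fun θ => transportMult σx lam ℓ θ := by
    simp_rw [transportMult_eq]; fun_prop
  have hmul : MemLp (fun θ => -transportMult σx lam ℓ θ * u θ) 2 volume := by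
    refine (Lp.memLp u).of_le_mul (c := ‖(⟨_, hcont⟩ : C(Ang, ℂ))‖)
      (hcont.neg.aestronglyMeasurable.mul (Lp.aestronglyMeasurable u))
      (Filter.Eventually.of_forall fun θ => ?_)
    rw [norm_mul, norm_neg]
    gcongr
    exact (⟨_, hcont⟩ : C(Ang, ℂ)).norm_coe_le_norm θ
  have hF : MemLp (fun θ => -transportMult σx lam ℓ θ * u θ + σθ * u₂ θ) 2 volume :=
    hmul.add ((Lp.memLp u₂).const_mul _)
  have heq : hF.toLp = hg.toLp := angCoeff_injective fun n => by
    rw [angCoeff_congr hF.coeFn_toLp, angCoeff_congr hg.coeFn_toLp, angCoeff_resolventExpr, hu₂]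
    have := h n
    rw [modeOp, diagSkew, modeDiag] at this
    push_cast at this ⊢
    linear_combination -this + (σθ * n ^ 2 * angCoeff u n : ℂ) * Complex.I_sq
  exact (MemLp.toLp_eq_toLp_iff hF hg).mp heq

/-- Solvability of the mode equation rules out the default branch of `resolvent`. -/
lemma modeOp_resolvent (hσx : 0 < σx) (hσθ : 0 < σθ) (hℓ : ℓ ≠ 0) (hg : MemLp g 2 volume) (n : ℤ) :
    modeOp σx σθ lam ℓ (angCoeff (resolvent σx lam σθ ℓ g)) n = -angCoeff g n := by
  have hgs : SqSum (angCoeff g) := by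
    have := sqSum_angCoeff hg.toLp
    have e : angCoeff hg.toLp = angCoeff g := funext (angCoeff_congr hg.coeFn_toLp)
    rwa [e] at this
  have hex : ∃ u, SolvesResolvent σx lam σθ ℓ g u := by
    obtain ⟨x, hx, hxe⟩ := exists_diagSkew_eq (modeOp_coercive hσx hσθ.le hℓ).1
      (modeOp_coercive hσx hσθ.le hℓ).2 (transportCoef lam ℓ) hgs.neg
    obtain ⟨u, hu⟩ := exists_angCoeff_eq hx
    refine ⟨u, solvesResolvent_of_modeOp_eq hσx hσθ hℓ hg fun n => ?_⟩
    rw [show angCoeff u = x from funext hu]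
    exact hxe n
  rw [resolvent, dif_pos hex]
  exact hex.choose_spec.modeOp_eq n

lemma modeOp_injective (hσx : 0 < σx) (hσθ : 0 < σθ) (hℓ : ℓ ≠ 0) {x y : ℤ → ℂ} (hx : SqSum x)
    (hy : SqSum y) (h : ∀ n, modeOp σx σθ lam ℓ x n = modeOp σx σθ lam ℓ y n) : x = y :=
  diagSkew_injective (modeOp_coercive hσx hσθ.le hℓ).1 (modeOp_coercive hσx hσθ.le hℓ).2 _ hx hy h

/-- Transfers the reality condition from data to solutions: it yields U^{-ℓ} = conj U^ℓ, and
likewise for V. -/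
lemma conj_neg_of_modeOp_eq (hσx : 0 < σx) (hσθ : 0 < σθ) (hℓ : ℓ ≠ 0) {x y : ℤ → ℂ} (hx : SqSum x)
    (hy : SqSum y)
    (h : ∀ n, modeOp σx σθ lam (-ℓ) y n = conj (modeOp σx σθ lam ℓ x (-n))) (n : ℤ) :
    y n = conj (x (-n)) := by
  refine congrFun (modeOp_injective (lam := lam) hσx hσθ (neg_ne_zero.mpr hℓ) hy (y := fun n => conj (x (-n))) ?_
    fun n => ?_) n
  · have := hx.comp (e := fun n : ℤ => -n) neg_injective
    simpa [SqSum] using this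
  · rw [modeOp_conj_neg, h]

end

/-! ## The modes `U` and `V` -/

lemma angleDeriv_turningMult (γ σc τ : ℝ) (ℓ : Fin 2 → ℤ) (θ : Ang) :
    angleDeriv (turningMult γ σc τ ℓ) θ = (-(2 * Real.pi * Complex.I)
        * (ℓ 0 * cosA θ + ℓ 1 * sinA θ)
      + 4 * Real.pi ^ 2 * τ * ((ℓ 0 ^ 2 - ℓ 1 ^ 2) * ((cosA θ ^ 2 - sinA θ ^ 2 : ℝ) : ℂ)
          + 2 * ℓ 0 * ℓ 1 * ((2 * sinA θ * cosA θ : ℝ) : ℂ))) / ellSymbol γ σc ℓ := by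
  have hc := (hasDerivAt_cosA θ).ofReal_comp
  have hs := (hasDerivAt_sinA θ).ofReal_comp
  have hp := (hs.neg.mul_const (ℓ 0 : ℂ)).add (hc.mul_const (ℓ 1 : ℂ))
  have hd := (hc.mul_const (ℓ 0 : ℂ)).add (hs.mul_const (ℓ 1 : ℂ))
  have h := (((hp.const_mul (2 * Real.pi * Complex.I)).sub
    ((hp.mul hd).const_mul (4 * Real.pi ^ 2 * τ : ℂ))).div_const (ellSymbol γ σc ℓ : ℂ))
  rw [angleDeriv]
  convert! h.deriv using 1
  · congr 1
    funext t
    simp only [turningMult, dirPerp, dir, waveVec, dotProduct, Fin.sum_univ_two, Matrix.mulVec,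
      Matrix.vecMulVec_apply, Matrix.cons_val_zero, Matrix.cons_val_one, Pi.add_apply, Pi.mul_apply,
      Pi.sub_apply, Pi.neg_apply]
    push_cast
    congr 1
    ring
  · simp only [Pi.add_apply, Pi.neg_apply, QuotientAddGroup.mk_zero, add_zero]
    push_cast
    congr 1
    ring

lemma continuous_angleDeriv_turningMult (γ σc τ : ℝ) (ℓ : Fin 2 → ℤ) :
    Continuous (angleDeriv (turningMult γ σc τ ℓ)) := by
  have hc := continuous_cosA
  have hs := continuous_sinA
  simp_rw [funext (angleDeriv_turningMult γ σc τ ℓ)]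
  fun_prop

lemma angCoeff_angleDeriv_turningMult (γ σc τ : ℝ) (ℓ : Fin 2 → ℤ) (n : ℤ) :
    angCoeff (angleDeriv (turningMult γ σc τ ℓ)) n = 2 * Real.pi * turnCoeff γ σc τ ℓ n := by
  have hc := continuous_cosA
  have hs := continuous_sinA
  have e : angleDeriv (turningMult γ σc τ ℓ) = fun θ =>
      ((-(2 * Real.pi * Complex.I) * ℓ 0 / ellSymbol γ σc ℓ) * (cosA θ : ℂ)
        + (-(2 * Real.pi * Complex.I) * ℓ 1 / ellSymbol γ σc ℓ) * (sinA θ : ℂ))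
      + ((4 * Real.pi ^ 2 * τ * (ℓ 0 ^ 2 - ℓ 1 ^ 2) / ellSymbol γ σc ℓ)
          * ((cosA θ ^ 2 - sinA θ ^ 2 : ℝ) : ℂ)
        + (4 * Real.pi ^ 2 * τ * (2 * ℓ 0 * ℓ 1) / ellSymbol γ σc ℓ)
          * ((2 * sinA θ * cosA θ : ℝ) : ℂ)) := by
    funext θ
    rw [angleDeriv_turningMult]
    ring
  rw [e, angCoeff_add (integrable_of_continuous_ang (by fun_prop))
    (integrable_of_continuous_ang (by fun_prop)), angCoeff_add
    (integrable_of_continuous_ang (by fun_prop)) (integrable_of_continuous_ang (by fun_prop)),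
    angCoeff_add (integrable_of_continuous_ang (by fun_prop))
    (integrable_of_continuous_ang (by fun_prop)), angCoeff_const_mul, angCoeff_const_mul,
    angCoeff_const_mul, angCoeff_const_mul, turnCoeff_eq]
  ring

lemma turnCoeff_neg (γ σc τ : ℝ) (m : Fin 2 → ℤ) (n : ℤ) :
    turnCoeff γ σc τ (-m) n = conj (turnCoeff γ σc τ m (-n)) := by
  have hE : ellSymbol γ σc (-m) = ellSymbol γ σc m := by simp [ellSymbol]
  have ho : omega (-m) = -omega m := by simp only [omega, Pi.neg_apply]; push_cast; ring
  simp only [turnCoeff, hE, ho, map_div₀, Complex.conj_ofReal, map_add, map_neg, neg_eq_iff_eq_neg,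
    neg_neg, apply_ite conj, map_mul, map_pow, Complex.conj_I, Complex.conj_conj, map_zero,
    map_ofNat, neg_sq]
  congr 1
  by_cases h1 : n = 1
  · subst h1; norm_num
  by_cases h2 : n = -1
  · subst h2; norm_num
  by_cases h3 : n = 2
  · subst h3; norm_num
  by_cases h4 : n = -2
  · subst h4; norm_num
  simp [h1, h2, h3, h4]

section
variable {σx lam γ σc τ σθ : ℝ} {ℓ : Fin 2 → ℤ}

lemma angCoeff_modeU (hσx : 0 < σx) (hσθ : 0 < σθ) (hℓ : ℓ ≠ 0) (n : ℤ) :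
    angCoeff (modeU σx lam γ σc τ σθ ℓ) n = 2 * Real.pi * kernelMode σx lam γ σc τ σθ ℓ n := by
  obtain ⟨h1, h2⟩ := kernelMode_spec (lam := lam) (γ := γ) (σc := σc) (τ := τ) (m := ℓ) hσx hσθ.le hℓ
  have hL : MemLp (angleDeriv (turningMult γ σc τ ℓ)) 2 volume :=
    (continuous_angleDeriv_turningMult γ σc τ ℓ).memLp_of_hasCompactSupport
      (HasCompactSupport.of_compactSpace _)
  refine congrFun (modeOp_injective (lam := lam) hσx hσθ hℓ (sqSum_angCoeff _)
    (h1.const_mul (2 * Real.pi)) fun n => ?_) n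
  rw [modeU, modeOp_resolvent hσx hσθ hℓ hL, angCoeff_angleDeriv_turningMult, modeOp,
    diagSkew_const_mul, ← modeOp, h2]
  ring

/-- V^ℓ represents the functional "integral over θ" for the mode operator at ℓ: `modeOp` at -ℓ is
the adjoint of `modeOp` at ℓ, and the coefficients of the constant 1 are 2π at n = 0 and zero
elsewhere. -/
lemma modeOp_modeV (hσx : 0 < σx) (hσθ : 0 < σθ) (hℓ : ℓ ≠ 0) (n : ℤ) :
    modeOp σx σθ lam (-ℓ) (angCoeff (modeV σx lam σθ ℓ)) n
      = if n = 0 then ((2 * Real.pi : ℝ) : ℂ) else 0 := by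
  have hL : MemLp (fun _ : Ang => (1 : ℂ)) 2 volume := memLp_const 1
  have h := modeOp_resolvent (lam := lam) (σx := σx) hσx hσθ (neg_ne_zero.mpr hℓ) hL n
  have e : angCoeff (modeV σx lam σθ ℓ)
      = fun n => -1 * angCoeff (resolvent σx lam σθ (-ℓ) fun _ => 1) n := by
    funext n
    rw [← angCoeff_const_mul]
    refine angCoeff_congr ?_ n
    filter_upwards [Lp.coeFn_neg (resolvent σx lam σθ (-ℓ) fun _ => 1)] with θ hθ
    rw [modeV, hθ]
    simp
  have h1 : angCoeff (fun _ => (1 : ℂ)) n = if n = 0 then ((2 * Real.pi : ℝ) : ℂ) else 0 := by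
    rw [← angCoeff_fourier 0 n]
    simp
  rw [e, modeOp, diagSkew_const_mul, ← modeOp, h, h1]
  ring

lemma angCoeff_modeU_neg (hσx : 0 < σx) (hσθ : 0 < σθ) (hℓ : ℓ ≠ 0) (n : ℤ) :
    angCoeff (modeU σx lam γ σc τ σθ (-ℓ)) n = conj (angCoeff (modeU σx lam γ σc τ σθ ℓ) (-n)) := by
  rw [angCoeff_modeU hσx hσθ hℓ, angCoeff_modeU hσx hσθ (neg_ne_zero.mpr hℓ)]
  obtain ⟨h1, h2⟩ := kernelMode_spec (lam := lam) (γ := γ) (σc := σc) (τ := τ) (m := ℓ) hσx hσθ.le hℓ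
  obtain ⟨h3, h4⟩ := kernelMode_spec (lam := lam) (γ := γ) (σc := σc) (τ := τ) (m := -ℓ) hσx hσθ.le
    (neg_ne_zero.mpr hℓ)
  rw [conj_neg_of_modeOp_eq hσx hσθ hℓ h1 h3 fun n => by rw [h2, h4, turnCoeff_neg, map_neg]]
  simp [Complex.conj_ofNat]

lemma angCoeff_modeV_neg (hσx : 0 < σx) (hσθ : 0 < σθ) (hℓ : ℓ ≠ 0) (n : ℤ) :
    angCoeff (modeV σx lam σθ (-ℓ)) n = conj (angCoeff (modeV σx lam σθ ℓ) (-n)) := by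
  have hℓ' := neg_ne_zero.mpr hℓ
  refine conj_neg_of_modeOp_eq (lam := lam) hσx hσθ hℓ' (sqSum_angCoeff _) (sqSum_angCoeff _)
    (fun n => ?_) n
  rw [modeOp_modeV hσx hσθ hℓ, modeOp_modeV hσx hσθ hℓ']
  by_cases h : n = 0 <;> simp [h, Complex.conj_ofNat]

/-! ### The real waves -/

lemma integral_wave (ℓ m : Fin 2 → ℤ) (a : L2Ang) (n : ℤ) :
    ∫ p : Phase, UnitAddTorus.mFourier (-m) p.1 * fourier (-n) p.2
      * (UnitAddTorus.mFourier ℓ p.1 * a p.2) = if m = ℓ then angCoeff a n else 0 := by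
  have e : ∀ p : Phase, UnitAddTorus.mFourier (-m) p.1 * fourier (-n) p.2
      * (UnitAddTorus.mFourier ℓ p.1 * a p.2)
      = UnitAddTorus.mFourier (-m + ℓ) p.1 * (fourier (-n) p.2 * a p.2) := fun p => by
    rw [UnitAddTorus.mFourier_add]; ring
  simp_rw [e]
  rw [Measure.volume_eq_prod, integral_prod_mul (fun x => UnitAddTorus.mFourier (-m + ℓ) x)
    (fun θ => fourier (-n) θ * a θ), integral_mFourier]
  simp only [neg_add_eq_zero, ite_mul, one_mul, zero_mul]
  rfl

/-- The hypothesis says b = conj a, so the real part in `realWave` averages two equal expressions.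
-/
lemma phaseCoeff_realWave {a b : L2Ang} (hab : ∀ n, angCoeff b n = conj (angCoeff a (-n)))
    (m : Fin 2 → ℤ) (n : ℤ) :
    phaseCoeff (realWave ℓ a b) m n = (if m = ℓ then angCoeff a n else 0)
      + if m = -ℓ then angCoeff b n else 0 := by
  set Z : Phase → ℂ := fun p => UnitAddTorus.mFourier ℓ p.1 * a p.2
    + UnitAddTorus.mFourier (-ℓ) p.1 * b p.2 with hZ
  have hi1 := (memLp_wave ℓ a).integrable (by norm_num)
  have hi2 := (memLp_wave (-ℓ) b).integrable (by norm_num)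
  have hiZ : Integrable Z := hi1.add hi2
  have hcoef : ∀ m n, ∫ p : Phase, UnitAddTorus.mFourier (-m) p.1 * fourier (-n) p.2 * Z p
      = (if m = ℓ then angCoeff a n else 0) + if m = -ℓ then angCoeff b n else 0 := fun m n => by
    rw [← integral_wave ℓ m a n, ← integral_wave (-ℓ) m b n, ← integral_add
      (integrable_phaseChar_mul hi1 _ _) (integrable_phaseChar_mul hi2 _ _)]
    simp_rw [hZ, mul_add]
  have hi := fun m n => integrable_phaseChar_mul hiZ (-m) (-n)
  have hi' : Integrable fun p : Phase =>
      conj (UnitAddTorus.mFourier (- -m) p.1 * fourier (- -n) p.2 * Z p) :=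
    (hi (-m) (-n)).congr' (by
      exact (Complex.continuous_conj.comp_aestronglyMeasurable (hi (-m) (-n)).1)) (by simp)
  have h2 : phaseCoeff (realWave ℓ a b) m n
      = ((∫ p : Phase, UnitAddTorus.mFourier (-m) p.1 * fourier (-n) p.2 * Z p)
      + ∫ p : Phase, conj (UnitAddTorus.mFourier (- -m) p.1 * fourier (- -n) p.2 * Z p)) / 2 := by
    rw [← integral_add (hi m n) hi', phaseCoeff, ← integral_div]
    refine integral_congr_ae ?_
    filter_upwards [(memLp_realWave ℓ a b).coeFn_toLp] with p hp
    rw [realWave, hp, map_mul, map_mul, ← UnitAddTorus.mFourier_neg, ← fourier_neg, neg_neg, neg_neg,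
      ← mul_add, Complex.add_conj]
    push_cast
    ring
  rw [h2, integral_conj, hcoef, hcoef, map_add, apply_ite conj, apply_ite conj, map_zero, hab,
    hab, neg_neg, Complex.conj_conj]
  simp only [neg_eq_iff_eq_neg]
  ring_nf

lemma angCoeff_smul (c : ℂ) (a : L2Ang) (n : ℤ) :
    angCoeff (c • a : L2Ang) n = c * angCoeff a n := by
  rw [← angCoeff_const_mul]
  refine angCoeff_congr ?_ n
  filter_upwards [Lp.coeFn_smul c a] with θ hθ
  rw [hθ]; rfl

lemma phaseCoeff_realWave_I {a b : L2Ang} (hab : ∀ n, angCoeff b n = conj (angCoeff a (-n)))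
    (m : Fin 2 → ℤ) (n : ℤ) :
    phaseCoeff (realWave ℓ (Complex.I • a) (-Complex.I • b)) m n
      = (if m = ℓ then Complex.I * angCoeff a n else 0)
      + if m = -ℓ then -Complex.I * angCoeff b n else 0 := by
  rw [phaseCoeff_realWave fun n => ?_, angCoeff_smul, angCoeff_smul]
  rw [angCoeff_smul, angCoeff_smul, hab, map_mul, Complex.conj_I]

end
end AntModel
end

noncomputable section
namespace AntModel
open MeasureTheory Submodule Matrix
open scoped ComplexConjugate

/-! ## Duality between the range and the dual modes -/

lemma tsum_conj_neg {a b u v : ℤ → ℂ} (hb : ∀ n, b n = conj (a (-n))) (hv : ∀ n, v n = conj (u (-n))) :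
    ∑' n, conj (b n) * v n = conj (∑' n, conj (a n) * u n) := by
  rw [Complex.conj_tsum, ← (Equiv.neg ℤ).tsum_eq]
  refine tsum_congr fun n => ?_
  simp [hb, hv]

lemma phaseCoeff_conj (g : L2Phase) (m : Fin 2 → ℤ) (n : ℤ) :
    phaseCoeff g (-m) n = conj (phaseCoeff g m (-n)) := by
  rw [← phaseCoeff_neg_neg, neg_neg]

/-- Only ±ℓ contribute to Parseval's sum, with conjugate contributions. They give twice a real part,
and the factor 1/2π becomes 1/π. -/
lemma inner_realWave {ℓ : Fin 2 → ℤ} (hℓ : ℓ ≠ 0) {a b : L2Ang}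
    (hab : ∀ n, angCoeff b n = conj (angCoeff a (-n))) (g : L2Phase) :
    inner ℝ (realWave ℓ a b) g
      = Real.pi⁻¹ * (∑' n, conj (angCoeff a n) * phaseCoeff g ℓ n).re := by
  have hne : ℓ ≠ -ℓ := fun h => hℓ (self_eq_neg.mp h)
  have hs := (sqSum_phaseCoeff (realWave ℓ a b)).conj_mul (sqSum_phaseCoeff g)
  have h : ∀ m, ∑' n, conj (phaseCoeff (realWave ℓ a b) m n) * phaseCoeff g m n
      = if m = ℓ then ∑' n, conj (angCoeff a n) * phaseCoeff g ℓ n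
        else if m = -ℓ then conj (∑' n, conj (angCoeff a n) * phaseCoeff g ℓ n) else 0 := fun m => by
    simp_rw [phaseCoeff_realWave hab]
    by_cases h1 : m = ℓ
    · subst h1; simp [hne]
    by_cases h2 : m = -ℓ
    · subst h2
      simp only [hne.symm, if_false, if_true, zero_add]
      exact tsum_conj_neg hab (phaseCoeff_conj g ℓ)
    · simp [h1, h2]
  rw [inner_L2Phase, hs.tsum_prod]
  simp_rw [h]
  rw [tsum_eq_sum (s := {ℓ, -ℓ}) fun m hm => by
    simp only [Finset.mem_insert, Finset.mem_singleton, not_or] at hm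
    simp [hm.1, hm.2], Finset.sum_pair hne]
  simp only [if_true, hne.symm, if_false, Complex.add_re, Complex.conj_re]
  field_simp
  ring

section
variable {σx lam γ σc τ σθ χ : ℝ}

/-- Move the mode operator onto V^ℓ by duality; what remains of it is 2π at n = 0, which picks out
the integral of h over θ. -/
lemma tsum_conj_modeV (hσx : 0 < σx) (hσθ : 0 < σθ) (hγ : 0 < γ) (hσc : 0 < σc) {ℓ : Fin 2 → ℤ}
    (hℓ : ℓ ≠ 0) (h : H20) :
    ∑' n, conj (angCoeff (modeV σx lam σθ ℓ) n)
        * phaseCoeff (linOp σx σθ lam τ 0 hγ hσc h : L20) ℓ n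
      = -(2 * Real.pi * phaseCoeff (h : L20) ℓ 0) := by
  have e : modeOp σx σθ lam (-ℓ) = diagSkew (modeDiag σx σθ (waveSq ℓ)) (-transportCoef lam ℓ) := by
    funext x n; rw [modeOp, modeDiag_neg_wave, transportCoef_neg]
  have hV := modeOp_modeV (lam := lam) hσx hσθ hℓ
  have hx' : SqSum (modeOp σx σθ lam (-ℓ) (angCoeff (modeV σx lam σθ ℓ))) :=
    SqSum.of_finite ((Set.finite_singleton 0).subset fun n hn => by
      by_contra h0
      exact hn (by rw [hV, if_neg (by simpa using h0)]))
  have hd := tsum_conj_diagSkew (transportCoef lam ℓ) (sqSum_angCoeff (modeV σx lam σθ ℓ))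
    (sqSum_phaseCoeff_slice (h : L20) ℓ) (e ▸ hx') (sqSum_modeOp (σx := σx) (σθ := σθ) (lam := lam) h ℓ)
  rw [← e] at hd
  have h1 : ∀ n, phaseCoeff (linOp σx σθ lam τ 0 hγ hσc h : L20) ℓ n
      = -diagSkew (modeDiag σx σθ (waveSq ℓ)) (transportCoef lam ℓ) (phaseCoeff (h : L20) ℓ) n :=
    fun n => by rw [← modeOp, modeOp_eq_neg_linOp (τ := τ) hγ hσc, neg_neg]
  simp_rw [h1, mul_neg]
  rw [tsum_neg, hd]
  simp_rw [hV]
  rw [tsum_eq_single 0 fun n hn => by simp [hn]]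
  simp [Complex.conj_ofNat]

lemma inner_psi (hσx : 0 < σx) (hσθ : 0 < σθ) (hγ : 0 < γ) (hσc : 0 < σc) {ℓ : Fin 2 → ℤ}
    (hℓ : ℓ ≠ 0) (h : H20) :
    inner ℝ (psi σx lam σθ ℓ) (linOp σx σθ lam τ 0 hγ hσc h : L20)
      = -2 * (phaseCoeff (h : L20) ℓ 0).re := by
  rw [psi, inner_realWave hℓ (angCoeff_modeV_neg hσx hσθ hℓ), tsum_conj_modeV hσx hσθ hγ hσc hℓ,
    ← Complex.ofReal_ofNat, ← Complex.ofReal_mul, Complex.neg_re, Complex.re_ofReal_mul]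
  field_simp

lemma inner_psiBis (hσx : 0 < σx) (hσθ : 0 < σθ) (hγ : 0 < γ) (hσc : 0 < σc) {ℓ : Fin 2 → ℤ}
    (hℓ : ℓ ≠ 0) (h : H20) :
    inner ℝ (psiBis σx lam σθ ℓ) (linOp σx σθ lam τ 0 hγ hσc h : L20)
      = -2 * (phaseCoeff (h : L20) ℓ 0).im := by
  rw [psiBis, inner_realWave hℓ fun n => by
    rw [angCoeff_smul, angCoeff_smul, angCoeff_modeV_neg hσx hσθ hℓ, map_mul, Complex.conj_I]]
  simp_rw [angCoeff_smul, map_mul, Complex.conj_I, mul_assoc]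
  rw [tsum_mul_left, tsum_conj_modeV hσx hσθ hγ hσc hℓ, ← Complex.ofReal_ofNat,
    ← Complex.ofReal_mul]
  simp
  field_simp

/-! ## Density of the domain and the adjoint -/

/-- For x orthogonal to H²₀, solve Δ_x f + ∂_θθ f = x. Then 0 = ⟨x, f⟩ is, up to a nonzero factor,
the sum of the symbol times |f̂|², so each such product vanishes, and with it x. -/
lemma dense_H20 : Dense (H20 : Set L20) := by
  rw [Submodule.dense_iff_topologicalClosure_eq_top, Submodule.topologicalClosure_eq_top_iff,
    Submodule.eq_bot_iff]
  intro x hx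
  obtain ⟨f, hf⟩ := exists_transport_preimage one_pos one_pos 0 x
  have hD : ∀ m n, phaseCoeff (x : L2Phase) m n
      = -((modeDiag 1 1 (waveSq m) n : ℝ) * phaseCoeff (f : L20) m n) := fun m n => by
    rw [← neg_eq_iff_eq_neg, ← hf]
    simp [modeOp, diagSkew, skewShift, transportCoef]
  have hD0 : ∀ m n, 0 ≤ modeDiag 1 1 (waveSq m) n := fun m n => by
    unfold modeDiag waveSq; positivity
  have h0 : inner ℝ (x : L2Phase) ((f : L20) : L2Phase) = 0 :=
    (Submodule.mem_orthogonal' _ _).mp hx f f.2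
  have hs := (sqSum_phaseCoeff (x : L2Phase)).conj_mul (sqSum_phaseCoeff ((f : L20) : L2Phase))
  have he : ∀ q : (Fin 2 → ℤ) × ℤ, conj (phaseCoeff (x : L2Phase) q.1 q.2)
      * phaseCoeff (f : L20) q.1 q.2
      = ((-(modeDiag 1 1 (waveSq q.1) q.2 * ‖phaseCoeff (f : L20) q.1 q.2‖ ^ 2) : ℝ) : ℂ) :=
    fun q => by
      rw [hD, map_neg, map_mul, Complex.conj_ofReal, neg_mul, mul_assoc, Complex.conj_mul']
      push_cast; ring
  rw [inner_L2Phase, tsum_congr he, ← Complex.ofReal_tsum, Complex.ofReal_re, tsum_neg,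
    mul_eq_zero, neg_eq_zero] at h0
  have h1 := h0.resolve_left (by positivity)
  have hs' : Summable fun q : (Fin 2 → ℤ) × ℤ =>
      modeDiag 1 1 (waveSq q.1) q.2 * ‖phaseCoeff (f : L20) q.1 q.2‖ ^ 2 := by
    have := Complex.summable_ofReal.mp ((summable_congr he).mp hs)
    simpa using this.neg
  refine Subtype.ext (phaseCoeff_ext fun m n => ?_)
  have hmn : modeDiag 1 1 (waveSq m) n * ‖phaseCoeff (f : L20) m n‖ ^ 2 = 0 := by
    refine le_antisymm ?_ (mul_nonneg (hD0 m n) (sq_nonneg _))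
    rw [← h1]
    exact hs'.le_tsum (m, n) fun q _ => mul_nonneg (hD0 q.1 q.2) (sq_nonneg _)
  have h00 : phaseCoeff ((0 : L20) : L2Phase) m n = 0 := by
    simpa using phaseCoeff_smul 0 (0 : L2Phase) m n
  rw [h00, hD]
  rcases mul_eq_zero.mp hmn with h | h
  · rw [h]; simp
  · rw [norm_eq_zero.mp (pow_eq_zero_iff two_ne_zero |>.mp h)]; simp

/-- Orthogonality of x to the range says that u ↦ ⟨x, T u⟩ is zero, hence continuous, so x is in the
domain of the adjoint and is sent to 0. No closedness is needed. -/
lemma orthogonal_range_eq_kernel_adjoint {T : L20 →ₗ.[ℝ] L20} (hT : Dense (T.domain : Set L20)) :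
    (range T)ᗮ = kernel T† := by
  ext x
  rw [Submodule.mem_orthogonal']
  constructor
  · intro h
    have h' : ∀ u : T.domain, inner ℝ (0 : L20) (u : L20) = inner ℝ x (T u) := fun u => by
      rw [inner_zero_left]; exact (h _ ⟨u, rfl⟩).symm
    have hx := LinearPMap.mem_adjoint_domain_of_exists x ⟨0, h'⟩
    exact ⟨⟨x, hx⟩, LinearPMap.adjoint_apply_eq hT ⟨x, hx⟩ h', rfl⟩
  · rintro ⟨y, hy, rfl⟩ _ ⟨u, rfl⟩
    have := LinearPMap.adjoint_isFormalAdjoint hT y u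
    rw [show T† y = 0 from hy, inner_zero_left] at this
    exact this.symm

/-! ## The modes of the linearized operator -/

/-- Right-hand sides are written as L_0 h, which loses nothing since L_0 is bijective. Both sides
then involve the same mode operator, which can be cancelled. -/
lemma linOp_eq_iff (hγ : 0 < γ) (hσc : 0 < σc) (f h : H20) :
    linOp σx σθ lam τ χ hγ hσc f = linOp σx σθ lam τ 0 hγ hσc h ↔
      ∀ m n, modeOp σx σθ lam m (phaseCoeff (f : L20) m) n
        = modeOp σx σθ lam m (phaseCoeff (h : L20) m) n
          - χ * phaseCoeff (f : L20) m 0 * turnCoeff γ σc τ m n := by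
  constructor
  · intro e m n
    have := phaseCoeff_linOp (σx := σx) (σθ := σθ) (lam := lam) (τ := τ) (χ := χ) hγ hσc f m n
    rw [e, phaseCoeff_linOp] at this
    push_cast at this
    linear_combination this
  · intro e
    refine Subtype.ext (phaseCoeff_ext fun m n => ?_)
    rw [phaseCoeff_linOp, phaseCoeff_linOp, e]
    push_cast
    ring

lemma modeOp_add_const_mul (m : Fin 2 → ℤ) (c : ℂ) (x y : ℤ → ℂ) (n : ℤ) :
    modeOp σx σθ lam m (fun n => x n + c * y n) n
      = modeOp σx σθ lam m x n + c * modeOp σx σθ lam m y n := by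
  simp only [modeOp, diagSkew_add, diagSkew_const_mul]

lemma turnCoeff_zero (n : ℤ) : turnCoeff γ σc τ 0 n = 0 := by
  simp [turnCoeff, omega]

/-- Both sides have the same image under the injective mode operator. At n = 0 the identity becomes
a scalar equation for the integral over θ. -/
lemma phaseCoeff_eq_of_linOp_eq (hσx : 0 < σx) (hσθ : 0 < σθ) (hγ : 0 < γ) (hσc : 0 < σc) {f h : H20}
    (e : linOp σx σθ lam τ χ hγ hσc f = linOp σx σθ lam τ 0 hγ hσc h) {m : Fin 2 → ℤ} (hm : m ≠ 0)
    (n : ℤ) :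
    phaseCoeff (f : L20) m n = phaseCoeff (h : L20) m n
      + χ * phaseCoeff (f : L20) m 0 * kernelMode σx lam γ σc τ σθ m n := by
  obtain ⟨h1, h2⟩ := kernelMode_spec (lam := lam) (γ := γ) (σc := σc) (τ := τ) hσx hσθ.le hm
  refine congrFun (modeOp_injective (lam := lam) hσx hσθ hm (sqSum_phaseCoeff_slice (f : L20) m)
    ((sqSum_phaseCoeff_slice (h : L20) m).add
      (h1.const_mul (χ * phaseCoeff (f : L20) m 0))) fun n => ?_) n
  rw [(linOp_eq_iff hγ hσc f h).mp e]
  rw [modeOp_add_const_mul, h2]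
  ring

lemma phaseCoeff_zero_eq_of_linOp_eq (hσθ : 0 < σθ) (hγ : 0 < γ) (hσc : 0 < σc) {f h : H20}
    (e : linOp σx σθ lam τ χ hγ hσc f = linOp σx σθ lam τ 0 hγ hσc h) (n : ℤ) :
    phaseCoeff (f : L20) 0 n = phaseCoeff (h : L20) 0 n := by
  rcases eq_or_ne n 0 with rfl | hn
  · rw [phaseCoeff_L20, phaseCoeff_L20]
  · have := (linOp_eq_iff hγ hσc f h).mp e 0 n
    rw [turnCoeff_zero, mul_zero, sub_zero, modeOp_zero_apply, modeOp_zero_apply] at this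
    refine mul_left_cancel₀ (Complex.ofReal_ne_zero.mpr ?_) this
    have : (n : ℝ) ≠ 0 := by exact_mod_cast hn
    positivity

/-- The numerator grows at most like |m|², and so does the denominator at least. -/
lemma norm_turnCoeff_le (hγ : 0 < γ) (hσc : 0 < σc) {m : Fin 2 → ℤ} (hm : m ≠ 0) (n : ℤ) :
    ‖turnCoeff γ σc τ m n‖
      ≤ (2 * Real.pi + 4 * Real.pi ^ 2 * |τ|) / (4 * Real.pi ^ 2 * σc) := by
  have hπ := Real.pi_pos
  have hE : ellSymbol γ σc m = γ + 4 * Real.pi ^ 2 * σc * waveSq m := by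
    unfold ellSymbol waveSq; ring
  have hW := one_le_waveSq hm
  have hw := norm_omega_sq m
  have h1 : ‖omega m‖ ≤ waveSq m := by
    have : 1 ≤ ‖omega m‖ := by
      by_contra h
      nlinarith [norm_nonneg (omega m)]
    nlinarith
  have hite : ∀ (p : Prop) [Decidable p] (z : ℂ), ‖if p then z else 0‖ ≤ ‖z‖ := fun p _ z => by
    split_ifs <;> simp
  have hnum : ∀ z₁ z₂ z₃ z₄ : ℂ, ‖z₁ + z₂ + z₃ + z₄‖ ≤ ‖z₁‖ + ‖z₂‖ + ‖z₃‖ + ‖z₄‖ :=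
    fun z₁ z₂ z₃ z₄ => norm_add₄_le
  have hE0 : 0 < ellSymbol γ σc m := by rw [hE]; positivity
  rw [turnCoeff, norm_div, Complex.norm_real, Real.norm_of_nonneg hE0.le,
    div_le_div_iff₀ hE0 (by positivity)]
  have h2 := (hnum _ _ _ _).trans (add_le_add (add_le_add (add_le_add
    (hite (n = 1) (-(Real.pi * Complex.I * conj (omega m))))
    (hite (n = -1) (-(Real.pi * Complex.I * omega m))))
    (hite (n = 2) (2 * Real.pi ^ 2 * τ * conj (omega m) ^ 2)))
    (hite (n = -2) (2 * Real.pi ^ 2 * τ * omega m ^ 2)))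
  simp only [norm_neg, norm_mul, norm_pow, RCLike.norm_conj, Complex.norm_I, Complex.norm_real,
    Real.norm_eq_abs, abs_of_pos hπ, Complex.norm_ofNat, hw, mul_one] at h2
  calc _ ≤ ((2 * Real.pi + 4 * Real.pi ^ 2 * |τ|) * waveSq m) * (4 * Real.pi ^ 2 * σc) := by
        gcongr
        refine h2.trans ?_
        have := mul_le_mul_of_nonneg_left h1 hπ.le
        linarith
    _ ≤ _ := by
        rw [mul_assoc, hE]
        gcongr
        linarith

/-- Up to a bounded factor this is the tensor product of ρ with the indicator of {±1, ±2}. -/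
lemma sqSum_mul_turnCoeff (hγ : 0 < γ) (hσc : 0 < σc) {ρ : (Fin 2 → ℤ) → ℂ} (hρ : SqSum ρ) (c : ℂ) :
    SqSum fun q : (Fin 2 → ℤ) × ℤ => c * ρ q.1 * turnCoeff γ σc τ q.1 q.2 := by
  set s : Finset ℤ := {1, -1, 2, -2} with hs
  set B := (2 * Real.pi + 4 * Real.pi ^ 2 * |τ|) / (4 * Real.pi ^ 2 * σc) with hB
  have hB0 : 0 ≤ B := by have := Real.pi_pos; positivity
  have h1 : SqSum fun n : ℤ => if n ∈ s then (1 : ℂ) else 0 :=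
    SqSum.of_finite (s.finite_toSet.subset fun n hn => by
      by_contra h
      exact hn (if_neg h))
  have h2 : SqSum fun q : (Fin 2 → ℤ) × ℤ => ρ q.1 * if q.2 ∈ s then (1 : ℂ) else 0 := by
    have := Summable.mul_of_nonneg hρ h1 (fun _ => by positivity) (fun _ => by positivity)
    simpa only [SqSum, norm_mul, mul_pow] using this
  refine (h2.const_mul c).of_le B fun q => ?_
  rw [mul_assoc, norm_mul, norm_mul, norm_mul, norm_mul, mul_left_comm B, mul_left_comm B]
  gcongr
  by_cases hq : q.1 = 0
  · rw [hq, turnCoeff_zero]; simp; positivity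
  by_cases hn : q.2 ∈ s
  · simpa [hn] using norm_turnCoeff_le hγ hσc hq q.2
  · simp only [hs, Finset.mem_insert, Finset.mem_singleton, not_or] at hn
    simp [turnCoeff, hn.1, hn.2.1, hn.2.2.1, hn.2.2.2]
    positivity

/-- The equation `L_χ f = L_0 h` is solved with prescribed averages `ρ` over the angle, provided that
these satisfy the scalar equations to which it reduces. -/
lemma exists_linOp_eq (hσx : 0 < σx) (hσθ : 0 < σθ) (hγ : 0 < γ) (hσc : 0 < σc) (h : H20)
    {ρ : (Fin 2 → ℤ) → ℂ} (hρ : SqSum ρ) (hρ0 : ρ 0 = 0) (hρc : ∀ m, ρ (-m) = conj (ρ m))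
    (he : ∀ m, m ≠ 0 → phaseCoeff (h : L20) m 0
      = (1 - χ * radialMass σx lam γ σc τ σθ (√(waveSq m)) : ℝ) * ρ m) :
    ∃ f : H20, linOp σx σθ lam τ χ hγ hσc f = linOp σx σθ lam τ 0 hγ hσc h ∧
      ∀ m, phaseCoeff (f : L20) m 0 = ρ m := by
  -- The unknown f̂(m,0) in the chemotactic term is replaced by the prescribed ρ, which leaves a
  -- transport equation. The scalar equations `he` then show that the solution does have ρ as its
  -- integral over θ.
  obtain ⟨f, hf⟩ := exists_modeOp_eq
    (g := fun m n => phaseCoeff (linOp σx σθ lam τ 0 hγ hσc h : L20) m n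
      + χ * ρ m * turnCoeff γ σc τ m n) hσx hσθ lam
    ((sqSum_phaseCoeff _).add (sqSum_mul_turnCoeff hγ hσc hρ χ))
    (by rw [phaseCoeff_L20, turnCoeff_zero]; simp)
    (fun m n => by
      rw [phaseCoeff_neg_neg, turnCoeff_neg, neg_neg, hρc, map_add, map_mul, map_mul,
        Complex.conj_ofReal])
  have hf' : ∀ m n, modeOp σx σθ lam m (phaseCoeff (f : L20) m) n
      = modeOp σx σθ lam m (phaseCoeff (h : L20) m) n - χ * ρ m * turnCoeff γ σc τ m n :=
    fun m n => by rw [hf, modeOp_eq_neg_linOp (τ := τ) hγ hσc]; ring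
  have hfρ : ∀ m, phaseCoeff (f : L20) m 0 = ρ m := fun m => by
    by_cases hm : m = 0
    · rw [hm, phaseCoeff_L20, hρ0]
    obtain ⟨h1, h2⟩ := kernelMode_spec (lam := lam) (γ := γ) (σc := σc) (τ := τ) hσx hσθ.le hm
    have := congrFun (modeOp_injective (lam := lam) hσx hσθ hm (sqSum_phaseCoeff_slice (f : L20) m)
      ((sqSum_phaseCoeff_slice (h : L20) m).add (h1.const_mul (χ * ρ m))) fun n => by
        rw [hf']
        rw [modeOp_add_const_mul, h2]
        ring) 0
    rw [this, kernelMode_zero hσx hσθ.le hm, he m hm]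
    push_cast
    ring
  exact ⟨f, (linOp_eq_iff hγ hσc f h).mpr fun m n => by rw [hf', hfρ], hfρ⟩

end
end AntModel
end

noncomputable section
namespace AntModel
open MeasureTheory Submodule Matrix
open scoped ComplexConjugate

/-! ## The critical wave vectors -/

/-- `C` is the set of nonzero wave vectors on which `χ` is critical, and `χ` stays away from
criticality uniformly on the other ones. -/
structure IsCritical (σx lam γ σc τ σθ χ : ℝ) (C : Finset (Fin 2 → ℤ)) : Prop where
  ne_zero : ∀ m ∈ C, m ≠ 0
  neg_mem : ∀ m ∈ C, -m ∈ C
  mul_radialMass : ∀ m ∈ C, χ * radialMass σx lam γ σc τ σθ (√(waveSq m)) = 1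
  gap : ∃ δ > 0, ∀ m ∉ C, m ≠ 0 → δ ≤ |1 - χ * radialMass σx lam γ σc τ σθ (√(waveSq m))|

lemma finite_waveSq_le (R : ℝ) : {m : Fin 2 → ℤ | waveSq m ≤ R}.Finite := by
  refine (Set.finite_Icc (fun _ => -⌈R⌉) (fun _ => ⌈R⌉)).subset fun m hm => ?_
  have hR : waveSq m ≤ ⌈R⌉ := le_trans hm (Int.le_ceil R)
  unfold waveSq at hR
  have hR' : m 0 ^ 2 + m 1 ^ 2 ≤ ⌈R⌉ := by exact_mod_cast hR
  have h : ∀ i, |m i| ≤ ⌈R⌉ := fun i => by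
    have h1 : |m i| ≤ m i ^ 2 := by
      rw [← sq_abs]; exact Int.le_self_sq _
    refine h1.trans (le_trans ?_ hR')
    fin_cases i
    · exact le_add_of_nonneg_right (sq_nonneg _)
    · exact le_add_of_nonneg_left (sq_nonneg _)
  exact ⟨fun i => (abs_le.mp (h i)).1, fun i => (abs_le.mp (h i)).2⟩

lemma exists_pos_le_of_finite {α : Type*} {s : Set α} (hs : s.Finite) {F : α → ℝ}
    (hF : ∀ a ∈ s, 0 < F a) : ∃ δ > 0, ∀ a ∈ s, δ ≤ F a := by
  rcases s.eq_empty_or_nonempty with rfl | hne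
  · exact ⟨1, one_pos, by simp⟩
  · obtain ⟨a, ha, h⟩ := Set.exists_min_image s F hs hne
    exact ⟨F a, hF a ha, h⟩

section
variable {σx lam γ σc τ σθ χ : ℝ} {C C' : Finset (Fin 2 → ℤ)}

/-- The mass is O(1/|m|²), so χ times the mass is at most 1/2 in absolute value outside a finite
set; on that set nonvanishing already gives a positive minimum. -/
lemma isCritical_of_forall (hσx : 0 < σx) (hγ : 0 < γ) (hσc : 0 < σc) (hτ : 0 ≤ τ) (hσθ : 0 < σθ)
    (hC0 : ∀ m ∈ C, m ≠ 0) (hCn : ∀ m ∈ C, -m ∈ C)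
    (h : ∀ m, m ≠ 0 → (χ * radialMass σx lam γ σc τ σθ (√(waveSq m)) = 1 ↔ m ∈ C)) :
    IsCritical σx lam γ σc τ σθ χ C := by
  refine ⟨hC0, hCn, fun m hm => (h m (hC0 m hm)).mpr hm, ?_⟩
  obtain ⟨B, hB⟩ := abs_radialMass_le (lam := lam) hσx hγ hσc hτ
  obtain ⟨δ, hδ, hδ'⟩ := exists_pos_le_of_finite
    (s := {m | waveSq m ≤ 2 * (|χ| * B)} ∩ {m | m ∉ C ∧ m ≠ 0})
    ((finite_waveSq_le _).inter_of_left _)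
    (F := fun m => |1 - χ * radialMass σx lam γ σc τ σθ (√(waveSq m))|)
    (fun m hm => abs_pos.mpr (sub_ne_zero.mpr fun e => hm.2.1 ((h m hm.2.2).mp e.symm)))
  refine ⟨min δ (1 / 2), by positivity, fun m hm hm0 => ?_⟩
  by_cases hle : waveSq m ≤ 2 * (|χ| * B)
  · exact (min_le_left _ _).trans (hδ' m ⟨hle, hm, hm0⟩)
  · refine (min_le_right _ _).trans ?_
    push Not at hle
    have hW := waveSq_pos hm0
    have h1 := hB σθ (√(waveSq m)) hσθ.le (Real.one_le_sqrt.mpr (one_le_waveSq hm0))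
    rw [Real.sq_sqrt hW.le] at h1
    have h2 : |χ * radialMass σx lam γ σc τ σθ (√(waveSq m))| ≤ 1 / 2 := by
      rw [abs_mul]
      calc _ ≤ |χ| * (B / waveSq m) := by gcongr
        _ ≤ 1 / 2 := by
          rw [← mul_div_assoc, div_le_iff₀ hW]; linarith
    have := abs_sub_abs_le_abs_sub 1 (χ * radialMass σx lam γ σc τ σθ (√(waveSq m)))
    rw [abs_one] at this
    linarith

/-! ### Kernel, range and cokernel -/

lemma linOp_zero_right (hγ : 0 < γ) (hσc : 0 < σc) :
    linOp σx σθ lam τ χ hγ hσc (0 : H20) = 0 := (linOp σx σθ lam τ χ hγ hσc).toFun.map_zero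

lemma phaseCoeff_zero (m : Fin 2 → ℤ) (n : ℤ) : phaseCoeff (0 : L2Phase) m n = 0 := by
  simpa using phaseCoeff_smul 0 (0 : L2Phase) m n

lemma mem_kernel_iff (hγ : 0 < γ) (hσc : 0 < σc) {x : L20} :
    x ∈ kernel (linOp σx σθ lam τ χ hγ hσc) ↔ ∃ f : H20, (f : L20) = x ∧
      linOp σx σθ lam τ χ hγ hσc f = linOp σx σθ lam τ 0 hγ hσc (0 : H20) := by
  rw [linOp_zero_right]
  constructor
  · rintro ⟨f, hf, rfl⟩
    exact ⟨f, rfl, hf⟩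
  · rintro ⟨f, rfl, hf⟩
    exact ⟨f, hf, rfl⟩

lemma phaseCoeff_of_mem_kernel (hσx : 0 < σx) (hσθ : 0 < σθ) (hγ : 0 < γ) (hσc : 0 < σc) {x : L20}
    (hx : x ∈ kernel (linOp σx σθ lam τ χ hγ hσc)) (m : Fin 2 → ℤ) (n : ℤ) :
    phaseCoeff (x : L2Phase) m n
      = if m = 0 then 0 else χ * phaseCoeff (x : L2Phase) m 0 * kernelMode σx lam γ σc τ σθ m n := by
  obtain ⟨f, rfl, hf⟩ := (mem_kernel_iff hγ hσc).mp hx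
  by_cases hm : m = 0
  · rw [if_pos hm, hm, phaseCoeff_zero_eq_of_linOp_eq hσθ hγ hσc hf]
    exact phaseCoeff_zero 0 n
  · rw [if_neg hm]
    refine (phaseCoeff_eq_of_linOp_eq hσx hσθ hγ hσc hf hm n).trans ?_
    rw [show phaseCoeff (((0 : H20) : L20) : L2Phase) m n = 0 from phaseCoeff_zero m n, zero_add]

/-- With h = 0 the scalar equation is (1 - χ Y) f̂(m,0) = 0, and the first factor is nonzero off C.
-/
lemma IsCritical.phaseCoeff_eq_zero (hC : IsCritical σx lam γ σc τ σθ χ C) (hσx : 0 < σx)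
    (hσθ : 0 < σθ) (hγ : 0 < γ) (hσc : 0 < σc) {x : L20}
    (hx : x ∈ kernel (linOp σx σθ lam τ χ hγ hσc)) {m : Fin 2 → ℤ} (hm : m ∉ C) :
    phaseCoeff (x : L2Phase) m 0 = 0 := by
  have h := phaseCoeff_of_mem_kernel hσx hσθ hγ hσc hx m 0
  by_cases hm0 : m = 0
  · rwa [if_pos hm0] at h
  · rw [if_neg hm0, kernelMode_zero hσx hσθ.le hm0] at h
    obtain ⟨δ, hδ, hg⟩ := hC.gap
    have hne : (1 - χ * radialMass σx lam γ σc τ σθ (√(waveSq m)) : ℝ) ≠ 0 :=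
      abs_pos.mp (hδ.trans_le (hg m hm hm0))
    refine (mul_eq_zero.mp ?_).resolve_left (Complex.ofReal_ne_zero.mpr hne)
    push_cast
    linear_combination h

lemma IsCritical.eq_of_mem_kernel (hC : IsCritical σx lam γ σc τ σθ χ C) (hσx : 0 < σx)
    (hσθ : 0 < σθ) (hγ : 0 < γ) (hσc : 0 < σc) {x y : L20}
    (hx : x ∈ kernel (linOp σx σθ lam τ χ hγ hσc)) (hy : y ∈ kernel (linOp σx σθ lam τ χ hγ hσc))
    (h : ∀ m ∈ C, phaseCoeff (x : L2Phase) m 0 = phaseCoeff (y : L2Phase) m 0) : x = y := by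
  refine Subtype.ext (phaseCoeff_ext fun m n => ?_)
  rw [phaseCoeff_of_mem_kernel hσx hσθ hγ hσc hx, phaseCoeff_of_mem_kernel hσx hσθ hγ hσc hy]
  by_cases hm : m ∈ C
  · rw [h m hm]
  · rw [hC.phaseCoeff_eq_zero hσx hσθ hγ hσc hx hm, hC.phaseCoeff_eq_zero hσx hσθ hγ hσc hy hm]

lemma IsCritical.exists_mem_kernel (hC : IsCritical σx lam γ σc τ σθ χ C) (hσx : 0 < σx)
    (hσθ : 0 < σθ) (hγ : 0 < γ) (hσc : 0 < σc) {z : (Fin 2 → ℤ) → ℂ}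
    (hz : ∀ m, z (-m) = conj (z m)) :
    ∃ f : H20, (f : L20) ∈ kernel (linOp σx σθ lam τ χ hγ hσc) ∧
      ∀ m ∈ C, phaseCoeff (f : L20) m 0 = z m := by
  classical
  have hCn : ∀ m, -m ∈ C ↔ m ∈ C := fun m =>
    ⟨fun h => neg_neg m ▸ hC.neg_mem _ h, hC.neg_mem m⟩
  obtain ⟨f, hf, hfz⟩ := exists_linOp_eq (lam := lam) (τ := τ) (χ := χ) hσx hσθ hγ hσc 0
    (ρ := fun m => if m ∈ C then z m else 0)
    (SqSum.of_finite (C.finite_toSet.subset fun m hm => by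
      by_contra h
      exact hm (if_neg h)))
    (if_neg fun h => hC.ne_zero 0 h rfl)
    (fun m => by simp only [hCn, hz, apply_ite conj, map_zero])
    (fun m _ => by
      rw [show phaseCoeff (((0 : H20) : L20) : L2Phase) m 0 = 0 from phaseCoeff_zero m 0]
      split_ifs with hm
      · rw [hC.mul_radialMass m hm]; simp
      · simp)
  exact ⟨f, (mem_kernel_iff hγ hσc).mpr ⟨f, rfl, hf⟩, fun m hm => by rw [hfz, if_pos hm]⟩

/-- The angular averages of `f` at the wave vectors in `C`, in the real coordinates of the Hartley
transform. -/
def hartley (C : Finset (Fin 2 → ℤ)) : L20 →ₗ[ℝ] (C → ℝ) where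
  toFun f ℓ := (phaseCoeff (f : L2Phase) ℓ 0).re + (phaseCoeff (f : L2Phase) ℓ 0).im
  map_add' f g := by
    funext ℓ
    simp only [Submodule.coe_add, phaseCoeff_add, Complex.add_re, Complex.add_im, Pi.add_apply]
    ring
  map_smul' a f := by
    funext ℓ
    simp only [Submodule.coe_smul, phaseCoeff_smul, Complex.re_ofReal_mul, Complex.im_ofReal_mul,
      Pi.smul_apply, smul_eq_mul, RingHom.id_apply]
    ring

/-- By reality the coefficients at m and -m are conjugate, so Re + Im at these two points recovers
both Re and Im. One real number per point of C is thus enough, and no half of C has to be chosen for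
the dimension count. -/
lemma hartley_eq_zero_iff (hCn : ∀ m ∈ C, -m ∈ C) {f : L20} :
    hartley C f = 0 ↔ ∀ m ∈ C, phaseCoeff (f : L2Phase) m 0 = 0 := by
  constructor
  · intro h m hm
    have h1 := congrFun h ⟨m, hm⟩
    have h2 := congrFun h ⟨-m, hCn m hm⟩
    simp only [hartley, LinearMap.coe_mk, AddHom.coe_mk, phaseCoeff_conj, neg_zero, Complex.conj_re,
      Complex.conj_im, Pi.zero_apply] at h1 h2
    exact Complex.ext (by simp; linarith) (by simp; linarith)
  · intro h
    funext ℓ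
    simp [hartley, h ℓ ℓ.2]

lemma IsCritical.exists_hartley_eq (hC : IsCritical σx lam γ σc τ σθ χ C) (hσx : 0 < σx)
    (hσθ : 0 < σθ) (hγ : 0 < γ) (hσc : 0 < σc) (w : C → ℝ) :
    ∃ f : H20, (f : L20) ∈ kernel (linOp σx σθ lam τ χ hγ hσc) ∧ hartley C f = w := by
  classical
  set w' : (Fin 2 → ℤ) → ℝ := fun m => if h : m ∈ C then w ⟨m, h⟩ else 0
  -- The even and odd parts of `w'` are the real and imaginary parts; this inverts Re + Im and
  -- satisfies the reality condition.
  obtain ⟨f, hf, hz⟩ := hC.exists_mem_kernel hσx hσθ hγ hσc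
    (z := fun m => ⟨(w' m + w' (-m)) / 2, (w' m - w' (-m)) / 2⟩) fun m => by
      rw [neg_neg]
      exact Complex.ext (by simp [add_comm]) (by simp; ring)
  refine ⟨f, hf, funext fun ℓ => ?_⟩
  simp only [hartley, LinearMap.coe_mk, AddHom.coe_mk, hz ℓ ℓ.2]
  rw [show w ℓ = w' ℓ by simp [w']]
  ring

lemma IsCritical.finrank_kernel (hC : IsCritical σx lam γ σc τ σθ χ C) (hσx : 0 < σx)
    (hσθ : 0 < σθ) (hγ : 0 < γ) (hσc : 0 < σc) :
    Module.finrank ℝ (kernel (linOp σx σθ lam τ χ hγ hσc)) = C.card := by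
  have hb : Function.Bijective
      ((hartley C).domRestrict (kernel (linOp σx σθ lam τ χ hγ hσc))) := by
    constructor
    · rw [← LinearMap.ker_eq_bot, LinearMap.ker_eq_bot']
      intro x hx
      have h := (hartley_eq_zero_iff hC.neg_mem).mp hx
      refine Subtype.ext (hC.eq_of_mem_kernel hσx hσθ hγ hσc x.2 (Submodule.zero_mem _) fun m hm => ?_)
      exact (h m hm).trans (phaseCoeff_zero m 0).symm
    · intro w
      obtain ⟨f, hf, hw⟩ := hC.exists_hartley_eq hσx hσθ hγ hσc w
      exact ⟨⟨f, hf⟩, hw⟩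
  rw [(LinearEquiv.ofBijective _ hb).finrank_eq]
  simp

lemma linOp_zero_bijective (hσx : 0 < σx) (hσθ : 0 < σθ) (hγ : 0 < γ) (hσc : 0 < σc) :
    Function.Bijective (linOp σx σθ lam τ 0 hγ hσc).toFun := by
  constructor
  · intro f f' h
    refine Subtype.ext (eq_of_modeOp_eq (lam := lam) hσx hσθ fun m n => ?_)
    rw [modeOp_eq_neg_linOp (τ := τ) hγ hσc f, modeOp_eq_neg_linOp (τ := τ) hγ hσc f']
    exact congrArg (fun g : L20 => -phaseCoeff (g : L2Phase) m n) h
  · intro g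
    obtain ⟨f, hf⟩ := exists_transport_preimage hσx hσθ lam g
    refine ⟨f, Subtype.ext (phaseCoeff_ext fun m n => ?_)⟩
    have := modeOp_eq_neg_linOp (σx := σx) (σθ := σθ) (lam := lam) (τ := τ) hγ hσc f m n
    rw [hf, neg_inj] at this
    exact this.symm

/-- On C the factor 1 - χ Y vanishes, which forces the condition. Off C one divides by it, and the
uniform gap keeps the quotients square summable. -/
lemma IsCritical.mem_range_iff (hC : IsCritical σx lam γ σc τ σθ χ C) (hσx : 0 < σx)
    (hσθ : 0 < σθ) (hγ : 0 < γ) (hσc : 0 < σc) (h : H20) :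
    linOp σx σθ lam τ 0 hγ hσc h ∈ range (linOp σx σθ lam τ χ hγ hσc) ↔
      ∀ m ∈ C, phaseCoeff (h : L20) m 0 = 0 := by
  classical
  constructor
  · rintro ⟨f, hf⟩ m hm
    have hm0 := hC.ne_zero m hm
    have := phaseCoeff_eq_of_linOp_eq hσx hσθ hγ hσc (f := f) (h := h) hf hm0 0
    have hY := congrArg (Complex.ofReal) (hC.mul_radialMass m hm)
    push_cast at hY
    rw [kernelMode_zero hσx hσθ.le hm0] at this
    linear_combination -this - phaseCoeff (f : L20) m 0 * hY
  · intro h0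
    obtain ⟨δ, hδ, hg⟩ := hC.gap
    set Y : (Fin 2 → ℤ) → ℝ := fun m =>
      1 - χ * radialMass σx lam γ σc τ σθ (√(waveSq m)) with hY
    have hYn : ∀ m, Y (-m) = Y m := fun m => by simp [hY, waveSq]
    obtain ⟨f, hf, -⟩ := exists_linOp_eq (lam := lam) (τ := τ) (χ := χ) hσx hσθ hγ hσc h
      (ρ := fun m => phaseCoeff (h : L20) m 0 / (Y m : ℝ))
      (((sqSum_phaseCoeff (h : L20)).comp (e := fun m => (m, 0)) fun _ _ e =>
        (Prod.ext_iff.mp e).1).of_le δ⁻¹ fun m => by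
          by_cases hm : m ∈ C
          · simp [h0 m hm]
          by_cases hm0 : m = 0
          · rw [hm0, phaseCoeff_L20]; simp
          rw [norm_div, Complex.norm_real, Real.norm_eq_abs, ← div_eq_inv_mul]
          exact div_le_div_of_nonneg_left (norm_nonneg _) hδ (hg m hm hm0))
      (by rw [phaseCoeff_L20, zero_div])
      (fun m => by rw [phaseCoeff_conj, neg_zero, hYn, map_div₀, Complex.conj_ofReal])
      (fun m hm0 => by
        by_cases hm : m ∈ C
        · simp [h0 m hm]
        · exact (mul_div_cancel₀ _ (Complex.ofReal_ne_zero.mpr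
            (abs_pos.mp (hδ.trans_le (hg m hm hm0))))).symm)
    exact ⟨f, hf⟩

/-- Through the inverse of L_0, the range is the kernel of a surjection onto C → ℝ. -/
lemma IsCritical.finrank_quotient_range (hC : IsCritical σx lam γ σc τ σθ χ C) (hσx : 0 < σx)
    (hσθ : 0 < σθ) (hγ : 0 < γ) (hσc : 0 < σc) :
    Module.finrank ℝ (L20 ⧸ range (linOp σx σθ lam τ χ hγ hσc)) = C.card := by
  set A : H20 ≃ₗ[ℝ] L20 := LinearEquiv.ofBijective (linOp σx σθ lam τ 0 hγ hσc).toFun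
    (linOp_zero_bijective hσx hσθ hγ hσc) with hA
  set Λ : L20 →ₗ[ℝ] (C → ℝ) := hartley C ∘ₗ H20.subtype ∘ₗ A.symm.toLinearMap with hΛ
  have hsurj : Function.Surjective Λ := fun w => by
    obtain ⟨f, -, hw⟩ := hC.exists_hartley_eq hσx hσθ hγ hσc w
    refine ⟨A f, ?_⟩
    change hartley C (A.symm (A f) : H20) = w
    rw [A.symm_apply_apply, hw]
  have hker : range (linOp σx σθ lam τ χ hγ hσc) = LinearMap.ker Λ := by
    ext g
    obtain ⟨h, rfl⟩ := A.surjective g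
    rw [LinearMap.mem_ker]
    change linOp σx σθ lam τ 0 hγ hσc h ∈ _ ↔ hartley C (A.symm (A h) : H20) = 0
    rw [hC.mem_range_iff hσx hσθ hγ hσc, A.symm_apply_apply, hartley_eq_zero_iff hC.neg_mem]
  rw [hker, (LinearMap.quotKerEquivOfSurjective Λ hsurj).finrank_eq]
  simp

end
end AntModel
end

noncomputable section
namespace AntModel
open MeasureTheory Submodule Matrix
open scoped ComplexConjugate

section
variable {σx lam γ σc τ σθ χ : ℝ} {C C' : Finset (Fin 2 → ℤ)}

/-! ## The spans of the real waves -/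

/-- The span of `ψ^ℓ` and `ψ^{bis ℓ}`, for `ℓ ∈ C`. -/
def psiSpan (σx lam σθ : ℝ) (C : Finset (Fin 2 → ℤ)) : Submodule ℝ L2Phase :=
  span ℝ (psi σx lam σθ '' C ∪ psiBis σx lam σθ '' C)

/-- The span of `φ^ℓ` and `φ^{bis ℓ}`, for `ℓ ∈ C`. -/
def phiSpan (σx lam γ σc τ σθ : ℝ) (C : Finset (Fin 2 → ℤ)) : Submodule ℝ L2Phase :=
  span ℝ (phi σx lam γ σc τ σθ '' C ∪ phiBis σx lam γ σc τ σθ '' C)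

lemma psiSpan_le (hσx : 0 < σx) (hσθ : 0 < σθ) (hC : ∀ m ∈ C, m ≠ 0) :
    psiSpan σx lam σθ C ≤ L20 := by
  refine span_le.mpr ?_
  rintro _ (⟨ℓ, hℓ, rfl⟩ | ⟨ℓ, hℓ, rfl⟩) <;> have h := hC ℓ hℓ
  · rw [SetLike.mem_coe, mem_L20_iff, psi, phaseCoeff_realWave (angCoeff_modeV_neg hσx hσθ h),
      if_neg h.symm, if_neg (neg_ne_zero.mpr h).symm, add_zero]
  · rw [SetLike.mem_coe, mem_L20_iff, psiBis, phaseCoeff_realWave_I (angCoeff_modeV_neg hσx hσθ h),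
      if_neg h.symm, if_neg (neg_ne_zero.mpr h).symm, add_zero]

instance finiteDimensional_psiSpan : FiniteDimensional ℝ (psiSpan σx lam σθ C) :=
  FiniteDimensional.span_of_finite ℝ
    ((C.finite_toSet.image _).union (C.finite_toSet.image _))

instance finiteDimensional_comap_psiSpan :
    FiniteDimensional ℝ ((psiSpan σx lam σθ C).comap L20.subtype) :=
  Module.Finite.of_injective
    ((L20.subtype.restrict (p := (psiSpan σx lam σθ C).comap L20.subtype)
      (q := psiSpan σx lam σθ C) fun _ h => h))
    fun _ _ h => Subtype.ext (Subtype.ext (congrArg (fun v : psiSpan σx lam σθ C => (v : L2Phase)) h))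

/-- Pairing with ψ^ℓ and ψ^{bis ℓ} reads off the real and imaginary parts of ĥ(ℓ,0). One of each
pair ±m suffices, the condition at -m being the conjugate of the one at m. -/
lemma IsCritical.range_eq (hC : IsCritical σx lam γ σc τ σθ χ C) (hσx : 0 < σx)
    (hσθ : 0 < σθ) (hγ : 0 < γ) (hσc : 0 < σc) (hle : C' ⊆ C) (hcov : ∀ m ∈ C, m ∈ C' ∨ -m ∈ C') :
    range (linOp σx σθ lam τ χ hγ hσc) = ((psiSpan σx lam σθ C').comap L20.subtype)ᗮ := by
  ext g
  obtain ⟨h, rfl⟩ : ∃ h : H20, linOp σx σθ lam τ 0 hγ hσc h = g :=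
    (linOp_zero_bijective hσx hσθ hγ hσc).2 g
  rw [hC.mem_range_iff hσx hσθ hγ hσc, Submodule.mem_orthogonal]
  have hle' := psiSpan_le (lam := lam) hσx hσθ fun m (hm : m ∈ C') => hC.ne_zero m (hle hm)
  constructor
  · intro h0 u hu
    have hz : ∀ v ∈ psiSpan σx lam σθ C',
        inner ℝ v (linOp σx σθ lam τ 0 hγ hσc h : L2Phase) = 0 := fun v hv => by
      refine Submodule.span_induction ?_ (inner_zero_left _) (fun a b _ _ ha hb => ?_)
        (fun c a _ ha => ?_) hv
      · rintro _ (⟨ℓ, hℓ, rfl⟩ | ⟨ℓ, hℓ, rfl⟩)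
        · rw [inner_psi hσx hσθ hγ hσc (hC.ne_zero ℓ (hle hℓ)), h0 ℓ (hle hℓ)]; simp
        · rw [inner_psiBis hσx hσθ hγ hσc (hC.ne_zero ℓ (hle hℓ)), h0 ℓ (hle hℓ)]; simp
      · rw [inner_add_left, ha, hb, add_zero]
      · rw [inner_smul_left, ha, mul_zero]
    exact hz u hu
  · intro ho
    have hz : ∀ v (hv : v ∈ psiSpan σx lam σθ C'),
        inner ℝ v (linOp σx σθ lam τ 0 hγ hσc h : L2Phase) = 0 := fun v hv =>
      ho ⟨v, hle' hv⟩ hv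
    have h' : ∀ m ∈ C', phaseCoeff (h : L20) m 0 = 0 := fun m hm => by
      have h1 := hz _ (subset_span (Or.inl ⟨m, hm, rfl⟩))
      have h2 := hz _ (subset_span (Or.inr ⟨m, hm, rfl⟩))
      rw [inner_psi hσx hσθ hγ hσc (hC.ne_zero m (hle hm))] at h1
      rw [inner_psiBis hσx hσθ hγ hσc (hC.ne_zero m (hle hm))] at h2
      exact Complex.ext (by simpa using h1) (by simpa using h2)
    intro m hm
    rcases hcov m hm with h1 | h1
    · exact h' m h1
    · have := h' _ h1
      rw [phaseCoeff_conj, neg_zero] at this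
      exact (map_eq_zero _).mp this

/-- A finite-dimensional subspace is its own double orthogonal complement. -/
lemma IsCritical.kernel_adjoint_eq (hC : IsCritical σx lam γ σc τ σθ χ C) (hσx : 0 < σx)
    (hσθ : 0 < σθ) (hγ : 0 < γ) (hσc : 0 < σc) (hle : C' ⊆ C) (hcov : ∀ m ∈ C, m ∈ C' ∨ -m ∈ C') :
    kernel (linOp σx σθ lam τ χ hγ hσc)† = (psiSpan σx lam σθ C').comap L20.subtype := by
  rw [← orthogonal_range_eq_kernel_adjoint (T := linOp σx σθ lam τ χ hγ hσc) dense_H20,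
    hC.range_eq hσx hσθ hγ hσc hle hcov, Submodule.orthogonal_orthogonal]

lemma IsCritical.map_kernel_adjoint (hC : IsCritical σx lam γ σc τ σθ χ C) (hσx : 0 < σx)
    (hσθ : 0 < σθ) (hγ : 0 < γ) (hσc : 0 < σc) (hle : C' ⊆ C) (hcov : ∀ m ∈ C, m ∈ C' ∨ -m ∈ C') :
    (kernel (linOp σx σθ lam τ χ hγ hσc)†).map L20.subtype = psiSpan σx lam σθ C' := by
  rw [hC.kernel_adjoint_eq hσx hσθ hγ hσc hle hcov, Submodule.map_comap_subtype]
  exact inf_eq_right.mpr (psiSpan_le hσx hσθ fun m hm => hC.ne_zero m (hle hm))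

/-- With C' = C the spanning family is redundant, since ℓ and -ℓ give the same functions up to sign.
The dimension is therefore read from the quotient, using that L²₀ modulo the complement of a closed
subspace is that subspace. -/
lemma IsCritical.finrank_kernel_adjoint (hC : IsCritical σx lam γ σc τ σθ χ C) (hσx : 0 < σx)
    (hσθ : 0 < σθ) (hγ : 0 < γ) (hσc : 0 < σc) :
    Module.finrank ℝ (kernel (linOp σx σθ lam τ χ hγ hσc)†) = C.card := by
  rw [← hC.finrank_quotient_range hσx hσθ hγ hσc,
    hC.kernel_adjoint_eq hσx hσθ hγ hσc subset_rfl fun m hm => Or.inl hm,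
    hC.range_eq hσx hσθ hγ hσc subset_rfl fun m hm => Or.inl hm]
  exact (Submodule.quotientEquivOfIsCompl _ _ (Submodule.isCompl_orthogonal _).symm).finrank_eq.symm

/-- A real wave carried by `±ℓ`, whose mode at `ℓ` is a multiple of `U^ℓ`, is in the kernel. -/
lemma IsCritical.mem_map_kernel (hC : IsCritical σx lam γ σc τ σθ χ C) (hσx : 0 < σx)
    (hσθ : 0 < σθ) (hγ : 0 < γ) (hσc : 0 < σc) {ℓ : Fin 2 → ℤ} (hℓ : ℓ ∈ C) {F : L2Phase} (c : ℂ)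
    (hF : ∀ m n, phaseCoeff F m n
      = (if m = ℓ then c * angCoeff (modeU σx lam γ σc τ σθ ℓ) n else 0)
        + if m = -ℓ then conj c * angCoeff (modeU σx lam γ σc τ σθ (-ℓ)) n else 0) :
    F ∈ (kernel (linOp σx σθ lam τ χ hγ hσc)).map L20.subtype := by
  classical
  have hℓ0 := hC.ne_zero ℓ hℓ
  have hℓn := neg_ne_zero.mpr hℓ0
  have hne : ℓ ≠ -ℓ := fun h => hℓ0 (self_eq_neg.mp h)
  obtain ⟨f, hf, hz⟩ := hC.exists_mem_kernel hσx hσθ hγ hσc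
    (z := fun m => phaseCoeff F m 0) fun m => by rw [phaseCoeff_conj, neg_zero]
  refine ⟨f, hf, phaseCoeff_ext fun m n => ?_⟩
  change phaseCoeff (f : L20) m n = _
  rw [phaseCoeff_of_mem_kernel hσx hσθ hγ hσc hf]
  -- The integral of U^m is 2π times the radial mass, hence 2π/χ at a critical wave vector.
  have hY : ∀ m ∈ C, (χ : ℂ) * angCoeff (modeU σx lam γ σc τ σθ m) 0 = 2 * Real.pi := fun m hm => by
    have := congrArg Complex.ofReal (hC.mul_radialMass m hm)
    push_cast at this
    rw [angCoeff_modeU hσx hσθ (hC.ne_zero m hm), kernelMode_zero hσx hσθ.le (hC.ne_zero m hm)]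
    linear_combination 2 * Real.pi * this
  by_cases hm : m ∈ C
  · rw [if_neg (hC.ne_zero m hm), hz m hm, hF, hF]
    by_cases h1 : m = ℓ
    · subst h1
      rw [if_pos rfl, if_pos rfl, if_neg hne, if_neg hne, add_zero, add_zero,
        angCoeff_modeU hσx hσθ hℓ0 n]
      linear_combination c * kernelMode σx lam γ σc τ σθ m n * hY m hm
    by_cases h2 : m = -ℓ
    · subst h2
      rw [if_neg h1, if_neg h1, if_pos rfl, if_pos rfl, zero_add, zero_add,
        angCoeff_modeU hσx hσθ hℓn n]
      linear_combination conj c * kernelMode σx lam γ σc τ σθ (-ℓ) n * hY _ hm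
    · simp [h1, h2]
  · have h1 : m ≠ ℓ := fun h => hm (h ▸ hℓ)
    have h2 : m ≠ -ℓ := fun h => hm (h ▸ hC.neg_mem ℓ hℓ)
    rw [hC.phaseCoeff_eq_zero hσx hσθ hγ hσc hf hm, hF, if_neg h1, if_neg h2]
    simp

lemma phaseCoeff_phi (hσx : 0 < σx) (hσθ : 0 < σθ) {ℓ : Fin 2 → ℤ} (hℓ : ℓ ≠ 0) (m : Fin 2 → ℤ)
    (n : ℤ) : phaseCoeff (phi σx lam γ σc τ σθ ℓ) m n
      = (if m = ℓ then angCoeff (modeU σx lam γ σc τ σθ ℓ) n else 0)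
        + if m = -ℓ then angCoeff (modeU σx lam γ σc τ σθ (-ℓ)) n else 0 := by
  rw [phi, phaseCoeff_realWave (angCoeff_modeU_neg hσx hσθ hℓ)]

lemma phaseCoeff_phiBis (hσx : 0 < σx) (hσθ : 0 < σθ) {ℓ : Fin 2 → ℤ} (hℓ : ℓ ≠ 0)
    (m : Fin 2 → ℤ) (n : ℤ) : phaseCoeff (phiBis σx lam γ σc τ σθ ℓ) m n
      = (if m = ℓ then Complex.I * angCoeff (modeU σx lam γ σc τ σθ ℓ) n else 0)
        + if m = -ℓ then -Complex.I * angCoeff (modeU σx lam γ σc τ σθ (-ℓ)) n else 0 := by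
  rw [phiBis, phaseCoeff_realWave_I (angCoeff_modeU_neg hσx hσθ hℓ)]

lemma IsCritical.phiSpan_le (hC : IsCritical σx lam γ σc τ σθ χ C) (hσx : 0 < σx)
    (hσθ : 0 < σθ) (hγ : 0 < γ) (hσc : 0 < σc) (hle : C' ⊆ C) :
    phiSpan σx lam γ σc τ σθ C' ≤ (kernel (linOp σx σθ lam τ χ hγ hσc)).map L20.subtype := by
  refine span_le.mpr ?_
  rintro _ (⟨ℓ, hℓ, rfl⟩ | ⟨ℓ, hℓ, rfl⟩) <;> have h0 := hC.ne_zero ℓ (hle hℓ)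
  · exact hC.mem_map_kernel hσx hσθ hγ hσc (hle hℓ) 1 fun m n => by
      simp [phaseCoeff_phi hσx hσθ h0]
  · exact hC.mem_map_kernel hσx hσθ hγ hσc (hle hℓ) Complex.I fun m n => by
      simp [phaseCoeff_phiBis hσx hσθ h0]

/-- A Fourier coefficient as a linear functional. -/
def phaseCoeffLin (m : Fin 2 → ℤ) (n : ℤ) : L2Phase →ₗ[ℝ] ℂ where
  toFun f := phaseCoeff f m n
  map_add' f g := phaseCoeff_add f g m n
  map_smul' a f := by rw [phaseCoeff_smul]; simp

lemma IsCritical.map_kernel (hC : IsCritical σx lam γ σc τ σθ χ C) (hσx : 0 < σx)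
    (hσθ : 0 < σθ) (hγ : 0 < γ) (hσc : 0 < σc) (hle : C' ⊆ C) (hcov : ∀ m ∈ C, m ∈ C' ∨ -m ∈ C')
    (hdis : ∀ m ∈ C', -m ∉ C') :
    (kernel (linOp σx σθ lam τ χ hγ hσc)).map L20.subtype = phiSpan σx lam γ σc τ σθ C' := by
  classical
  refine le_antisymm ?_ (hC.phiSpan_le hσx hσθ hγ hσc hle)
  rintro _ ⟨x, hx, rfl⟩
  -- φ^ℓ has coefficient 2π/χ at (ℓ,0), and φ^{bis ℓ} has i times that. The weights r Re z and r Im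
  -- z therefore reproduce z on C', where by `hdis` no other wave interferes.
  set r : ℝ := χ / (2 * Real.pi) with hr
  set z : (Fin 2 → ℤ) → ℂ := fun m => phaseCoeff (x : L2Phase) m 0 with hz
  set F : L2Phase := ∑ ℓ ∈ C', ((r * (z ℓ).re) • phi σx lam γ σc τ σθ ℓ
    + (r * (z ℓ).im) • phiBis σx lam γ σc τ σθ ℓ) with hF
  have hFS : F ∈ phiSpan σx lam γ σc τ σθ C' := sum_mem fun ℓ hℓ =>
    add_mem (Submodule.smul_mem _ _ (subset_span (Or.inl ⟨ℓ, hℓ, rfl⟩)))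
      (Submodule.smul_mem _ _ (subset_span (Or.inr ⟨ℓ, hℓ, rfl⟩)))
  obtain ⟨y, hy, hyF⟩ := hC.phiSpan_le hσx hσθ hγ hσc hle hFS
  have hFz : ∀ m ∈ C', phaseCoeff F m 0 = z m := fun m hm => by
    change phaseCoeffLin m 0 F = z m
    have hm0 := hC.ne_zero m (hle hm)
    rw [hF, map_sum, Finset.sum_eq_single_of_mem m hm]
    · change phaseCoeff _ m 0 = _
      have hne : m ≠ -m := fun h => hm0 (self_eq_neg.mp h)
      have hY := congrArg Complex.ofReal (hC.mul_radialMass m (hle hm))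
      push_cast at hY
      have hπ : (Real.pi : ℂ) ≠ 0 := Complex.ofReal_ne_zero.mpr Real.pi_ne_zero
      have hrπ : (r : ℂ) * (2 * Real.pi) = χ := by
        rw [hr]; push_cast; field_simp
      rw [phaseCoeff_add, phaseCoeff_smul, phaseCoeff_smul, phaseCoeff_phi hσx hσθ hm0,
        phaseCoeff_phiBis hσx hσθ hm0, if_pos rfl, if_pos rfl, if_neg hne, if_neg hne,
        angCoeff_modeU hσx hσθ hm0, kernelMode_zero hσx hσθ.le hm0]
      push_cast
      conv_rhs => rw [← Complex.re_add_im (z m)]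
      linear_combination ((z m).re + (z m).im * Complex.I) * hY
        + ((z m).re + (z m).im * Complex.I) * radialMass σx lam γ σc τ σθ (√(waveSq m)) * hrπ
    · intro ℓ hℓ hne
      change phaseCoeff _ m 0 = _
      have hℓ0 := hC.ne_zero ℓ (hle hℓ)
      have hn : m ≠ -ℓ := fun h => hdis ℓ hℓ (h ▸ hm)
      rw [phaseCoeff_add, phaseCoeff_smul, phaseCoeff_smul, phaseCoeff_phi hσx hσθ hℓ0,
        phaseCoeff_phiBis hσx hσθ hℓ0, if_neg hne.symm, if_neg hne.symm, if_neg hn, if_neg hn]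
      simp
  have hxy : x = y := hC.eq_of_mem_kernel hσx hσθ hγ hσc hx hy fun m hm => by
    rw [show (y : L2Phase) = F from hyF]
    rcases hcov m hm with h1 | h1
    · exact (hFz m h1).symm
    · have := hFz _ h1
      simp only [hz, phaseCoeff_conj, neg_zero] at this
      exact ((starRingEnd ℂ).injective this).symm
  rw [hxy, hyF]
  exact hFS

end

/-! ## The critical circle -/

/-- The nonzero lattice points on the circle of radius `k`. -/
def circlePoints (k : ℕ) : Set (Fin 2 → ℤ) := {m | m ≠ 0 ∧ m 0 ^ 2 + m 1 ^ 2 = (k : ℤ) ^ 2}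

lemma mem_circlePoints_iff {k : ℕ} {m : Fin 2 → ℤ} :
    m ∈ circlePoints k ↔ m ≠ 0 ∧ m 0 ^ 2 + m 1 ^ 2 = (k : ℤ) ^ 2 := Iff.rfl

lemma waveSq_of_mem_circlePoints {k : ℕ} {m : Fin 2 → ℤ} (h : m ∈ circlePoints k) :
    waveSq m = (k : ℝ) ^ 2 := by
  unfold waveSq
  exact_mod_cast h.2

lemma finite_circlePoints (k : ℕ) : (circlePoints k).Finite :=
  (finite_waveSq_le ((k : ℝ) ^ 2)).subset fun _ hm => (waveSq_of_mem_circlePoints hm).le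

lemma isCritical_circlePoints {σx lam γ σc τ σθ : ℝ} {k : ℕ} (hσx : 0 < σx) (hγ : 0 < γ)
    (hσc : 0 < σc) (hτ : 0 ≤ τ) (hσθ : 0 < σθ) (hY : 0 < radialMass σx lam γ σc τ σθ k)
    (hsep : ∀ N : ℕ, 1 ≤ N → N ≠ k ^ 2 →
      radialMass σx lam γ σc τ σθ (√N) ≠ radialMass σx lam γ σc τ σθ k) :
    IsCritical σx lam γ σc τ σθ (radialMass σx lam γ σc τ σθ k)⁻¹
      (finite_circlePoints k).toFinset := by
  refine isCritical_of_forall hσx hγ hσc hτ hσθ (fun m hm => ?_) (fun m hm => ?_) fun m hm => ?_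
  · exact ((finite_circlePoints k).mem_toFinset.mp hm).1
  · rw [Set.Finite.mem_toFinset] at hm ⊢
    exact ⟨neg_ne_zero.mpr hm.1, by simpa using hm.2⟩
  · rw [Set.Finite.mem_toFinset, inv_mul_eq_one₀ hY.ne']
    constructor
    · intro h
      refine ⟨hm, ?_⟩
      have h0 : 0 ≤ m 0 ^ 2 + m 1 ^ 2 := by positivity
      obtain ⟨N, hN⟩ := Int.eq_ofNat_of_zero_le h0
      have hW : waveSq m = N := by unfold waveSq; exact_mod_cast hN
      by_contra hne
      refine hsep N ?_ (fun e => hne ?_) ?_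
      · have := one_le_waveSq hm
        rw [hW] at this
        exact_mod_cast this
      · rw [hN, e]; push_cast; rfl
      · rw [← hW, h]
    · intro h
      rw [waveSq_of_mem_circlePoints h, Real.sqrt_sq (Nat.cast_nonneg k)]

lemma NonPythagorean.eq_or_neg {k : ℕ} (hk : NonPythagorean k) {m : Fin 2 → ℤ}
    (hm : m ∈ circlePoints k) :
    (m = ![(k : ℤ), 0] ∨ m = ![0, (k : ℤ)]) ∨ -m = ![(k : ℤ), 0] ∨ -m = ![0, (k : ℤ)] := by
  have h2 := hm.2
  by_cases h0 : m 0 = 0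
  · rw [h0] at h2
    have h3 : m 1 ^ 2 = (k : ℤ) ^ 2 := by linarith
    rcases sq_eq_sq_iff_eq_or_eq_neg.mp h3 with h | h
    · refine Or.inl (Or.inr (funext fun i => ?_)); fin_cases i <;> simp [h0, h]
    · refine Or.inr (Or.inr (funext fun i => ?_)); fin_cases i <;> simp [h0, h]
  · by_cases h1 : m 1 = 0
    · rw [h1] at h2
      have h3 : m 0 ^ 2 = (k : ℤ) ^ 2 := by linarith
      rcases sq_eq_sq_iff_eq_or_eq_neg.mp h3 with h | h
      · refine Or.inl (Or.inl (funext fun i => ?_)); fin_cases i <;> simp [h1, h]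
      · refine Or.inr (Or.inl (funext fun i => ?_)); fin_cases i <;> simp [h1, h]
    · refine absurd ?_ (hk (m 0).natAbs (m 1).natAbs (Int.natAbs_pos.mpr h0) (Int.natAbs_pos.mpr h1))
      zify
      rw [sq_abs, sq_abs, h2]

end AntModel
end
-- The theorem
theorem theorem4p4 (σx lam γ σc τ : ℝ) (hσx : 0 < σx) (hlam : 0 < lam) (hγ : 0 < γ) (hσc : 0 < σc)
    (hτ : 0 ≤ τ) (k : ℕ) (hk : 1 ≤ k) :
    ∃ σk : ℝ, 0 < σk ∧ ∀ σθ : ℝ, 0 < σθ → σθ < σk → ∃ χ : ℝ, 0 < χ ∧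
      let L : AntModel.L20 →ₗ.[ℝ] AntModel.L20 := AntModel.linOp σx σθ lam τ χ hγ hσc
      let k₁ : Fin 2 → ℤ := ![(k : ℤ), 0]
      let k₂ : Fin 2 → ℤ := ![0, (k : ℤ)]
      Module.finrank ℝ (AntModel.kernel L) = AntModel.latticeCount k ∧
      Module.finrank ℝ (AntModel.kernel L†) = AntModel.latticeCount k ∧
      Module.finrank ℝ (AntModel.L20 ⧸ AntModel.range L) = AntModel.latticeCount k ∧
      (AntModel.range L)ᗮ = AntModel.kernel L† ∧
      (AntModel.NonPythagorean k →
        (AntModel.kernel L).map AntModel.L20.subtype = Submodule.span ℝ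
          {AntModel.phi σx lam γ σc τ σθ k₁, AntModel.phi σx lam γ σc τ σθ k₂,
            AntModel.phiBis σx lam γ σc τ σθ k₁, AntModel.phiBis σx lam γ σc τ σθ k₂} ∧
        (AntModel.kernel L†).map AntModel.L20.subtype = Submodule.span ℝ
          {AntModel.psi σx lam σθ k₁, AntModel.psi σx lam σθ k₂,
            AntModel.psiBis σx lam σθ k₁, AntModel.psiBis σx lam σθ k₂}) := by
  classical
  obtain ⟨σk, hσk, h⟩ := AntModel.exists_diffusion_threshold hσx hlam hγ hσc hτ hk
  refine ⟨σk, hσk, fun σθ hσθ hlt => ?_⟩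
  obtain ⟨hY, hsep⟩ := h σθ hσθ hlt
  have hC := AntModel.isCritical_circlePoints hσx hγ hσc hτ hσθ hY hsep
  have hcard : (AntModel.finite_circlePoints k).toFinset.card = AntModel.latticeCount k :=
    (Set.ncard_eq_toFinset_card _ _).symm
  -- The critical sensitivity is the inverse of the radial mass at wave number k.
  refine ⟨_, inv_pos.mpr hY, ?_⟩
  intro L k₁ k₂
  refine ⟨(hC.finrank_kernel hσx hσθ hγ hσc).trans hcard,
    (hC.finrank_kernel_adjoint hσx hσθ hγ hσc).trans hcard,
    (hC.finrank_quotient_range hσx hσθ hγ hσc).trans hcard,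
    AntModel.orthogonal_range_eq_kernel_adjoint AntModel.dense_H20, fun hP => ?_⟩
  have hk0 : (k : ℤ) ≠ 0 := by exact_mod_cast (Nat.one_le_iff_ne_zero.mp hk)
  -- The next three facts say that k₁ and k₂ represent each pair ±m of the circle exactly once; the
  -- covering is the only place where k must be non-Pythagorean.
  have hle : ({k₁, k₂} : Finset (Fin 2 → ℤ)) ⊆ (AntModel.finite_circlePoints k).toFinset := by
    intro m hm
    rw [Set.Finite.mem_toFinset, AntModel.mem_circlePoints_iff]
    rcases Finset.mem_insert.mp hm with rfl | hm
    · exact ⟨fun e => hk0 (by simpa [k₁] using congrFun e 0), by simp [k₁]⟩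
    · rw [Finset.mem_singleton.mp hm]
      exact ⟨fun e => hk0 (by simpa [k₂] using congrFun e 1), by simp [k₂]⟩
  have hcov : ∀ m ∈ (AntModel.finite_circlePoints k).toFinset,
      m ∈ ({k₁, k₂} : Finset (Fin 2 → ℤ)) ∨ -m ∈ ({k₁, k₂} : Finset (Fin 2 → ℤ)) := fun m hm => by
    simpa [k₁, k₂] using hP.eq_or_neg ((Set.Finite.mem_toFinset _).mp hm)
  have hdis : ∀ m ∈ ({k₁, k₂} : Finset (Fin 2 → ℤ)), -m ∉ ({k₁, k₂} : Finset (Fin 2 → ℤ)) := by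
    have hn : -(k : ℤ) ≠ k := fun e => hk0 (neg_eq_self.mp e)
    intro m hm hm'
    simp only [Finset.mem_insert, Finset.mem_singleton] at hm hm'
    rcases hm with rfl | rfl <;> rcases hm' with e | e
    · exact hn (by simpa [k₁] using congrFun e 0)
    · exact hk0 (by simpa [k₁, k₂] using congrFun e 0)
    · exact hk0 (by simpa [k₁, k₂] using congrFun e 1)
    · exact hn (by simpa [k₂] using congrFun e 1)
  constructor
  · rw [hC.map_kernel hσx hσθ hγ hσc hle hcov hdis, AntModel.phiSpan, Finset.coe_pair,
      Set.image_pair, Set.image_pair, Set.insert_union, Set.singleton_union]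
  · rw [hC.map_kernel_adjoint hσx hσθ hγ hσc hle hcov, AntModel.psiSpan, Finset.coe_pair,
      Set.image_pair, Set.image_pair, Set.insert_union, Set.singleton_union]
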